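/- Let $G$ be a graph and let $\mathcal V$ be a partition of $V(G)$ into nonempty parts. A path system $\mathcal P$ in $G$ is a finite collection of pairwise vertex-disjoint paths in $G$. Its reduced multigraph $R_{\mathcal V}(\mathcal P)$ has vertex set $\mathcal V$ and has one edge between $U$ and $U'$ (a loop if $U=U'$) for each path of $\mathcal P$ whose two endpoints lie in $U$ and $U'$. The path system $\mathcal P$ is called $\mathcal V$-connecting if $R_{\mathcal V}(\mathcal P)$ is Eulerian, i.e. it is nonempty, connected and all its vertices have even degree (loops counting twice). There is a single deterministic algorithm which, given a graph $G$ on $n$ vertices (as an adjacency matrix) and a partition $\mathcal V$ of $V(G)$ with $|\mathcal V|=m$ (as a list giving the part of each vertex), determines whether $G$ has a $\mathcal V$-connecting path system and, if it has one, outputs a $\mathcal V$-connecting path system with at most $m^2-m$ edges in total. On a word RAM with words of $O(\log (n+2))$ bits and unit-cost operations, the algorithm runs in time $$m^{O(m^2)}+O\!\left(m^2 n^{5/2}\right),$$ where the implied constants are absolute; precisely, there is a constant $C$ such that for all $n,m\ge 0$ the running time is at most $C\,m^{C m^2}+C\,m^2 n^{5/2}$ (with $0^0=1$). -/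

import Mathlib

namespace PathSystems

/-! ### Path systems, reduced multigraphs and connecting path systems -/

/-- A path in a graph, together with its two endpoints (a path of length `0` is allowed). -/
structure PathIn {V : Type*} (G : SimpleGraph V) where
  src : V
  tgt : V
  path : G.Path src tgt

/-- The vertices of a path, listed from one end to the other. -/
def PathIn.verts {V : Type*} {G : SimpleGraph V} (p : PathIn G) : List V :=
  p.path.1.support

/-- A path system: a finite collection of pairwise vertex-disjoint paths in `G`. -/
structure PathSystem {V : Type*} (G : SimpleGraph V) where
  paths : List (PathIn G)
  disjoint : paths.Pairwise fun p q => p.verts.Disjoint q.verts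

/-- The number of edges of a path system. -/
def PathSystem.edgeCount {V : Type*} {G : SimpleGraph V} (P : PathSystem G) : ℕ :=
  (P.paths.map fun p => p.path.1.length).sum

/-- The reduced multigraph of a path system with respect to the partition of `V` into the fibres
of `part : V → ι`. Its vertices are the parts (named by their indices), and every path of the system
gives one edge, which joins the parts containing the two endpoints of the path. -/
def PathSystem.reducedMultigraph {V ι : Type*} {G : SimpleGraph V} (P : PathSystem G)
    (part : V → ι) : Graph ι (Fin P.paths.length) where
  vertexSet := Set.univ
  IsLink e x y := s(part (P.paths.get e).src, part (P.paths.get e).tgt) = s(x, y)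
  isLink_symm := fun _ _ => ⟨fun _ _ h => h.trans Sym2.eq_swap⟩
  eq_or_eq_of_isLink_of_isLink := by
    intro e x y v w h h'
    have := Sym2.eq_iff.1 (h.symm.trans h')
    tauto
  left_mem_of_isLink := fun _ _ _ _ => Set.mem_univ _

/-- The degree of a vertex of a multigraph; a loop counts twice. -/
noncomputable def multiDegree {α β : Type*} (H : Graph α β) (x : α) : ℕ :=
  {e | H.IsNonloopAt e x}.ncard + 2 * {e | H.IsLoopAt e x}.ncard

/-- A multigraph is connected if it has a vertex and any two of its vertices are joined
by a walk. -/
def MultiConnected {α β : Type*} (H : Graph α β) : Prop :=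
  H.vertexSet.Nonempty ∧
    ∀ x ∈ H.vertexSet, ∀ y ∈ H.vertexSet, Relation.ReflTransGen H.Adj x y

/-- A (finite) multigraph is Eulerian if it is connected and all its degrees are even. -/
def IsEulerian {α β : Type*} (H : Graph α β) : Prop :=
  MultiConnected H ∧ ∀ x ∈ H.vertexSet, Even (multiDegree H x)

/-- A path system is connecting, with respect to the partition into the fibres of `part`, if its
reduced multigraph is Eulerian. -/
def PathSystem.IsConnecting {V ι : Type*} {G : SimpleGraph V} (P : PathSystem G)
    (part : V → ι) : Prop :=
  IsEulerian (P.reducedMultigraph part)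

/-! ### A word RAM with unit cost

The memory consists of registers and of arrays, all of whose cells hold natural numbers. (A program
mentions only finitely many registers and arrays.) -/

/-- A memory state: `reg r` is the content of register `r`, and `arr k i` is entry number `i`
of array `k`. -/
@[ext]
structure State where
  reg : ℕ → ℕ
  arr : ℕ → ℕ → ℕ

/-- Write `x` to register `r`. -/
def State.setReg (σ : State) (r x : ℕ) : State :=
  { σ with reg := Function.update σ.reg r x }

/-- Write `x` to entry `i` of array `k`. -/
def State.setArr (σ : State) (k i x : ℕ) : State :=
  { σ with arr := Function.update σ.arr k (Function.update (σ.arr k) i x) }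

/-- A test comparing the contents of two registers. -/
inductive Test where
  | lt (a b : ℕ)
  | eq (a b : ℕ)

/-- The condition that is checked by a test. -/
def Test.Holds (σ : State) : Test → Prop
  | .lt a b => σ.reg a < σ.reg b
  | .eq a b => σ.reg a = σ.reg b

/-- Programs. The arguments are names of registers and of arrays, except for the literal `c`
in `const r c`. -/
inductive Prog where
  /-- Do nothing. -/
  | skip
  /-- `reg r := c` -/
  | const (r c : ℕ)
  /-- `reg r := reg a` -/
  | copy (r a : ℕ)
  /-- `reg r := reg a + reg b` -/
  | add (r a b : ℕ)
  /-- `reg r := reg a - reg b`, truncated at `0` -/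
  | sub (r a b : ℕ)
  /-- `reg r := reg a * reg b` -/
  | mul (r a b : ℕ)
  /-- `reg r := arr k (reg a)` -/
  | load (r k a : ℕ)
  /-- `arr k (reg a) := reg b` -/
  | store (k a b : ℕ)
  /-- First `p`, then `q`. -/
  | seq (p q : Prog)
  /-- If the test holds then `p`, otherwise `q`. -/
  | cond (t : Test) (p q : Prog)
  /-- As long as the test holds, repeat `p`. -/
  | loop (t : Test) (p : Prog)

/-- `Exec B p σ t σ'`: on a machine whose words are the numbers below `B`, the program `p`, started
in the state `σ`, halts after exactly `t` steps in the state `σ'`. Every elementary instruction and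
every evaluation of a test is one step. An operation whose result is not a word has no outcome
(the machine crashes). -/
inductive Exec (B : ℕ) : Prog → State → ℕ → State → Prop where
  | skip (σ : State) : Exec B .skip σ 1 σ
  | const (σ : State) (r c : ℕ) (h : c < B) :
      Exec B (.const r c) σ 1 (σ.setReg r c)
  | copy (σ : State) (r a : ℕ) :
      Exec B (.copy r a) σ 1 (σ.setReg r (σ.reg a))
  | add (σ : State) (r a b : ℕ) (h : σ.reg a + σ.reg b < B) :
      Exec B (.add r a b) σ 1 (σ.setReg r (σ.reg a + σ.reg b))
  | sub (σ : State) (r a b : ℕ) :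
      Exec B (.sub r a b) σ 1 (σ.setReg r (σ.reg a - σ.reg b))
  | mul (σ : State) (r a b : ℕ) (h : σ.reg a * σ.reg b < B) :
      Exec B (.mul r a b) σ 1 (σ.setReg r (σ.reg a * σ.reg b))
  | load (σ : State) (r k a : ℕ) :
      Exec B (.load r k a) σ 1 (σ.setReg r (σ.arr k (σ.reg a)))
  | store (σ : State) (k a b : ℕ) :
      Exec B (.store k a b) σ 1 (σ.setArr k (σ.reg a) (σ.reg b))
  | seq {p q : Prog} {σ₁ σ₂ σ₃ : State} {s t : ℕ} (hp : Exec B p σ₁ s σ₂)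
      (hq : Exec B q σ₂ t σ₃) : Exec B (.seq p q) σ₁ (s + t) σ₃
  | cond_true {c : Test} {p q : Prog} {σ σ' : State} {t : ℕ} (hc : c.Holds σ)
      (hp : Exec B p σ t σ') : Exec B (.cond c p q) σ (t + 1) σ'
  | cond_false {c : Test} {p q : Prog} {σ σ' : State} {t : ℕ} (hc : ¬ c.Holds σ)
      (hq : Exec B q σ t σ') : Exec B (.cond c p q) σ (t + 1) σ'
  | loop_false {c : Test} {p : Prog} {σ : State} (hc : ¬ c.Holds σ) :
      Exec B (.loop c p) σ 1 σ
  | loop_true {c : Test} {p : Prog} {σ₁ σ₂ σ₃ : State} {s t : ℕ} (hc : c.Holds σ₁)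
      (hp : Exec B p σ₁ s σ₂) (hl : Exec B (.loop c p) σ₂ t σ₃) :
      Exec B (.loop c p) σ₁ (s + t + 1) σ₃

/-- The machine is deterministic: a program has at most one halting run from a given state. -/
theorem Exec.unique {B : ℕ} {p : Prog} {σ σ₁ σ₂ : State} {t₁ t₂ : ℕ}
    (h₁ : Exec B p σ t₁ σ₁) (h₂ : Exec B p σ t₂ σ₂) : t₁ = t₂ ∧ σ₁ = σ₂ := by
  induction h₁ generalizing t₂ σ₂ with
  | seq _ _ ihp ihq =>
    cases h₂ with
    | seq hp' hq' =>
      obtain ⟨rfl, rfl⟩ := ihp hp'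
      obtain ⟨rfl, rfl⟩ := ihq hq'
      exact ⟨rfl, rfl⟩
  | cond_true hc _ ih =>
    cases h₂ with
    | cond_true _ hp' => obtain ⟨rfl, rfl⟩ := ih hp'; exact ⟨rfl, rfl⟩
    | cond_false hc' _ => exact absurd hc hc'
  | cond_false hc _ ih =>
    cases h₂ with
    | cond_true hc' _ => exact absurd hc' hc
    | cond_false _ hp' => obtain ⟨rfl, rfl⟩ := ih hp'; exact ⟨rfl, rfl⟩
  | loop_false hc =>
    cases h₂ with
    | loop_false _ => exact ⟨rfl, rfl⟩
    | loop_true hc' _ _ => exact absurd hc' hc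
  | loop_true hc _ _ ihp ihl =>
    cases h₂ with
    | loop_false hc' => exact absurd hc hc'
    | loop_true _ hp' hl' =>
      obtain ⟨rfl, rfl⟩ := ihp hp'
      obtain ⟨rfl, rfl⟩ := ihl hl'
      exact ⟨rfl, rfl⟩
  | _ => cases h₂; exact ⟨rfl, rfl⟩

/-! ### Input and output -/

open Classical in
/-- The initial state for a graph on the vertices `0, …, n - 1` whose vertices are partitioned into
`m` parts: register `0` holds `n`, register `1` holds `m`, array `0` holds the adjacency matrix
row by row, array `1` holds the index of the part of each vertex, and everything else is `0`. -/
noncomputable def inputState {n m : ℕ} (G : SimpleGraph (Fin n)) (part : Fin n → Fin m) :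
    State where
  reg := fun r => if r = 0 then n else if r = 1 then m else 0
  arr := fun k i =>
    if k = 0 then (if ∃ u v : Fin n, i = u.val * n + v.val ∧ G.Adj u v then 1 else 0)
    else if k = 1 then (if h : i < n then (part ⟨i, h⟩).val else 0)
    else 0

/-- A path system written as a list of numbers: path after path, each given by its vertices in
order (vertex `v` as `v + 1`) and terminated by a `0`. -/
def PathSystem.encode {n : ℕ} {G : SimpleGraph (Fin n)} (P : PathSystem G) : List ℕ :=
  P.paths.flatMap fun p => p.verts.map (fun v => v.val + 1) ++ [0]

/-- The output of a halted machine is the initial segment of array `2` whose length is in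
register `1`. -/
def State.output (σ : State) : List ℕ :=
  (List.range (σ.reg 1)).map (σ.arr 2)

/-- The final state `σ` solves the problem for `G` and `part`: if there is a connecting path system,
then register `0` holds `1` and the output is a connecting path system with at most `m ^ 2 - m`
edges; otherwise register `0` holds `0`. -/
def Solves {n m : ℕ} (G : SimpleGraph (Fin n)) (part : Fin n → Fin m) (σ : State) : Prop :=
  ((∃ P : PathSystem G, P.IsConnecting part) →
    σ.reg 0 = 1 ∧ ∃ P : PathSystem G, P.IsConnecting part ∧ P.edgeCount ≤ m ^ 2 - m ∧
      σ.output = P.encode) ∧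
  ((¬ ∃ P : PathSystem G, P.IsConnecting part) → σ.reg 0 = 0)

end PathSystems

namespace PathSystems

/-! ### Reasoning about programs -/

/-! Write M = m² - m. The proof has a combinatorial half and a half that verifies a concrete
program.

Short systems (`IsGood.exists_stepSum_le`). Take a connecting system that minimises `cost`. If a
path meets the same part twice, cut it at these two vertices and discard what lies between: in the
reduced multigraph this only subdivides an edge, so it stays Eulerian and the cost drops. Hence in a
minimal system every path crosses each pair of parts at most once. If three paths each have a step
between the parts U and W, then two of the three steps can be deleted without losing Eulerianity
(`EdgeEulerian.cutTwo`). Degrees stay even automatically; if each of the three choices disconnected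
the multigraph, the three separating sets would contradict the parity of edge ends in a union of
components. So each of the m(m-1)/2 pairs of parts is crossed at most twice, which gives M edges.

Few relevant edges (`IsSparse.isKernel`, `IsGood.exists_in_kernel`). A system with at most M edges
and no trivial paths has at most 2M vertices. Scan all edges uv greedily, skipping one if u already
has 2M + 1 kept neighbours in the part of v, or the other way round, or if 4M(2M + 1) + 1 edges
between the two parts are already kept. A skipped edge xy used by the system can be traded for a
kept edge with the same parts that shares with the system at most one vertex, x or y: delete xy, and
attach the new edge at x, or at y, or leave it as a separate path. Each time the reduced edge is
merely subdivided, and the number of edges is unchanged. So a system with at most M edges exists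
among the kept edges as soon as one exists at all, and only O(m⁶) edges are kept.

Search. A system of at most M kept edges without trivial paths is coded by at most 3M tokens, each
being the terminator or an end of a kept edge. Thus m^{O(m²)} candidate strings suffice, and each is
checked directly against the original graph in time polynomial in m, so there are no false
positives. The scan costs O(n²), which is below the permitted m² n^{5/2}.

Verification rests on `Runs`, a total correctness triple with a time budget, on the frame property
`Exec.agree`, and on the rule `Runs.forTo` for counting loops. Throughout, register `2` holds the
constant 0 and register `3` the constant 1. Values that are stored grow polynomially in n, so words
below a power of n + 2 suffice. -/

/-- From `σ`, the program `p` halts within `T` steps in a state satisfying `Q`. -/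
def Runs (B : ℕ) (p : Prog) (σ : State) (T : ℕ) (Q : State → Prop) : Prop :=
  ∃ t σ', Exec B p σ t σ' ∧ t ≤ T ∧ Q σ'

/-- Run the programs of a list one after another. -/
def block : List Prog → Prog
  | [] => .skip
  | p :: ps => .seq p (block ps)

/-- The registers that a program may write to. -/
def Prog.wregs : Prog → List ℕ
  | .skip => []
  | .const r _ => [r]
  | .copy r _ => [r]
  | .add r _ _ => [r]
  | .sub r _ _ => [r]
  | .mul r _ _ => [r]
  | .load r _ _ => [r]
  | .store _ _ _ => []
  | .seq p q => p.wregs ++ q.wregs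
  | .cond _ p q => p.wregs ++ q.wregs
  | .loop _ p => p.wregs

/-- The arrays that a program may write to. -/
def Prog.warrs : Prog → List ℕ
  | .store k _ _ => [k]
  | .seq p q => p.warrs ++ q.warrs
  | .cond _ p q => p.warrs ++ q.warrs
  | .loop _ p => p.warrs
  | _ => []

/-- Two states agree on everything that `p` does not write to. -/
structure Agree (p : Prog) (σ σ' : State) : Prop where
  reg : ∀ r, r ∉ p.wregs → σ'.reg r = σ.reg r
  arr : ∀ k, k ∉ p.warrs → σ'.arr k = σ.arr k

theorem Agree.refl (p : Prog) (σ : State) : Agree p σ σ := ⟨fun _ _ => rfl, fun _ _ => rfl⟩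

theorem Agree.trans {p : Prog} {σ σ' σ'' : State} (h : Agree p σ σ') (h' : Agree p σ' σ'') :
    Agree p σ σ'' :=
  ⟨fun r hr => (h'.reg r hr).trans (h.reg r hr), fun k hk => (h'.arr k hk).trans (h.arr k hk)⟩

theorem Agree.mono {p q : Prog} {σ σ' : State} (h : Agree p σ σ') (hr : p.wregs ⊆ q.wregs)
    (ha : p.warrs ⊆ q.warrs) : Agree q σ σ' :=
  ⟨fun r h' => h.reg r fun h'' => h' (hr h''), fun k h' => h.arr k fun h'' => h' (ha h'')⟩

@[simp] theorem State.reg_setReg (σ : State) (r x r' : ℕ) :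
    (σ.setReg r x).reg r' = if r' = r then x else σ.reg r' := by
  simp [State.setReg, Function.update_apply]

@[simp] theorem State.arr_setReg (σ : State) (r x : ℕ) : (σ.setReg r x).arr = σ.arr := rfl

@[simp] theorem State.reg_setArr (σ : State) (k i x : ℕ) : (σ.setArr k i x).reg = σ.reg := rfl

@[simp] theorem State.arr_setArr (σ : State) (k i x k' i' : ℕ) :
    (σ.setArr k i x).arr k' i' = if k' = k ∧ i' = i then x else σ.arr k' i' := by
  by_cases h : k' = k
  · subst h; simp [State.setArr, Function.update_apply]
  · simp [State.setArr, h]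

theorem State.arr_setArr_of_ne (σ : State) {k k' : ℕ} (i x : ℕ) (h : k' ≠ k) :
    (σ.setArr k i x).arr k' = σ.arr k' := by
  simp [State.setArr, h]

theorem Exec.agree {B : ℕ} {p : Prog} {σ σ' : State} {t : ℕ} (h : Exec B p σ t σ') :
    Agree p σ σ' := by
  induction h with
  | skip | loop_false => exact Agree.refl _ _
  | const | copy | add | sub | mul | load =>
    exact ⟨fun r hr => by simp_all [Prog.wregs], fun _ _ => rfl⟩
  | store =>
    exact ⟨fun _ _ => rfl, fun k hk => State.arr_setArr_of_ne _ _ _ (by simpa [Prog.warrs] using hk)⟩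
  | seq _ _ ih ih' =>
    exact (ih.mono (by simp [Prog.wregs]) (by simp [Prog.warrs])).trans
      (ih'.mono (by simp [Prog.wregs]) (by simp [Prog.warrs]))
  | cond_true _ _ ih => exact ih.mono (by simp [Prog.wregs]) (by simp [Prog.warrs])
  | cond_false _ _ ih => exact ih.mono (by simp [Prog.wregs]) (by simp [Prog.warrs])
  | loop_true _ _ _ ih ih' =>
    exact (ih.mono (by simp [Prog.wregs]) (by simp [Prog.warrs])).trans ih'

/-- The new postcondition may use `Agree`. This is the frame rule: specifications only mention what
a program changes, and everything else is recovered from its write sets. -/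
theorem Runs.mono {B T T' : ℕ} {p : Prog} {σ : State} {Q Q' : State → Prop}
    (h : Runs B p σ T Q) (hT : T ≤ T') (hQ : ∀ σ', Agree p σ σ' → Q σ' → Q' σ') :
    Runs B p σ T' Q' := by
  obtain ⟨t, σ', h1, h2, h3⟩ := h
  exact ⟨t, σ', h1, h2.trans hT, hQ _ h1.agree h3⟩

theorem Runs.cons {B T₁ T₂ T : ℕ} {p : Prog} {ps : List Prog} {σ : State} {Q₁ Q : State → Prop}
    (h : Runs B p σ T₁ Q₁)
    (h' : ∀ σ', Agree p σ σ' → Q₁ σ' → Runs B (block ps) σ' T₂ Q) (hT : T₁ + T₂ ≤ T) :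
    Runs B (block (p :: ps)) σ T Q := by
  obtain ⟨t, σ', h1, h2, h3⟩ := h
  obtain ⟨t', σ'', h1', h2', h3'⟩ := h' _ h1.agree h3
  exact ⟨t + t', σ'', .seq h1 h1', by omega, h3'⟩

@[simp] theorem runs_block_nil {B T : ℕ} {σ : State} {Q : State → Prop} :
    Runs B (block []) σ (T + 1) Q ↔ Q σ := by
  constructor
  · rintro ⟨t, σ', h, -, hQ⟩
    cases h; exact hQ
  · intro h
    exact ⟨1, σ, .skip σ, by omega, h⟩

/-- The equivalence lets `simp` execute straight-line code symbolically, each instruction consuming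
one unit of the budget. Overflow conditions then remain as side goals. -/
theorem runs_cons_iff {B T : ℕ} {p : Prog} {ps : List Prog} {σ σ' : State}
    {Q : State → Prop} (h : Exec B p σ 1 σ') :
    Runs B (block (p :: ps)) σ (T + 1) Q ↔ Runs B (block ps) σ' T Q := by
  constructor
  · rintro ⟨t, τ, hE, ht, hQ⟩
    cases hE with
    | seq h1 h2 =>
      obtain ⟨rfl, rfl⟩ := h.unique h1
      exact ⟨_, _, h2, by omega, hQ⟩
  · rintro ⟨t, τ, hE, ht, hQ⟩
    exact ⟨1 + t, τ, .seq h hE, by omega, hQ⟩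

@[simp] theorem runs_copy {B T r a : ℕ} {ps : List Prog} {σ : State} {Q : State → Prop} :
    Runs B (block (.copy r a :: ps)) σ (T + 1) Q ↔
      Runs B (block ps) (σ.setReg r (σ.reg a)) T Q :=
  runs_cons_iff (.copy σ r a)

@[simp] theorem runs_sub {B T r a b : ℕ} {ps : List Prog} {σ : State} {Q : State → Prop} :
    Runs B (block (.sub r a b :: ps)) σ (T + 1) Q ↔
      Runs B (block ps) (σ.setReg r (σ.reg a - σ.reg b)) T Q :=
  runs_cons_iff (.sub σ r a b)

@[simp] theorem runs_load {B T r k a : ℕ} {ps : List Prog} {σ : State} {Q : State → Prop} :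
    Runs B (block (.load r k a :: ps)) σ (T + 1) Q ↔
      Runs B (block ps) (σ.setReg r (σ.arr k (σ.reg a))) T Q :=
  runs_cons_iff (.load σ r k a)

@[simp] theorem runs_store {B T k a b : ℕ} {ps : List Prog} {σ : State} {Q : State → Prop} :
    Runs B (block (.store k a b :: ps)) σ (T + 1) Q ↔
      Runs B (block ps) (σ.setArr k (σ.reg a) (σ.reg b)) T Q :=
  runs_cons_iff (.store σ k a b)

@[simp] theorem runs_const {B T r c : ℕ} {ps : List Prog} {σ : State} {Q : State → Prop} :
    Runs B (block (.const r c :: ps)) σ (T + 1) Q ↔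
      c < B ∧ Runs B (block ps) (σ.setReg r c) T Q := by
  constructor
  · intro h
    obtain ⟨t, τ, hE, ht, hQ⟩ := id h
    cases hE with
    | seq h1 h2 =>
      have hc : c < B := by cases h1; assumption
      exact ⟨hc, (runs_cons_iff (.const σ r c hc)).1 h⟩
  · rintro ⟨hc, h⟩
    exact (runs_cons_iff (.const σ r c hc)).2 h

@[simp] theorem runs_add {B T r a b : ℕ} {ps : List Prog} {σ : State} {Q : State → Prop} :
    Runs B (block (.add r a b :: ps)) σ (T + 1) Q ↔
      σ.reg a + σ.reg b < B ∧ Runs B (block ps) (σ.setReg r (σ.reg a + σ.reg b)) T Q := by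
  constructor
  · intro h
    obtain ⟨t, τ, hE, ht, hQ⟩ := id h
    cases hE with
    | seq h1 h2 =>
      have hc : σ.reg a + σ.reg b < B := by cases h1; assumption
      exact ⟨hc, (runs_cons_iff (.add σ r a b hc)).1 h⟩
  · rintro ⟨hc, h⟩
    exact (runs_cons_iff (.add σ r a b hc)).2 h

@[simp] theorem runs_mul {B T r a b : ℕ} {ps : List Prog} {σ : State} {Q : State → Prop} :
    Runs B (block (.mul r a b :: ps)) σ (T + 1) Q ↔
      σ.reg a * σ.reg b < B ∧ Runs B (block ps) (σ.setReg r (σ.reg a * σ.reg b)) T Q := by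
  constructor
  · intro h
    obtain ⟨t, τ, hE, ht, hQ⟩ := id h
    cases hE with
    | seq h1 h2 =>
      have hc : σ.reg a * σ.reg b < B := by cases h1; assumption
      exact ⟨hc, (runs_cons_iff (.mul σ r a b hc)).1 h⟩
  · rintro ⟨hc, h⟩
    exact (runs_cons_iff (.mul σ r a b hc)).2 h

theorem Exec.pos {B : ℕ} {p : Prog} {σ σ' : State} {t : ℕ} (h : Exec B p σ t σ') : 0 < t := by
  induction h <;> omega

/-- The first block ends in a `skip` that is absent from the concatenation; this is the unit
subtracted by writing its time as `s + 1`. -/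
theorem exec_block_append {B : ℕ} {ps qs : List Prog} {σ σ'' : State} {t : ℕ} :
    Exec B (block (ps ++ qs)) σ t σ'' ↔ ∃ s u σ', Exec B (block ps) σ (s + 1) σ' ∧
      Exec B (block qs) σ' u σ'' ∧ t = s + u := by
  induction ps generalizing σ t with
  | nil =>
    constructor
    · intro h
      exact ⟨0, t, σ, .skip σ, h, by omega⟩
    · rintro ⟨s, u, σ', h1, h2, rfl⟩
      cases h1
      simpa using h2
  | cons p ps ih =>
    constructor
    · intro h
      cases h with
      | @seq _ _ _ _ _ a _ h1 h2 =>
        obtain ⟨s, u, σ', h3, h4, rfl⟩ := ih.1 h2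
        have := Exec.seq h1 h3
        exact ⟨a + s, u, σ', this, h4, by omega⟩
    · rintro ⟨s, u, σ', h1, h2, rfl⟩
      generalize hs : s + 1 = s' at h1
      cases h1 with
      | @seq _ _ _ τ _ a b h3 h4 =>
        obtain ⟨b', rfl⟩ := Nat.exists_eq_succ_of_ne_zero h4.pos.ne'
        have := ih.2 ⟨b', u, σ', h4, h2, rfl⟩
        have := Exec.seq h3 this
        obtain rfl : s = a + b' := by omega
        rwa [add_assoc]

/-- A branching followed by more instructions. -/
@[simp] theorem runs_cond {B T : ℕ} {c : Test} {ps qs rs : List Prog} {σ : State}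
    {Q : State → Prop} :
    Runs B (block (.cond c (block ps) (block qs) :: rs)) σ (T + 2) Q ↔
      (c.Holds σ → Runs B (block (ps ++ rs)) σ T Q) ∧
        (¬ c.Holds σ → Runs B (block (qs ++ rs)) σ T Q) := by
  have key : ∀ {ps : List Prog}, (∃ t u σ' σ'', Exec B (block ps) σ t σ' ∧
      Exec B (block rs) σ' u σ'' ∧ t + 1 + u ≤ T + 2 ∧ Q σ'') ↔
      Runs B (block (ps ++ rs)) σ T Q := by
    intro ps
    constructor
    · rintro ⟨t, u, σ', σ'', h1, h2, h3, h4⟩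
      obtain ⟨s, rfl⟩ := Nat.exists_eq_succ_of_ne_zero h1.pos.ne'
      exact ⟨_, σ'', exec_block_append.2 ⟨s, u, σ', h1, h2, rfl⟩, by omega, h4⟩
    · rintro ⟨t, σ'', h1, h2, h3⟩
      obtain ⟨s, u, σ', h4, h5, rfl⟩ := exec_block_append.1 h1
      exact ⟨_, u, σ', σ'', h4, h5, by omega, h3⟩
  by_cases hc : c.Holds σ
  · simp only [hc, true_implies, not_true, false_implies, and_true]
    rw [← key]
    constructor
    · rintro ⟨t, τ, hE, ht, hQ⟩
      cases hE with
      | seq h1 h2 =>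
        cases h1 with
        | cond_true _ h1 => exact ⟨_, _, _, _, h1, h2, ht, hQ⟩
        | cond_false hc' _ => exact absurd hc hc'
    · rintro ⟨t, u, σ', σ'', h1, h2, h3, h4⟩
      exact ⟨_, _, .seq (.cond_true hc h1) h2, h3, h4⟩
  · simp only [hc, false_implies, not_false_eq_true, true_implies, true_and]
    rw [← key]
    constructor
    · rintro ⟨t, τ, hE, ht, hQ⟩
      cases hE with
      | seq h1 h2 =>
        cases h1 with
        | cond_true hc' h1 => exact absurd hc' hc
        | cond_false _ h1 => exact ⟨_, _, _, _, h1, h2, ht, hQ⟩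
    · rintro ⟨t, u, σ', σ'', h1, h2, h3, h4⟩
      exact ⟨_, _, .seq (.cond_false hc h1) h2, h3, h4⟩

@[simp] theorem holds_lt {σ : State} {a b : ℕ} :
    (Test.lt a b).Holds σ ↔ σ.reg a < σ.reg b := Iff.rfl

@[simp] theorem holds_eq {σ : State} {a b : ℕ} :
    (Test.eq a b).Holds σ ↔ σ.reg a = σ.reg b := Iff.rfl

/-- Repeat `ps` while register `i`, which is increased by register `3` each time, is less than
register `n`. -/
def forTo (i n : ℕ) (ps : List Prog) : Prog :=
  .loop (.lt i n) (block (ps ++ [.add i i 3]))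

theorem wregs_block_append (ps qs : List Prog) :
    (block (ps ++ qs)).wregs = (block ps).wregs ++ (block qs).wregs := by
  induction ps with
  | nil => simp [block, Prog.wregs]
  | cons p ps ih => simp [block, Prog.wregs, ih]

/-- The rule for counting loops, with an invariant `I`. -/
theorem Runs.forTo {B T N i n : ℕ} {ps : List Prog} {σ₀ : State} (I : ℕ → State → Prop)
    (hi : i ∉ (block ps).wregs) (hn : n ∉ (block ps).wregs) (h3 : 3 ∉ (block ps).wregs)
    (hin : n ≠ i) (hi3 : 3 ≠ i) (hB : N < B)
    (h0 : σ₀.reg i = 0) (hN : σ₀.reg n = N) (h1 : σ₀.reg 3 = 1) (hI : I 0 σ₀)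
    (step : ∀ k < N, ∀ σ, Agree (PathSystems.forTo i n ps) σ₀ σ → σ.reg i = k → I k σ →
      Runs B (block ps) σ T fun σ' => I (k + 1) (σ'.setReg i (k + 1))) :
    Runs B (PathSystems.forTo i n ps) σ₀ (N * (T + 2) + 1)
      fun σ' => I N σ' ∧ σ'.reg i = N := by
  -- Induction on the number `j` of iterations still to come. A round costs the body, one addition
  -- and one test, hence `T + 2`; the final failing test gives the `+ 1`.
  have main : ∀ j k σ, k + j = N → Agree (PathSystems.forTo i n ps) σ₀ σ → σ.reg i = k →
      I k σ → Runs B (PathSystems.forTo i n ps) σ (j * (T + 2) + 1)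
        fun σ' => I N σ' ∧ σ'.reg i = N := by
    have hnw : n ∉ (PathSystems.forTo i n ps).wregs := by
      simp [PathSystems.forTo, Prog.wregs, wregs_block_append, block, hn, hin]
    have h3w : 3 ∉ (PathSystems.forTo i n ps).wregs := by
      simp [PathSystems.forTo, Prog.wregs, wregs_block_append, block, h3, hi3]
    intro j
    induction j with
    | zero =>
      intro k σ hk hA hik hIk
      obtain rfl : k = N := by omega
      refine ⟨1, σ, .loop_false ?_, by omega, hIk, hik⟩
      rw [holds_lt, hik, hA.reg n hnw, hN]
      omega
    | succ j ih =>
      intro k σ hk hA hik hIk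
      obtain ⟨t, τ, hE, ht, hτ⟩ := step k (by omega) σ hA hik hIk
      have hτi : τ.reg i = k := by rw [hE.agree.reg i hi, hik]
      have hτ3 : τ.reg 3 = 1 := by rw [hE.agree.reg 3 h3, hA.reg 3 h3w, h1]
      have hadd : Exec B (.add i i 3) τ 1 (τ.setReg i (k + 1)) := by
        have := Exec.add (B := B) τ i i 3 (by rw [hτi, hτ3]; omega)
        rwa [hτi, hτ3] at this
      have hbody : Exec B (block (ps ++ [.add i i 3])) σ (t + 1) (τ.setReg i (k + 1)) := by
        obtain ⟨s, rfl⟩ := Nat.exists_eq_succ_of_ne_zero hE.pos.ne'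
        exact exec_block_append.2 ⟨s, 2, τ, hE, .seq hadd (.skip _), rfl⟩
      have hA' : Agree (PathSystems.forTo i n ps) σ (τ.setReg i (k + 1)) :=
        hbody.agree.mono (fun _ h => h) (fun _ h => h)
      obtain ⟨t', τ', hE', ht', hQ'⟩ := ih (k + 1) (τ.setReg i (k + 1)) (by omega)
        (hA.trans hA') (by simp) hτ
      refine ⟨t + 1 + t' + 1, τ', .loop_true ?_ hbody hE', ?_, hQ'⟩
      · rw [holds_lt, hik, hA.reg n hnw, hN]
        omega
      · rw [add_mul]; omega
  exact main N 0 σ₀ (by omega) (Agree.refl _ _) h0 hI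

/-! ### Multisets of edges -/

/-- The degree of `x`, given the multiset of edges. -/
def edgeDegree {ι : Type*} [DecidableEq ι] (E : Multiset (ι × ι)) (x : ι) : ℕ :=
  (E.map Prod.fst).count x + (E.map Prod.snd).count x

/-- A multiset of edges is connected: every set which no edge leaves or enters is trivial. -/
def EdgeConn {ι : Type*} (E : Multiset (ι × ι)) : Prop :=
  ∀ C : ι → Prop, (∀ e ∈ E, C e.1 ↔ C e.2) → ∀ x y, C x → C y

/-- All degrees are even and the edges connect everything. -/
def EdgeEulerian {ι : Type*} [DecidableEq ι] (E : Multiset (ι × ι)) : Prop :=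
  (∀ x, Even (edgeDegree E x)) ∧ EdgeConn E

/-- A set witnessing that the redirected multigraph is disconnected must separate `U` from `W`,
since otherwise it would already be closed for the original edges. After complementing, `U` lies
inside and `W` outside, which forces the tails of the two redirected edges in and their heads out.
-/
theorem exists_separating {ι : Type*} {E : Multiset (ι × ι)} {a₁ a₂ a₃ b₁ b₂ b₃ U W : ι}
    (h : EdgeConn ((a₁, b₁) ::ₘ (a₂, b₂) ::ₘ (a₃, b₃) ::ₘ E))
    (h' : ¬ EdgeConn ((a₁, U) ::ₘ (W, b₁) ::ₘ (a₂, U) ::ₘ (W, b₂) ::ₘ (a₃, b₃) ::ₘ E)) :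
    ∃ S : ι → Prop, (∀ e ∈ E, S e.1 ↔ S e.2) ∧ S a₁ ∧ S a₂ ∧ ¬ S b₁ ∧ ¬ S b₂ ∧
      (S a₃ ↔ S b₃) := by
  simp only [EdgeConn, Multiset.forall_mem_cons, not_forall] at h h'
  obtain ⟨C, ⟨h1, h2, h3, h4, h5, h6⟩, x, y, hx, hy⟩ := h'
  by_cases hUW : C U ↔ C W
  · exact absurd (h C ⟨by tauto, by tauto, h5, h6⟩ x y hx) hy
  · by_cases hU : C U
    · exact ⟨C, h6, by tauto, by tauto, by tauto, by tauto, h5⟩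
    · exact ⟨fun x => ¬ C x, fun e he => not_congr (h6 e he), by tauto, by tauto, by tauto,
        by tauto, not_congr h5⟩

section Edges

variable {ι : Type*} [DecidableEq ι] {E : Multiset (ι × ι)} {a b c d x : ι}

theorem edgeDegree_cons :
    edgeDegree ((a, b) ::ₘ E) x =
      (if x = a then 1 else 0) + (if x = b then 1 else 0) + edgeDegree E x := by
  simp only [edgeDegree, Multiset.map_cons, Multiset.count_cons]
  omega

/-- Subdividing an edge at `c` adds two ends at `c`, and a set closed under both halves is closed
under the whole edge. -/
theorem EdgeEulerian.split (h : EdgeEulerian ((a, b) ::ₘ E)) (c : ι) :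
    EdgeEulerian ((a, c) ::ₘ (c, b) ::ₘ E) := by
  refine ⟨fun x => ?_, fun C hC => h.2 C ?_⟩
  · have := h.1 x
    simp only [edgeDegree_cons] at this ⊢
    grind
  · simp only [Multiset.forall_mem_cons] at hC ⊢
    exact ⟨hC.1.trans hC.2.1, hC.2.2⟩

theorem EdgeEulerian.dropLoop (h : EdgeEulerian ((a, a) ::ₘ E)) : EdgeEulerian E := by
  refine ⟨fun x => ?_, fun C hC => h.2 C ?_⟩
  · have := h.1 x
    simp only [edgeDegree_cons] at this
    grind
  · simpa only [Multiset.forall_mem_cons, true_and, iff_self] using hC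

theorem edgeEulerian_swap : EdgeEulerian ((a, b) ::ₘ E) ↔ EdgeEulerian ((b, a) ::ₘ E) := by
  have : ∀ a b : ι, EdgeEulerian ((a, b) ::ₘ E) → EdgeEulerian ((b, a) ::ₘ E) := by
    intro a b h
    refine ⟨fun x => ?_, fun C hC => h.2 C ?_⟩
    · have := h.1 x
      simp only [edgeDegree_cons] at this ⊢
      grind
    · simp only [Multiset.forall_mem_cons] at hC ⊢
      exact ⟨hC.1.symm, hC.2⟩
  exact ⟨this _ _, this _ _⟩

theorem even_countP_of_even_count {α : Type*} [DecidableEq α] (D : Multiset α)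
    (h : ∀ x, Even (D.count x)) (C : α → Prop) [DecidablePred C] : Even (D.countP C) := by
  rw [Multiset.countP_eq_card_filter, ← Multiset.toFinset_sum_count_eq]
  refine Finset.even_sum _ fun x hx => ?_
  rw [Multiset.mem_toFinset, Multiset.mem_filter] at hx
  rw [Multiset.count_filter_of_pos hx.2]
  exact h x

/-- The number of edge ends inside a set is even. -/
theorem even_countP_ends (h : ∀ x, Even (edgeDegree E x)) (C : ι → Prop) [DecidablePred C] :
    Even ((E.map Prod.fst).countP C + (E.map Prod.snd).countP C) := by
  rw [← Multiset.countP_add]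
  refine even_countP_of_even_count _ (fun x => ?_) C
  rw [Multiset.count_add]
  exact h x

/-- Of three edges of an Eulerian multigraph, two may be redirected through the vertices `U`
and `W`. -/
theorem EdgeEulerian.cutTwo {a₁ a₂ a₃ b₁ b₂ b₃ : ι} (U W : ι)
    (h : EdgeEulerian ((a₁, b₁) ::ₘ (a₂, b₂) ::ₘ (a₃, b₃) ::ₘ E)) :
    EdgeEulerian ((a₁, U) ::ₘ (W, b₁) ::ₘ (a₂, U) ::ₘ (W, b₂) ::ₘ (a₃, b₃) ::ₘ E) ∨
    EdgeEulerian ((a₁, U) ::ₘ (W, b₁) ::ₘ (a₃, U) ::ₘ (W, b₃) ::ₘ (a₂, b₂) ::ₘ E) ∨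
    EdgeEulerian ((a₂, U) ::ₘ (W, b₂) ::ₘ (a₃, U) ::ₘ (W, b₃) ::ₘ (a₁, b₁) ::ₘ E) := by
  classical
  by_contra hcon
  simp only [not_or] at hcon
  obtain ⟨n1, n2, n3⟩ := hcon
  -- Redirecting two edges adds two ends at `U` and two at `W`, so parities survive and only
  -- connectivity can fail; likewise for the other two choices.
  have e1 : ¬ EdgeConn ((a₁, U) ::ₘ (W, b₁) ::ₘ (a₂, U) ::ₘ (W, b₂) ::ₘ (a₃, b₃) ::ₘ E) := by
    refine fun hc => n1 ⟨fun x => ?_, hc⟩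
    have := h.1 x
    simp only [edgeDegree_cons] at this ⊢
    grind
  have e2 : ¬ EdgeConn ((a₁, U) ::ₘ (W, b₁) ::ₘ (a₃, U) ::ₘ (W, b₃) ::ₘ (a₂, b₂) ::ₘ E) := by
    refine fun hc => n2 ⟨fun x => ?_, hc⟩
    have := h.1 x
    simp only [edgeDegree_cons] at this ⊢
    grind
  have e3 : ¬ EdgeConn ((a₂, U) ::ₘ (W, b₂) ::ₘ (a₃, U) ::ₘ (W, b₃) ::ₘ (a₁, b₁) ::ₘ E) := by
    refine fun hc => n3 ⟨fun x => ?_, hc⟩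
    have := h.1 x
    simp only [edgeDegree_cons] at this ⊢
    grind
  have hc2 := h.2
  rw [Multiset.cons_swap (a₂, b₂)] at hc2
  have hc3 := hc2
  rw [Multiset.cons_swap (a₁, b₁), Multiset.cons_swap (a₁, b₁), Multiset.cons_swap (a₃, b₃)] at hc3
  obtain ⟨S, hS, s1, s2, s3, s4, s5⟩ := exists_separating h.2 e1
  obtain ⟨S', hS', s1', s2', s3', s4', s5'⟩ := exists_separating hc2 e2
  obtain ⟨S'', hS'', t1, t2, t3, t4, t5⟩ := exists_separating hc3 e3
  -- A set closed under the remaining edges contains both ends or no end of each of them, so it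
  -- contains an even number of ends of the three special edges.
  have par : ∀ C : ι → Prop, (∀ e ∈ E, C e.1 ↔ C e.2) →
      Even ((if C a₁ then 1 else 0) + (if C a₂ then 1 else 0) + (if C a₃ then 1 else 0) +
        ((if C b₁ then 1 else 0) + (if C b₂ then 1 else 0) + (if C b₃ then 1 else 0))) := by
    intro C hC
    have h1 := even_countP_ends h.1 C
    have h2 : (E.map Prod.fst).countP C = (E.map Prod.snd).countP C := by
      rw [Multiset.countP_map, Multiset.countP_map]
      congr 1
      exact Multiset.filter_congr hC
    simp only [Multiset.map_cons, Multiset.countP_cons, h2] at h1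
    grind
  -- Applied to the intersection of the three sets, parity says that an even number of the
  -- statements `S a₃`, `S' a₂`, `S'' a₁` hold. Applied to the intersection of the complements, it
  -- says that an even number of them fail. But there are three of them.
  have p1 := par (fun x => S x ∧ S' x ∧ S'' x) fun e he =>
    and_congr (hS e he) (and_congr (hS' e he) (hS'' e he))
  have p2 := par (fun x => ¬ S x ∧ ¬ S' x ∧ ¬ S'' x) fun e he =>
    and_congr (not_congr (hS e he)) (and_congr (not_congr (hS' e he)) (not_congr (hS'' e he)))
  simp only [s1, s2, s3, s4, s1', s2', s3', s4', t1, t2, t3, t4] at p1 p2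
  by_cases c1 : S a₃ <;> by_cases c2 : S' a₂ <;> by_cases c3 : S'' a₁ <;>
    simp_all <;> first | exact absurd p1 (by decide) | exact absurd p2 (by decide)

end Edges

/-! ### Path systems as multisets of lists -/

section Lists

variable {V ι : Type*}

/-- The parts of the first and of the last vertex of a nonempty list. -/
def endPair (part : V → ι) : List V → List (ι × ι)
  | [] => []
  | x :: l => [(part x, part ((x :: l).getLast (List.cons_ne_nil x l)))]

/-- The pairs of consecutive entries. -/
def stepPairs (l : List V) : List (V × V) := l.zip l.tail

theorem stepPairs_append (A B : List V) (x y : V) :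
    stepPairs (A ++ x :: y :: B) = stepPairs (A ++ [x]) ++ (x, y) :: stepPairs (y :: B) := by
  induction A with
  | nil => simp [stepPairs]
  | cons a A ih =>
    cases A with
    | nil => simp [stepPairs]
    | cons a' A => simpa [stepPairs] using ih

theorem exists_of_mem_stepPairs {l : List V} {x y : V} (h : (x, y) ∈ stepPairs l) :
    ∃ A B, l = A ++ x :: y :: B := by
  induction l with
  | nil => simp [stepPairs] at h
  | cons a l ih =>
    cases l with
    | nil => simp [stepPairs] at h
    | cons b l =>
      simp only [stepPairs, List.tail_cons, List.zip_cons_cons, List.mem_cons, Prod.mk.injEq] at h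
      rcases h with ⟨rfl, rfl⟩ | h
      · exact ⟨[], l, rfl⟩
      · obtain ⟨A, B, h⟩ := ih h
        exact ⟨a :: A, B, by rw [h]; rfl⟩

theorem length_stepPairs (l : List V) : (stepPairs l).length = l.length - 1 := by
  simp [stepPairs]

/-- The part `a` depends only on the front piece and `b` only on the rear piece, so the same pair
serves for the whole path, for the two pieces after a cut, and for the pieces prolonged by a new
vertex. -/
theorem endPair_cut (part : V → ι) (A B : List V) (x y : V) :
    ∃ a b, (∀ D, endPair part (A ++ x :: (D ++ y :: B)) = [(a, b)]) ∧
      endPair part (A ++ [x]) = [(a, part x)] ∧ endPair part (y :: B) = [(part y, b)] ∧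
      (∀ z, endPair part (A ++ [x, z]) = [(a, part z)]) ∧
      ∀ z, endPair part (z :: y :: B) = [(part z, b)] := by
  cases A with
  | nil => exact ⟨part x, part ((y :: B).getLast (by simp)), by simp [endPair]⟩
  | cons a A => exact ⟨part a, part ((y :: B).getLast (by simp)), by simp [endPair]⟩

theorem endPair_reverse (part : V → ι) {l : List V} {a b : ι} (h : endPair part l = [(a, b)]) :
    endPair part l.reverse = [(b, a)] := by
  cases l with
  | nil => simp [endPair] at h
  | cons x l =>
    induction l using List.reverseRecOn with
    | nil =>
      simp only [endPair, List.getLast_singleton, List.cons.injEq, Prod.mk.injEq] at h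
      simp [endPair, ← h.1.1, ← h.1.2]
    | append_singleton l y _ =>
      simp_all [endPair]

/-- The multigraph of a multiset of lists: one edge for each nonempty list. -/
def endPairs (part : V → ι) (S : Multiset (List V)) : Multiset (ι × ι) :=
  S.bind fun l => (endPair part l : Multiset (ι × ι))

/-- All entries of all lists. -/
def allVerts (S : Multiset (List V)) : Multiset V := S.bind fun l => (l : Multiset V)

theorem endPairs_cons (part : V → ι) {l : List V} {a b : ι} (h : endPair part l = [(a, b)])
    (S : Multiset (List V)) : endPairs part (l ::ₘ S) = (a, b) ::ₘ endPairs part S := by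
  simp [endPairs, h, ← Multiset.singleton_add]

theorem allVerts_cons (l : List V) (S : Multiset (List V)) :
    allVerts (l ::ₘ S) = (l : Multiset V) + allVerts S := by
  simp [allVerts]

/-- The lists are the vertex lists of pairwise disjoint paths. -/
structure IsPathFamily (G : SimpleGraph V) (S : Multiset (List V)) : Prop where
  ne_nil : ∀ l ∈ S, l ≠ []
  chain : ∀ l ∈ S, l.IsChain G.Adj
  nodup : (allVerts S).Nodup

/-- A sum over all steps of all lists. -/
def stepSum (f : V × V → ℕ) (S : Multiset (List V)) : ℕ :=
  (S.map fun l => ((stepPairs l).map f).sum).sum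

theorem stepSum_cons (f : V × V → ℕ) (l : List V) (S : Multiset (List V)) :
    stepSum f (l ::ₘ S) = ((stepPairs l).map f).sum + stepSum f S := by
  simp [stepSum]

theorem sum_map_stepPairs_append (f : V × V → ℕ) (A B : List V) (x y : V) :
    ((stepPairs (A ++ x :: y :: B)).map f).sum =
      ((stepPairs (A ++ [x])).map f).sum + f (x, y) + ((stepPairs (y :: B)).map f).sum := by
  simp [stepPairs_append, add_assoc]

theorem exists_of_not_pairwise {R : V → V → Prop} {l : List V} (h : ¬ l.Pairwise R) :
    ∃ A x B y C, l = A ++ x :: (B ++ y :: C) ∧ ¬ R x y := by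
  induction l with
  | nil => simp at h
  | cons a l ih =>
    rw [List.pairwise_cons, not_and_or] at h
    rcases h with h | h
    · push Not at h
      obtain ⟨y, hy, hR⟩ := h
      obtain ⟨B, C, rfl⟩ := List.append_of_mem hy
      exact ⟨[], a, B, y, C, rfl, hR⟩
    · obtain ⟨A, x, B, y, C, rfl, hR⟩ := ih h
      exact ⟨a :: A, x, B, y, C, rfl, hR⟩

end Lists

/-! ### Cutting paths while keeping the reduced multigraph Eulerian -/

section Small

variable {V ι : Type*} {G : SimpleGraph V} {S S' : Multiset (List V)} {part : V → ι}

theorem isPathFamily_cons {l : List V} : IsPathFamily G (l ::ₘ S) ↔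
    l ≠ [] ∧ l.IsChain G.Adj ∧ IsPathFamily G S ∧ (allVerts (l ::ₘ S)).Nodup := by
  constructor
  · intro h
    refine ⟨h.ne_nil l (by simp), h.chain l (by simp),
      ⟨fun l' h' => h.ne_nil l' (by simp [h']), fun l' h' => h.chain l' (by simp [h']), ?_⟩, h.nodup⟩
    have := h.nodup
    rw [allVerts_cons] at this
    exact (Multiset.nodup_add.1 this).2.1
  · rintro ⟨h1, h2, h3, h4⟩
    refine ⟨?_, ?_, h4⟩
    · intro l' h'
      rcases Multiset.mem_cons.1 h' with rfl | h'
      · exact h1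
      · exact h3.ne_nil _ h'
    · intro l' h'
      rcases Multiset.mem_cons.1 h' with rfl | h'
      · exact h2
      · exact h3.chain _ h'

theorem IsPathFamily.reverse {l : List V} (h : IsPathFamily G (l ::ₘ S)) :
    IsPathFamily G (l.reverse ::ₘ S) := by
  rw [isPathFamily_cons] at h ⊢
  obtain ⟨h1, h2, h3, h4⟩ := h
  refine ⟨by simpa using h1, ?_, h3, ?_⟩
  · rw [List.isChain_reverse]
    exact h2.imp fun a b h => h.symm
  · rw [allVerts_cons] at h4 ⊢
    rwa [Multiset.coe_reverse]

/-- Cutting a path in two, possibly leaving out a piece in the middle. -/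
theorem IsPathFamily.cut {A D C : List V} {x y : V}
    (h : IsPathFamily G ((A ++ x :: (D ++ y :: C)) ::ₘ S)) :
    IsPathFamily G ((A ++ [x]) ::ₘ (y :: C) ::ₘ S) := by
  rw [isPathFamily_cons] at h
  obtain ⟨h1, h2, h3, h4⟩ := h
  have h5 : A ++ x :: (D ++ y :: C) = (A ++ [x]) ++ (D ++ y :: C) := by simp
  rw [h5] at h2
  have h6 := List.isChain_append.1 h2
  have h7 := List.isChain_append.1 h6.2.1
  have h8 : allVerts ((A ++ [x]) ::ₘ (y :: C) ::ₘ S) ≤ allVerts ((A ++ x :: (D ++ y :: C)) ::ₘ S) := by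
    rw [h5]
    simp only [allVerts_cons, ← Multiset.coe_add]
    rw [← add_assoc]
    refine add_le_add (add_le_add le_rfl ?_) le_rfl
    exact Multiset.le_add_left _ _
  have h9 := Multiset.nodup_of_le h8 h4
  rw [isPathFamily_cons, isPathFamily_cons]
  refine ⟨by simp, h6.1, ⟨by simp, h7.2.1, h3, ?_⟩, h9⟩
  rw [allVerts_cons] at h9
  exact (Multiset.nodup_add.1 h9).2.1

/-- Path families whose multigraph is Eulerian. -/
def IsGood [DecidableEq ι] (G : SimpleGraph V) (part : V → ι) (S : Multiset (List V)) : Prop :=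
  IsPathFamily G S ∧ EdgeEulerian (endPairs part S)

variable [DecidableEq ι]

theorem IsGood.reverse {l : List V} (h : IsGood G part (l ::ₘ S)) :
    IsGood G part (l.reverse ::ₘ S) := by
  refine ⟨h.1.reverse, ?_⟩
  have hne := h.1.ne_nil l (by simp)
  have : ∃ a b, endPair part l = [(a, b)] := by
    cases l with
    | nil => exact absurd rfl hne
    | cons x l => exact ⟨_, _, rfl⟩
  obtain ⟨a, b, hab⟩ := this
  have h2 := h.2
  rw [endPairs_cons part hab] at h2
  rw [endPairs_cons part (endPair_reverse part hab)]
  exact edgeEulerian_swap.1 h2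

/-- In the reduced multigraph, the cut subdivides an edge at the common part of `x` and `y`,
whatever the omitted piece `D` is. -/
theorem IsGood.cut {A D C : List V} {x y : V} (hxy : part x = part y)
    (h : IsGood G part ((A ++ x :: (D ++ y :: C)) ::ₘ S)) :
    IsGood G part ((A ++ [x]) ::ₘ (y :: C) ::ₘ S) := by
  refine ⟨h.1.cut, ?_⟩
  obtain ⟨a, b, h1, h2, h3, -⟩ := endPair_cut part A C x y
  have := h.2
  rw [endPairs_cons part (h1 D)] at this
  rw [endPairs_cons part h2, endPairs_cons part h3, ← hxy]
  exact this.split _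

/-- A trivial path is a loop of the reduced multigraph, which matters neither for parity nor for
connectivity. -/
theorem IsGood.dropSingleton {v : V} (h : IsGood G part ([v] ::ₘ S)) : IsGood G part S := by
  refine ⟨(isPathFamily_cons.1 h.1).2.2.1, ?_⟩
  have := h.2
  rw [endPairs_cons part (a := part v) (b := part v) (by simp [endPair])] at this
  exact this.dropLoop

theorem isPathFamily_cut₂ {A₁ B₁ A₂ B₂ : List V} {l : List V} {x₁ y₁ x₂ y₂ : V}
    (h : IsPathFamily G ((A₁ ++ x₁ :: y₁ :: B₁) ::ₘ (A₂ ++ x₂ :: y₂ :: B₂) ::ₘ l ::ₘ S)) :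
    IsPathFamily G ((A₁ ++ [x₁]) ::ₘ (y₁ :: B₁) ::ₘ (A₂ ++ [x₂]) ::ₘ (y₂ :: B₂) ::ₘ l ::ₘ S) := by
  have h1 : IsPathFamily G _ := IsPathFamily.cut (D := []) h
  rw [Multiset.cons_swap (y₁ :: B₁), Multiset.cons_swap (A₁ ++ [x₁])] at h1
  have h2 : IsPathFamily G _ := IsPathFamily.cut (D := []) h1
  convert h2 using 1
  rw [Multiset.cons_swap (y₁ :: B₁) (A₂ ++ [x₂]), Multiset.cons_swap (A₁ ++ [x₁]),
    Multiset.cons_swap (y₁ :: B₁) (y₂ :: B₂), Multiset.cons_swap (A₁ ++ [x₁]) (y₂ :: B₂)]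

/-- The first two paths lose their step from `U` to `W` and the third stays intact. No vertex
disappears, so the cost drops by the two deleted steps. -/
theorem cutTwo_aux {A₁ B₁ A₂ B₂ A₃ B₃ : List V} {x₁ y₁ x₂ y₂ x₃ y₃ : V} {U W : ι}
    (hx₁ : part x₁ = U) (hx₂ : part x₂ = U)
    (hy₁ : part y₁ = W) (hy₂ : part y₂ = W)
    (h : IsPathFamily G ((A₁ ++ x₁ :: y₁ :: B₁) ::ₘ (A₂ ++ x₂ :: y₂ :: B₂) ::ₘ
      (A₃ ++ x₃ :: y₃ :: B₃) ::ₘ S))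
    {a₁ b₁ a₂ b₂ a₃ b₃ : ι}
    (e₁ : endPair part (A₁ ++ [x₁]) = [(a₁, part x₁)]) (e₁' : endPair part (y₁ :: B₁) = [(part y₁, b₁)])
    (e₂ : endPair part (A₂ ++ [x₂]) = [(a₂, part x₂)]) (e₂' : endPair part (y₂ :: B₂) = [(part y₂, b₂)])
    (e₃ : endPair part (A₃ ++ x₃ :: y₃ :: B₃) = [(a₃, b₃)])
    (hE : EdgeEulerian ((a₁, U) ::ₘ (W, b₁) ::ₘ (a₂, U) ::ₘ (W, b₂) ::ₘ (a₃, b₃) ::ₘ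
      endPairs part S)) :
    ∃ S', IsGood G part S' ∧ stepSum (fun _ => 1) S' + (allVerts S').card <
      stepSum (fun _ => 1) ((A₁ ++ x₁ :: y₁ :: B₁) ::ₘ (A₂ ++ x₂ :: y₂ :: B₂) ::ₘ
      (A₃ ++ x₃ :: y₃ :: B₃) ::ₘ S) + (allVerts ((A₁ ++ x₁ :: y₁ :: B₁) ::ₘ
        (A₂ ++ x₂ :: y₂ :: B₂) ::ₘ (A₃ ++ x₃ :: y₃ :: B₃) ::ₘ S)).card := by
  refine ⟨_, ⟨isPathFamily_cut₂ h, ?_⟩, ?_⟩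
  · rw [endPairs_cons part e₁, endPairs_cons part e₁', endPairs_cons part e₂,
      endPairs_cons part e₂', endPairs_cons part e₃, hx₁, hx₂, hy₁, hy₂]
    exact hE
  · simp only [stepSum_cons, sum_map_stepPairs_append, allVerts_cons, Multiset.card_add,
      Multiset.coe_card, List.length_append, List.length_cons, List.length_nil]
    omega

theorem IsGood.cutTwo {A₁ B₁ A₂ B₂ A₃ B₃ : List V} {x₁ y₁ x₂ y₂ x₃ y₃ : V} {U W : ι}
    (hx₁ : part x₁ = U) (hx₂ : part x₂ = U) (hx₃ : part x₃ = U)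
    (hy₁ : part y₁ = W) (hy₂ : part y₂ = W) (hy₃ : part y₃ = W)
    (h : IsGood G part ((A₁ ++ x₁ :: y₁ :: B₁) ::ₘ (A₂ ++ x₂ :: y₂ :: B₂) ::ₘ
      (A₃ ++ x₃ :: y₃ :: B₃) ::ₘ S)) :
    ∃ S', IsGood G part S' ∧ stepSum (fun _ => 1) S' + (allVerts S').card <
      stepSum (fun _ => 1) ((A₁ ++ x₁ :: y₁ :: B₁) ::ₘ (A₂ ++ x₂ :: y₂ :: B₂) ::ₘ
      (A₃ ++ x₃ :: y₃ :: B₃) ::ₘ S) + (allVerts ((A₁ ++ x₁ :: y₁ :: B₁) ::ₘ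
        (A₂ ++ x₂ :: y₂ :: B₂) ::ₘ (A₃ ++ x₃ :: y₃ :: B₃) ::ₘ S)).card := by
  obtain ⟨a₁, b₁, e₁, f₁, g₁, -⟩ := endPair_cut part A₁ B₁ x₁ y₁
  obtain ⟨a₂, b₂, e₂, f₂, g₂, -⟩ := endPair_cut part A₂ B₂ x₂ y₂
  obtain ⟨a₃, b₃, e₃, f₃, g₃, -⟩ := endPair_cut part A₃ B₃ x₃ y₃
  replace e₁ := e₁ []
  replace e₂ := e₂ []
  replace e₃ := e₃ []
  rw [List.nil_append] at e₁ e₂ e₃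
  have hE := h.2
  rw [endPairs_cons part e₁, endPairs_cons part e₂, endPairs_cons part e₃] at hE
  rcases hE.cutTwo U W with hE | hE | hE
  · exact cutTwo_aux hx₁ hx₂ hy₁ hy₂ h.1 f₁ g₁ f₂ g₂ e₃ hE
  · have h1 := h.1
    rw [Multiset.cons_swap (A₂ ++ _)] at h1
    rw [Multiset.cons_swap (A₂ ++ _)]
    exact cutTwo_aux hx₁ hx₃ hy₁ hy₃ h1 f₁ g₁ f₃ g₃ e₂ hE
  · have h1 := h.1
    rw [Multiset.cons_swap (A₁ ++ _), Multiset.cons_swap (A₁ ++ _)] at h1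
    rw [Multiset.cons_swap (A₁ ++ _), Multiset.cons_swap (A₁ ++ _)]
    exact cutTwo_aux hx₂ hx₃ hy₂ hy₃ h1 f₂ g₂ f₃ g₃ e₁ hE

end Small

/-! ### The bound m² - m on the number of edges -/

section Bound

variable {V ι : Type*} {G : SimpleGraph V} {S S' : Multiset (List V)} {part : V → ι}

/-- The pairs of parts between which a list steps. -/
def stepClasses (part : V → ι) (l : List V) : List (Sym2 ι) :=
  (stepPairs l).map fun e => s(part e.1, part e.2)

theorem ne_of_mem_stepPairs {l : List V} (h : l.Pairwise fun x y => part x ≠ part y) {x y : V}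
    (hxy : (x, y) ∈ stepPairs l) : part x ≠ part y := by
  obtain ⟨A, B, rfl⟩ := exists_of_mem_stepPairs hxy
  have := (List.pairwise_append.1 h).2.1
  exact List.rel_of_pairwise_cons this (by simp)

theorem mem_of_mem_stepPairs {l : List V} {e : V × V} (h : e ∈ stepPairs l) : e.1 ∈ l ∧ e.2 ∈ l := by
  obtain ⟨A, B, rfl⟩ := exists_of_mem_stepPairs (x := e.1) (y := e.2) h
  simp

/-- The part of the first vertex never recurs, so the class of the first step contains a part that
no later step meets. -/
theorem nodup_stepClasses {l : List V} (h : l.Pairwise fun x y => part x ≠ part y) :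
    (stepClasses part l).Nodup := by
  induction l with
  | nil => simp [stepClasses, stepPairs]
  | cons a l ih =>
    cases l with
    | nil => simp [stepClasses, stepPairs]
    | cons b l =>
      rw [List.pairwise_cons] at h
      have h1 : stepClasses part (a :: b :: l) = s(part a, part b) :: stepClasses part (b :: l) := by
        simp [stepClasses, stepPairs]
      rw [h1, List.nodup_cons]
      refine ⟨fun hmem => ?_, ih h.2⟩
      obtain ⟨e, he, he'⟩ := List.mem_map.1 hmem
      have h2 := mem_of_mem_stepPairs he
      have h3 : part a ∈ s(part e.1, part e.2) := by rw [he']; simp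
      rcases Sym2.mem_iff.1 h3 with h3 | h3
      · exact h.1 _ h2.1 h3
      · exact h.1 _ h2.2 h3

/-- Removing one element with a positive value lowers the sum by at most 1. Three applications
extract three distinct paths crossing the same pair of parts. -/
theorem exists_cons_of_lt_sum {α : Type*} {f : α → ℕ}  {S : Multiset α} {k : ℕ} (h1 : ∀ l ∈ S, f l ≤ 1) (h : k + 1 ≤ (S.map f).sum) :
    ∃ l S', S = l ::ₘ S' ∧ 0 < f l ∧ k ≤ (S'.map f).sum := by
  have : ∃ l ∈ S, 0 < f l := by
    by_contra hcon
    push Not at hcon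
    have : (S.map f).sum = 0 := by
      refine Multiset.sum_eq_zero fun x hx => ?_
      obtain ⟨l, hl, rfl⟩ := Multiset.mem_map.1 hx
      have := hcon l hl
      omega
    omega
  obtain ⟨l, hl, hfl⟩ := this
  obtain ⟨S', rfl⟩ := Multiset.exists_cons_of_mem hl
  have h2 := h1 l (by simp)
  simp only [Multiset.map_cons, Multiset.sum_cons] at h
  exact ⟨l, S', rfl, hfl, by omega⟩

variable [DecidableEq ι]

/-- The number of steps plus the number of vertices. -/
def cost (S : Multiset (List V)) : ℕ := stepSum (fun _ => 1) S + (allVerts S).card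

/-- Paths have no preferred direction, so reversing one makes it cross from `U` to `W` at no cost.
-/
theorem IsGood.orient {l : List V} {U W : ι} (h : IsGood G part (l ::ₘ S))
    (hl : s(U, W) ∈ stepClasses part l) :
    ∃ A x y B, part x = U ∧ part y = W ∧ IsGood G part ((A ++ x :: y :: B) ::ₘ S) ∧
      cost ((A ++ x :: y :: B) ::ₘ S) = cost (l ::ₘ S) := by
  obtain ⟨⟨x, y⟩, he, he'⟩ := List.mem_map.1 hl
  obtain ⟨A, B, rfl⟩ := exists_of_mem_stepPairs he
  rcases Sym2.eq_iff.1 he' with ⟨h1, h2⟩ | ⟨h1, h2⟩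
  · exact ⟨A, x, y, B, h1, h2, h, rfl⟩
  · refine ⟨B.reverse, y, x, A.reverse, h2, h1, ?_, ?_⟩
    · simpa using h.reverse
    · simp only [cost, stepSum_cons, allVerts_cons, Multiset.card_add, Multiset.coe_card]
      simp [length_stepPairs]
      omega

theorem IsGood.exists_stepSum_le [Fintype ι] (h : IsGood G part S) :
    ∃ S', IsGood G part S' ∧ stepSum (fun _ => 1) S' ≤ Fintype.card ι ^ 2 - Fintype.card ι := by
  induction hc : cost S using Nat.strong_induction_on generalizing S with
  | _ c ih =>
  -- If some good family is cheaper, recurse; otherwise `S` itself is minimal and meets the bound.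
  by_cases hmin : ∃ S', IsGood G part S' ∧ cost S' < cost S
  · obtain ⟨S', h', hlt⟩ := hmin
    exact ih _ (hc ▸ hlt) h' rfl
  refine ⟨S, h, ?_⟩
  have hinj : ∀ l ∈ S, l.Pairwise fun x y => part x ≠ part y := by
    intro l hl
    by_contra hcon
    obtain ⟨A, x, B, y, C, rfl, hxy⟩ := exists_of_not_pairwise hcon
    rw [not_not] at hxy
    obtain ⟨S', rfl⟩ := Multiset.exists_cons_of_mem hl
    refine hmin ⟨_, h.cut hxy, ?_⟩
    simp only [cost, stepSum_cons, allVerts_cons, Multiset.card_add, Multiset.coe_card]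
    simp [length_stepPairs]
    omega
  set D : Multiset (Sym2 ι) := S.bind fun l => (stepClasses part l : Multiset (Sym2 ι)) with hD
  have hcard : stepSum (fun _ => 1) S = D.card := by
    simp [hD, stepSum, stepClasses, Multiset.card_bind, Function.comp_def]
  -- Three crossings of one pair would belong to three different paths; after orienting these alike,
  -- `IsGood.cutTwo` contradicts minimality.
  have hcount : ∀ z, D.count z ≤ 2 := by
    intro z
    by_contra hcon
    rw [not_le, hD, Multiset.count_bind] at hcon
    have hle : ∀ l ∈ S, (stepClasses part l : Multiset (Sym2 ι)).count z ≤ 1 := fun l hl =>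
      Multiset.nodup_iff_count_le_one.1 (Multiset.coe_nodup.2 (nodup_stepClasses (hinj l hl))) z
    obtain ⟨l₁, S₁, rfl, p₁, hcon⟩ := exists_cons_of_lt_sum hle hcon
    obtain ⟨l₂, S₂, rfl, p₂, hcon⟩ := exists_cons_of_lt_sum (fun l hl => hle l (by simp [hl])) hcon
    obtain ⟨l₃, S₃, rfl, p₃, -⟩ := exists_cons_of_lt_sum (fun l hl => hle l (by simp [hl])) hcon
    rw [Multiset.count_pos, Multiset.mem_coe] at p₁ p₂ p₃
    induction z with
    | _ U W =>
    obtain ⟨A₁, x₁, y₁, B₁, q₁, r₁, h₁, c₁⟩ := h.orient p₁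
    rw [Multiset.cons_swap] at h₁
    obtain ⟨A₂, x₂, y₂, B₂, q₂, r₂, h₂, c₂⟩ := h₁.orient p₂
    rw [Multiset.cons_swap _ l₃, Multiset.cons_swap _ l₃] at h₂
    obtain ⟨A₃, x₃, y₃, B₃, q₃, r₃, h₃, c₃⟩ := h₂.orient p₃
    obtain ⟨S', h', hlt⟩ := IsGood.cutTwo q₃ q₂ q₁ r₃ r₂ r₁ h₃
    refine hmin ⟨S', h', lt_of_lt_of_eq hlt ?_⟩
    rw [Multiset.cons_swap l₂] at c₂
    rw [Multiset.cons_swap l₃, Multiset.cons_swap l₃] at c₃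
    exact (c₃.trans c₂).trans c₁
  have hdiag : ∀ z ∈ D.toFinset, ¬ z.IsDiag := by
    intro z hz
    rw [Multiset.mem_toFinset, hD, Multiset.mem_bind] at hz
    obtain ⟨l, hl, hz⟩ := hz
    obtain ⟨⟨x, y⟩, he, rfl⟩ := List.mem_map.1 (Multiset.mem_coe.1 hz)
    exact ne_of_mem_stepPairs (hinj l hl) he
  have h1 : D.card ≤ D.toFinset.card * 2 := by
    rw [← Multiset.toFinset_sum_count_eq]
    exact Finset.sum_le_card_nsmul _ _ _ fun z _ => hcount z
  have h2 : D.toFinset.card ≤ (Fintype.card ι).choose 2 := by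
    rw [← Sym2.card_subtype_not_diag, Fintype.card_subtype]
    exact Finset.card_le_card fun z hz => by simpa using hdiag z hz
  have h3 : (Fintype.card ι).choose 2 * 2 = Fintype.card ι ^ 2 - Fintype.card ι := by
    rw [Nat.choose_two_right, Nat.div_mul_cancel (Nat.even_mul_pred_self _).two_dvd,
      Nat.mul_sub, mul_one, sq]
  rw [hcard]
  omega

end Bound

/-! ### Reduction to few vertices -/

section Kernel

variable {V ι : Type*} {G : SimpleGraph V} {S S' : Multiset (List V)} {part : V → ι}

/-- Up to `s` vertices can be avoided when an edge is replaced by an edge of the relation `K`. -/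
structure IsKernel (G : SimpleGraph V) (part : V → ι) (s : ℕ) (K : V → V → Prop) : Prop where
  adj : ∀ x y, K x y → G.Adj x y
  replace : ∀ x y, G.Adj x y → K x y ∨ ∀ Z : Finset V, Z.card ≤ s →
    (∃ y' ∉ Z, K x y' ∧ part y' = part y) ∨ (∃ x' ∉ Z, K x' y ∧ part x' = part x) ∨
    ∃ x' ∉ Z, ∃ y' ∉ Z, K x' y' ∧ part x' = part x ∧ part y' = part y

variable [DecidableEq ι]

/-- Deleting trivial paths leaves every step sum unchanged; afterwards the number of vertices is
controlled by the number of steps. -/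
theorem IsGood.exists_two_le (h : IsGood G part S) :
    ∃ S', IsGood G part S' ∧ (∀ f, stepSum f S' = stepSum f S) ∧ ∀ l ∈ S', 2 ≤ l.length := by
  induction hc : S.card generalizing S with
  | zero =>
    obtain rfl := Multiset.card_eq_zero.1 hc
    exact ⟨0, h, fun _ => rfl, by simp⟩
  | succ c ih =>
    by_cases hS : ∀ l ∈ S, 2 ≤ l.length
    · exact ⟨S, h, fun _ => rfl, hS⟩
    · push Not at hS
      obtain ⟨l, hl, hlen⟩ := hS
      obtain ⟨S₁, rfl⟩ := Multiset.exists_cons_of_mem hl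
      have hne := h.1.ne_nil l hl
      obtain ⟨v, rfl⟩ : ∃ v, l = [v] := by
        have := List.length_pos_iff.2 hne
        exact List.length_eq_one_iff.1 (by omega)
      obtain ⟨S', h1, h2, h3⟩ := ih h.dropSingleton (by simpa using hc)
      exact ⟨S', h1, fun f => by rw [h2, stepSum_cons]; simp [stepPairs], h3⟩

theorem card_allVerts_le (h : ∀ l ∈ S, 2 ≤ l.length) :
    (allVerts S).card ≤ 2 * stepSum (fun _ => 1) S := by
  induction S using Multiset.induction_on with
  | empty => simp [allVerts]
  | cons l S ih =>
    have h1 := h l (by simp)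
    have h2 := ih fun l' h' => h l' (by simp [h'])
    simp only [allVerts_cons, stepSum_cons, Multiset.card_add, Multiset.coe_card]
    simp [length_stepPairs]
    omega

theorem IsPathFamily.snoc {A : List V} {x z : V} (h : IsPathFamily G ((A ++ [x]) ::ₘ S))
    (hz : z ∉ allVerts ((A ++ [x]) ::ₘ S)) (hxz : G.Adj x z) :
    IsPathFamily G ((A ++ [x, z]) ::ₘ S) := by
  rw [isPathFamily_cons] at h ⊢
  obtain ⟨h1, h2, h3, h4⟩ := h
  refine ⟨by simp, ?_, h3, ?_⟩
  · rw [List.isChain_append_cons_cons]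
    exact ⟨h2, hxz, by simp⟩
  · have : allVerts ((A ++ [x, z]) ::ₘ S) = z ::ₘ allVerts ((A ++ [x]) ::ₘ S) := by
      have h5 : A ++ [x, z] = (A ++ [x]) ++ [z] := by simp
      rw [allVerts_cons, allVerts_cons, h5, ← Multiset.coe_add, Multiset.coe_singleton,
        ← Multiset.singleton_add, add_comm _ ({z} : Multiset V), add_assoc]
    rw [this]
    exact Multiset.nodup_cons.2 ⟨hz, h4⟩

theorem IsPathFamily.consCons {B : List V} {y z : V} (h : IsPathFamily G ((y :: B) ::ₘ S))
    (hz : z ∉ allVerts ((y :: B) ::ₘ S)) (hyz : G.Adj z y) :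
    IsPathFamily G ((z :: y :: B) ::ₘ S) := by
  rw [isPathFamily_cons] at h ⊢
  obtain ⟨h1, h2, h3, h4⟩ := h
  refine ⟨by simp, ?_, h3, ?_⟩
  · rw [List.isChain_cons_cons]
    exact ⟨hyz, h2⟩
  · have : allVerts ((z :: y :: B) ::ₘ S) = z ::ₘ allVerts ((y :: B) ::ₘ S) := by
      simp only [allVerts_cons, ← Multiset.cons_coe, Multiset.cons_add]
    rw [this]
    exact Multiset.nodup_cons.2 ⟨hz, h4⟩

theorem IsPathFamily.singleton {z : V} (h : IsPathFamily G S) (hz : z ∉ allVerts S) :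
    IsPathFamily G ([z] ::ₘ S) := by
  rw [isPathFamily_cons]
  refine ⟨by simp, by simp, h, ?_⟩
  rw [allVerts_cons]
  simpa using ⟨hz, h.nodup⟩

/-- One edge outside of the kernel can be replaced. -/
theorem IsGood.exchange {K : V → V → Prop} {s : ℕ} (hK : IsKernel G part s K) {A B : List V}
    {x y : V} (h : IsGood G part ((A ++ x :: y :: B) ::ₘ S))
    (hs : (allVerts ((A ++ x :: y :: B) ::ₘ S)).card ≤ s) (hxy : ¬ K x y) :
    ∃ S', IsGood G part S' ∧ ∃ z w, K z w ∧ ∀ f,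
      stepSum f S' + f (x, y) = stepSum f ((A ++ x :: y :: B) ::ₘ S) + f (z, w) := by
  classical
  have hG : G.Adj x y := by
    have := h.1.chain (A ++ x :: y :: B) (by simp)
    exact (List.isChain_append_cons_cons.1 this).2.1
  have hcut : IsPathFamily G _ := IsPathFamily.cut (D := []) h.1
  have hv : allVerts ((A ++ [x]) ::ₘ (y :: B) ::ₘ S) = allVerts ((A ++ x :: y :: B) ::ₘ S) := by
    simp only [allVerts_cons, ← add_assoc, Multiset.coe_add, List.append_assoc,
      List.singleton_append]
  obtain ⟨a, b, e1, e2, e3, e4, e5⟩ := endPair_cut part A B x y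
  replace e1 := e1 []
  rw [List.nil_append] at e1
  have hE := h.2
  rw [endPairs_cons part e1] at hE
  rcases (hK.replace x y hG).resolve_left hxy (allVerts ((A ++ x :: y :: B) ::ₘ S)).toFinset
    ((Multiset.toFinset_card_le _).trans hs) with ⟨y', hy', hk, hp⟩ | ⟨x', hx', hk, hp⟩ |
      ⟨x', hx', y', hy', hk, hp, hp'⟩
  -- The new vertex `y'` is attached to the front piece: the reduced edge is subdivided at the part
  -- of `y`.
  · rw [Multiset.mem_toFinset, ← hv] at hy'
    refine ⟨(A ++ [x, y']) ::ₘ (y :: B) ::ₘ S, ⟨hcut.snoc hy' (hK.adj _ _ hk), ?_⟩, x, y', hk, ?_⟩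
    · rw [endPairs_cons part (e4 y'), endPairs_cons part e3, hp]
      exact hE.split _
    · intro f
      have := sum_map_stepPairs_append f A [] x y'
      simp only [stepSum_cons, sum_map_stepPairs_append, this]
      simp [stepPairs]
      omega
  -- Symmetrically, `x'` is attached to the rear piece and the subdivision is at the part of `x`.
  · rw [Multiset.mem_toFinset, ← hv] at hx'
    rw [Multiset.cons_swap] at hcut hx'
    refine ⟨(x' :: y :: B) ::ₘ (A ++ [x]) ::ₘ S, ⟨hcut.consCons hx' (hK.adj _ _ hk), ?_⟩, x', y,
      hk, ?_⟩
    · rw [endPairs_cons part (e5 x'), endPairs_cons part e2, hp, Multiset.cons_swap]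
      exact hE.split _
    · intro f
      have := sum_map_stepPairs_append f [] B x' y
      rw [List.nil_append] at this
      simp only [stepSum_cons, sum_map_stepPairs_append, this]
      simp [stepPairs]
      omega
  -- The new edge is a path of its own: the reduced edge is subdivided at the part of `x` and again
  -- at the part of `y`.
  · rw [Multiset.mem_toFinset, ← hv] at hx' hy'
    have h1 : IsPathFamily G ((([] : List V) ++ [x']) ::ₘ (A ++ [x]) ::ₘ (y :: B) ::ₘ S) :=
      hcut.singleton hx'
    have h2 : y' ∉ allVerts ((([] : List V) ++ [x']) ::ₘ (A ++ [x]) ::ₘ (y :: B) ::ₘ S) := by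
      rw [allVerts_cons]
      have : y' ≠ x' := (hK.adj _ _ hk).ne'
      simpa [this] using hy'
    have h3 := h1.snoc h2 (hK.adj _ _ hk)
    refine ⟨_, ⟨h3, ?_⟩, x', y', hk, ?_⟩
    · rw [endPairs_cons part (a := part x') (b := part y') (by simp [endPair]), endPairs_cons part e2,
        endPairs_cons part e3, hp, hp']
      have h4 := hE.split (part x)
      rw [Multiset.cons_swap] at h4
      have h5 := h4.split (part y)
      rwa [Multiset.cons_swap (part y, b)] at h5
    · intro f
      simp only [stepSum_cons, sum_map_stepPairs_append]
      simp [stepPairs]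
      omega

/-- Induction on the number of steps outside `K`: an exchange turns one of them into a step of `K`
and preserves the total. Trivial paths, which exchanges may create, are removed in every round so
that the family never has more than `2 * M` vertices to avoid. -/
theorem IsGood.exists_in_kernel {K : V → V → Prop} {M : ℕ} (hK : IsKernel G part (2 * M) K)
    (h : IsGood G part S) (hM : stepSum (fun _ => 1) S ≤ M) :
    ∃ S', IsGood G part S' ∧ stepSum (fun _ => 1) S' ≤ M ∧ (∀ l ∈ S', 2 ≤ l.length) ∧
      ∀ l ∈ S', l.IsChain K := by
  classical
  induction hc : stepSum (fun e => if K e.1 e.2 then 0 else 1) S using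
    Nat.strong_induction_on generalizing S with
  | _ c ih =>
  obtain ⟨S₁, h1, h2, h3⟩ := h.exists_two_le
  by_cases hch : ∀ l ∈ S₁, l.IsChain K
  · exact ⟨S₁, h1, by rwa [h2], h3, hch⟩
  · push Not at hch
    obtain ⟨l, hl, hlK⟩ := hch
    obtain ⟨S₂, rfl⟩ := Multiset.exists_cons_of_mem hl
    have : ∃ A x y B, l = A ++ x :: y :: B ∧ ¬ K x y := by
      by_contra hcon
      push Not at hcon
      exact hlK (List.isChain_iff_forall_rel_of_append_cons_cons.2 fun {x y A B} hA => hcon A x y B hA)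
    obtain ⟨A, x, y, B, rfl, hxy⟩ := this
    have hcard := card_allVerts_le h3
    rw [h2] at hcard
    obtain ⟨S', h4, z, w, hzw, h5⟩ := h1.exchange hK (by omega) hxy
    have h6 := h5 fun _ => 1
    have h7 := h5 fun e => if K e.1 e.2 then 0 else 1
    simp only [hxy, hzw, if_true, if_false] at h7
    rw [h2] at h6 h7
    exact ih _ (by omega) h4 (by omega) rfl

end Kernel

/-! ### Path systems and families of lists -/

section Bridge

variable {V ι : Type*} {G : SimpleGraph V} {part : V → ι}

theorem endPair_support {u v : V} (w : G.Walk u v) :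
    endPair part w.support = [(part u, part v)] := by
  cases w with
  | nil => rfl
  | cons h w =>
    simp only [SimpleGraph.Walk.support_cons, endPair, List.getLast_cons w.support_ne_nil,
      w.getLast_support]

theorem allVerts_coe (L : List (List V)) : allVerts (L : Multiset (List V)) = (L.flatten : List V) := by
  rw [allVerts, Multiset.coe_bind, List.flatMap_id']

theorem endPairs_coe (L : List (List V)) :
    endPairs part (L : Multiset (List V)) = (L.flatMap (endPair part) : List (ι × ι)) := by
  simp [endPairs, Multiset.coe_bind]

/-- The vertex lists of the paths of a path system. -/
def PathSystem.lists (P : PathSystem G) : List (List V) := P.paths.map PathIn.verts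

theorem PathSystem.isPathFamily (P : PathSystem G) : IsPathFamily G (P.lists : Multiset (List V)) := by
  refine ⟨fun l hl => ?_, fun l hl => ?_, ?_⟩
  · obtain ⟨p, -, rfl⟩ := List.mem_map.1 (Multiset.mem_coe.1 hl)
    exact p.path.1.support_ne_nil
  · obtain ⟨p, -, rfl⟩ := List.mem_map.1 (Multiset.mem_coe.1 hl)
    exact p.path.1.isChain_adj_support
  · rw [allVerts_coe, Multiset.coe_nodup, List.nodup_flatten]
    refine ⟨fun l hl => ?_, ?_⟩
    · obtain ⟨p, -, rfl⟩ := List.mem_map.1 hl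
      exact p.path.2.support_nodup
    · exact List.pairwise_map.2 P.disjoint

theorem PathSystem.exists_lists_eq {L : List (List V)}
    (h : IsPathFamily G (L : Multiset (List V))) : ∃ P : PathSystem G, P.lists = L := by
  have hnodup := h.nodup
  rw [allVerts_coe, Multiset.coe_nodup, List.nodup_flatten] at hnodup
  have h1 : ∀ l ∈ L, ∃ p : PathIn G, p.verts = l := by
    intro l hl
    have hs := SimpleGraph.Walk.support_ofSupport (h.ne_nil l hl) (h.chain l hl)
    refine ⟨⟨_, _, SimpleGraph.Walk.ofSupport l (h.ne_nil l hl) (h.chain l hl), ?_⟩, hs⟩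
    rw [SimpleGraph.Walk.isPath_def, hs]
    exact hnodup.1 l hl
  have h2 : ∃ ps : List (PathIn G), ps.map PathIn.verts = L := by
    clear h hnodup
    induction L with
    | nil => exact ⟨[], rfl⟩
    | cons l L ih =>
      obtain ⟨ps, hps⟩ := ih fun l' h' => h1 l' (by simp [h'])
      obtain ⟨p, hp⟩ := h1 l (by simp)
      exact ⟨p :: ps, by simp [hp, hps]⟩
  obtain ⟨ps, rfl⟩ := h2
  exact ⟨⟨ps, List.pairwise_map.1 hnodup.2⟩, rfl⟩

theorem PathSystem.edgeCount_eq (P : PathSystem G) :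
    P.edgeCount = stepSum (fun _ => 1) (P.lists : Multiset (List V)) := by
  simp only [PathSystem.edgeCount, stepSum, PathSystem.lists, Multiset.map_coe, List.map_map,
    Multiset.sum_coe]
  congr 1
  refine List.map_congr_left fun p _ => ?_
  simp [PathIn.verts, length_stepPairs]

theorem PathSystem.endPairs_eq (P : PathSystem G) :
    endPairs part (P.lists : Multiset (List V)) = (Finset.univ : Finset (Fin P.paths.length)).val.map
      fun e => (part (P.paths.get e).src, part (P.paths.get e).tgt) := by
  have h1 : endPairs part (P.lists : Multiset (List V)) =
      (P.paths.map fun p => (part p.src, part p.tgt) : List (ι × ι)) := by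
    rw [endPairs_coe]
    simp only [PathSystem.lists, List.flatMap_map, PathIn.verts, endPair_support]
    rw [← List.map_eq_flatMap]
  rw [h1]
  conv_lhs => rw [← List.ofFn_get P.paths]
  rw [List.map_ofFn]
  simp [Fin.univ_def, List.ofFn_eq_map, Function.comp_def]

/-- This passes from walks and degrees in a `Graph` to closed sets and end counts. `Nonempty ι` is a
separate condition because `EdgeConn` holds vacuously without vertices. -/
theorem PathSystem.isConnecting_iff [DecidableEq ι] (P : PathSystem G) :
    P.IsConnecting part ↔
      Nonempty ι ∧ EdgeEulerian (endPairs part (P.lists : Multiset (List V))) := by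
  classical
  set s : Fin P.paths.length → ι := fun e => part (P.paths.get e).src with hs
  set t : Fin P.paths.length → ι := fun e => part (P.paths.get e).tgt with ht
  have hlink : ∀ e x y, (P.reducedMultigraph part).IsLink e x y ↔ s(s e, t e) = s(x, y) :=
    fun e x y => Iff.rfl
  have hE : endPairs part (P.lists : Multiset (List V)) =
    (Finset.univ : Finset (Fin P.paths.length)).val.map fun e => (s e, t e) := P.endPairs_eq
  have hdeg : ∀ x, multiDegree (P.reducedMultigraph part) x =
      edgeDegree (endPairs part (P.lists : Multiset (List V))) x := by
    intro x
    rw [hE, edgeDegree, multiDegree, Multiset.map_map, Multiset.map_map, Multiset.count_map,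
      Multiset.count_map]
    have h1 : {e | (P.reducedMultigraph part).IsNonloopAt e x} =
        ↑(Finset.univ.filter fun e => (x = s e ∧ x ≠ t e) ∨ (x = t e ∧ x ≠ s e)) := by
      ext e
      simp only [Set.mem_ofPred_eq, Graph.IsNonloopAt, hlink, Sym2.eq_iff, Finset.coe_filter,
        Finset.mem_univ, true_and]
      constructor
      · rintro ⟨y, hy, ⟨rfl, rfl⟩ | ⟨rfl, rfl⟩⟩
        · exact Or.inl ⟨rfl, hy.symm⟩
        · exact Or.inr ⟨rfl, hy.symm⟩
      · rintro (⟨rfl, h⟩ | ⟨rfl, h⟩)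
        · exact ⟨_, h.symm, Or.inl ⟨rfl, rfl⟩⟩
        · exact ⟨_, h.symm, Or.inr ⟨rfl, rfl⟩⟩
    have h2 : {e | (P.reducedMultigraph part).IsLoopAt e x} =
        ↑(Finset.univ.filter fun e => x = s e ∧ x = t e) := by
      ext e
      simp only [Set.mem_ofPred_eq, Graph.IsLoopAt, hlink, Sym2.eq_iff, Finset.coe_filter,
        Finset.mem_univ, true_and]
      grind
    rw [h1, h2, Set.ncard_coe_finset, Set.ncard_coe_finset]
    change _ = (Finset.univ.filter fun e => x = s e).card + (Finset.univ.filter fun e => x = t e).card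
    -- The comparison is made edge by edge: a loop counts 2 on both sides, once as source and once
    -- as target on the right.
    simp only [Finset.card_filter, Finset.mul_sum]
    rw [← Finset.sum_add_distrib, ← Finset.sum_add_distrib]
    refine Finset.sum_congr rfl fun e _ => ?_
    by_cases c1 : x = s e <;> by_cases c2 : x = t e <;> simp [c1, c2]
    all_goals grind
  have hconn : (∀ x y, Relation.ReflTransGen (P.reducedMultigraph part).Adj x y) ↔
      EdgeConn (endPairs part (P.lists : Multiset (List V))) := by
    rw [hE]
    constructor
    · intro h C hC x y hx
      have hC' : ∀ e, C (s e) ↔ C (t e) := fun e =>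
        hC _ (Multiset.mem_map_of_mem (fun e => (s e, t e)) (Finset.mem_univ e))
      have := h x y
      induction this with
      | refl => exact hx
      | tail _ hyz ih =>
        obtain ⟨e, he⟩ := hyz
        rw [hlink, Sym2.eq_iff] at he
        rcases he with ⟨h1, h2⟩ | ⟨h1, h2⟩
        · rw [← h2, ← hC', h1]; exact ih
        · rw [← h1, hC', h2]; exact ih
    · intro h x y
      -- The closed set to use is the set of vertices reachable from `x`.
      refine h (fun z => Relation.ReflTransGen (P.reducedMultigraph part).Adj x z) ?_ x y .refl
      intro e' he'
      obtain ⟨e, -, rfl⟩ := Multiset.mem_map.1 he'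
      have h1 : (P.reducedMultigraph part).Adj (s e) (t e) := ⟨e, (hlink _ _ _).2 rfl⟩
      exact ⟨fun h => h.tail h1, fun h => h.tail h1.symm⟩
  rw [PathSystem.IsConnecting, IsEulerian, MultiConnected, EdgeEulerian, ← hconn]
  have hV : (P.reducedMultigraph part).vertexSet = Set.univ := rfl
  simp only [hV, Set.mem_univ, true_implies, hdeg, ← Set.nonempty_iff_univ_nonempty]
  tauto

end Bridge

/-! ### Recognizing encodings of connecting path systems -/

/-- Replace label `reg 50` by label `reg 51`. -/
def relabel : Prog :=
  forTo 52 1 [.load 53 8 52, .cond (.eq 53 50) (block [.store 8 52 51]) (block [])]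

/-- Set all parities to `0` and give each part its own label. -/
def initParts : Prog := forTo 52 1 [.store 7 52 2, .store 8 52 52]

/-- Does the token in register `45` differ from all earlier ones? -/
def checkFresh : Prog :=
  forTo 46 44 [.load 47 2 46, .cond (.eq 47 45) (block [.const 43 0]) (block [])]

/-- Process the end of a path. -/
def endOfPath : List Prog :=
  [.cond (.eq 40 2) (block [.const 43 0]) (block [.sub 48 41 3, .load 48 1 48, .sub 49 40 3,
    .load 49 1 49, .load 53 7 48, .sub 53 3 53, .store 7 48 53, .load 53 7 49, .sub 53 3 53,
    .store 7 49 53, .load 50 8 48, .load 51 8 49, .const 52 0, relabel, .const 40 0])]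

/-- Process the next vertex of a path. -/
def nextVertex : List Prog :=
  [.const 46 0, checkFresh, .cond (.eq 40 2) (block [.copy 41 45])
    (block [.sub 48 40 3, .mul 48 48 0, .sub 49 45 3, .add 48 48 49, .load 48 0 48,
      .cond (.eq 48 3) (block []) (block [.const 43 0]), .add 42 42 3]), .copy 40 45]

/-- Process all tokens. -/
def readTokens : Prog :=
  forTo 44 33 [.load 45 2 44, .cond (.eq 45 2) (block endOfPath) (block nextVertex)]

/-- Are all parities `0` and all labels equal? -/
def checkParts : Prog :=
  forTo 52 1 [.load 53 7 52, .cond (.eq 53 2) (block []) (block [.const 43 0]),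
    .load 53 8 52, .cond (.eq 53 54) (block []) (block [.const 43 0])]

/-- Set register `43` to `1` if and only if the first `reg 33` tokens encode a connecting path
system with at most `reg 4` edges. -/
def checkTokens : Prog :=
  block [.const 40 0, .const 41 0, .const 42 0, .const 43 1, .const 52 0, initParts,
    .const 44 0, readTokens, .cond (.eq 40 2) (block []) (block [.const 43 0]),
    .cond (.lt 4 42) (block [.const 43 0]) (block []), .const 52 0, .load 54 8 2, checkParts]

/-- Components are merged by a full sweep over the `m` labels; a linear cost in `m` is harmless
beside the size of the search. -/
theorem relabel_spec {B m : ℕ} {σ : State} (h1 : σ.reg 1 = m) (h3 : σ.reg 3 = 1)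
    (h52 : σ.reg 52 = 0) (hB : m < B) : Runs B relabel σ (m * 7 + 1) fun σ' =>
      ∀ x < m, σ'.arr 8 x = if σ.arr 8 x = σ.reg 50 then σ.reg 51 else σ.arr 8 x := by
  refine Runs.mono (Runs.forTo (T := 5) (N := m) (fun k τ => (∀ x < k, τ.arr 8 x =
    if σ.arr 8 x = σ.reg 50 then σ.reg 51 else σ.arr 8 x) ∧ ∀ x, k ≤ x → τ.arr 8 x = σ.arr 8 x)
    (by decide) (by decide) (by decide) (by decide) (by decide) hB h52 h1 h3
    ⟨by simp, by simp⟩ ?_) le_rfl fun σ' _ h => h.1.1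
  intro k hk τ hA hτ ⟨hI, hI'⟩
  have e50 : τ.reg 50 = σ.reg 50 := hA.reg 50 (by decide)
  have e51 : τ.reg 51 = σ.reg 51 := hA.reg 51 (by decide)
  have e8 := hI' k le_rfl
  simp [hτ, e50, e51, e8]
  constructor
  · intro h
    constructor
    · intro x hx
      rcases hx.lt_or_eq with hx | rfl
      · simp [hx.ne, hI x hx]
      · simp [h]
    · intro x hx
      have : x ≠ k := by omega
      simp [this, hI' x (by omega)]
  · intro h
    constructor
    · intro x hx
      rcases hx.lt_or_eq with hx | rfl
      · exact hI x hx
      · simp [h, e8]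
    · exact fun x hx => hI' x (by omega)

theorem initParts_spec {B m : ℕ} {σ : State} (h1 : σ.reg 1 = m) (h3 : σ.reg 3 = 1)
    (h2 : σ.reg 2 = 0) (h52 : σ.reg 52 = 0) (hB : m < B) : Runs B initParts σ (m * 5 + 1) fun σ' =>
      ∀ x < m, σ'.arr 7 x = 0 ∧ σ'.arr 8 x = x := by
  refine Runs.mono (Runs.forTo (T := 3) (N := m) (fun k τ => ∀ x < k, τ.arr 7 x = 0 ∧ τ.arr 8 x = x)
    (by decide) (by decide) (by decide) (by decide) (by decide) hB h52 h1 h3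
    (by simp) ?_) le_rfl fun σ' _ h => h.1
  intro k hk τ hA hτ hI
  have e2 : τ.reg 2 = σ.reg 2 := hA.reg 2 (by decide)
  simp [hτ, e2, h2]
  intro x hx
  rcases hx.lt_or_eq with hx | rfl
  · simp [hx.ne, hI x hx]
  · simp

theorem checkFresh_spec {B i : ℕ} {σ : State} (h44 : σ.reg 44 = i) (h3 : σ.reg 3 = 1)
    (h46 : σ.reg 46 = 0) (hB : i < B) : Runs B checkFresh σ (i * 7 + 1) fun σ' =>
      (σ'.reg 43 = 1 ↔ σ.reg 43 = 1 ∧ σ.reg 45 ∉ (List.range i).map (σ.arr 2)) := by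
  refine Runs.mono (Runs.forTo (T := 5) (N := i) (fun k τ =>
    (τ.reg 43 = 1 ↔ σ.reg 43 = 1 ∧ σ.reg 45 ∉ (List.range k).map (σ.arr 2)))
    (by decide) (by decide) (by decide) (by decide) (by decide) hB h46 h44 h3
    (by simp) ?_) le_rfl fun σ' _ h => h.1
  intro k hk τ hA hτ hI
  have e2 : τ.arr 2 = σ.arr 2 := hA.arr 2 (by decide)
  have e45 : τ.reg 45 = σ.reg 45 := hA.reg 45 (by decide)
  rw [List.range_succ, List.map_append]
  simp [hτ, e2, e45] at hI ⊢
  grind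

theorem checkParts_spec {B m : ℕ} {σ : State} (h1 : σ.reg 1 = m) (h3 : σ.reg 3 = 1)
    (h2 : σ.reg 2 = 0) (h52 : σ.reg 52 = 0) (hB : m < B) :
    Runs B checkParts σ (m * 12 + 1) fun σ' =>
      (σ'.reg 43 = 1 ↔ σ.reg 43 = 1 ∧ ∀ x < m, σ.arr 7 x = 0 ∧ σ.arr 8 x = σ.reg 54) := by
  refine Runs.mono (Runs.forTo (T := 10) (N := m) (fun k τ =>
    (τ.reg 43 = 1 ↔ σ.reg 43 = 1 ∧ ∀ x < k, σ.arr 7 x = 0 ∧ σ.arr 8 x = σ.reg 54))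
    (by decide) (by decide) (by decide) (by decide) (by decide) hB h52 h1 h3
    (by simp) ?_) le_rfl fun σ' _ h => h.1
  intro k hk τ hA hτ hI
  have e2 : τ.reg 2 = σ.reg 2 := hA.reg 2 (by decide)
  have e54 : τ.reg 54 = σ.reg 54 := hA.reg 54 (by decide)
  have e7 : τ.arr 7 = σ.arr 7 := hA.arr 7 (by decide)
  have e8 : τ.arr 8 = σ.arr 8 := hA.arr 8 (by decide)
  simp [hτ, e2, h2, e54, e7, e8, forall_and] at hI ⊢
  grind

/-! ### Token lists and the invariant of their reader -/

section Tokens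

variable {n m : ℕ} {G : SimpleGraph (Fin n)} {part : Fin n → Fin m}

/-- The vertices of a path as tokens. -/
def tokens (c : List (Fin n)) : List ℕ := c.map fun v => v.val + 1

/-- The token list of a list of paths. -/
def encodeLists (L : List (List (Fin n))) : List ℕ := L.flatMap fun l => tokens l ++ [0]

theorem PathSystem.encode_eq (P : PathSystem G) : P.encode = encodeLists P.lists := by
  simp [PathSystem.encode, encodeLists, PathSystem.lists, List.flatMap_map, tokens]

theorem mem_encodeLists {L : List (List (Fin n))} {c : List (Fin n)} {v : Fin n} :
    v.val + 1 ∈ encodeLists L ++ tokens c ↔ v ∈ L.flatten ++ c := by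
  simp [encodeLists, tokens, Fin.val_inj]

theorem encodeLists_append (L : List (List (Fin n))) (c : List (Fin n)) :
    encodeLists (L ++ [c]) = encodeLists L ++ tokens c ++ [0] := by
  simp [encodeLists]

theorem tokens_append_singleton (c : List (Fin n)) (v : Fin n) :
    tokens (c ++ [v]) = tokens c ++ [v.val + 1] := by
  simp [tokens]

/-- Vertex tokens are positive and `0` only terminates paths, so the first `0` marks the end of the
first path. -/
theorem encodeLists_injective {L L' : List (List (Fin n))} (h : encodeLists L = encodeLists L') :
    L = L' := by
  have split : ∀ (l l' : List (Fin n)) (t t' : List ℕ), tokens l ++ 0 :: t = tokens l' ++ 0 :: t' →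
      l = l' ∧ t = t' := by
    intro l
    induction l with
    | nil =>
      intro l' t t' h
      cases l' with
      | nil => simpa [tokens] using h
      | cons v l' => simp [tokens] at h
    | cons v l ih =>
      intro l' t t' h
      cases l' with
      | nil => simp [tokens] at h
      | cons v' l' =>
        simp only [tokens, List.map_cons, List.cons_append, List.cons.injEq, add_left_inj,
          Fin.val_inj] at h
        obtain ⟨rfl, h⟩ := h
        obtain ⟨rfl, rfl⟩ := ih l' t t' h
        exact ⟨rfl, rfl⟩
  induction L generalizing L' with
  | nil =>
    cases L' with
    | nil => rfl
    | cons l' L' => simp [encodeLists] at h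
  | cons l L ih =>
    cases L' with
    | nil => simp [encodeLists] at h
    | cons l' L' =>
      simp only [encodeLists, List.flatMap_cons, List.append_assoc, List.singleton_append] at h
      obtain ⟨rfl, h'⟩ := split _ _ _ _ h
      rw [ih h']

/-- A list of paths and an initial segment of another path, all disjoint. -/
structure IsPartial (G : SimpleGraph (Fin n)) (L : List (List (Fin n))) (c : List (Fin n)) :
    Prop where
  ne_nil : ∀ l ∈ L, l ≠ []
  chain : ∀ l ∈ L, l.IsChain G.Adj
  chain_last : c.IsChain G.Adj
  nodup : (L.flatten ++ c).Nodup

theorem isPartial_nil {L : List (List (Fin n))} :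
    IsPartial G L [] ↔ IsPathFamily G (L : Multiset (List (Fin n))) := by
  constructor
  · intro h
    refine ⟨h.ne_nil, h.chain, ?_⟩
    rw [allVerts_coe, Multiset.coe_nodup]
    simpa using h.nodup
  · intro h
    refine ⟨h.ne_nil, h.chain, by simp, ?_⟩
    have := h.nodup
    rw [allVerts_coe, Multiset.coe_nodup] at this
    simpa using this

theorem isPartial_endOfPath {L : List (List (Fin n))} {c : List (Fin n)} :
    IsPartial G (L ++ [c]) [] ↔ c ≠ [] ∧ IsPartial G L c := by
  constructor
  · rintro ⟨h1, h2, -, h4⟩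
    exact ⟨h1 c (by simp), fun l hl => h1 l (by simp [hl]), fun l hl => h2 l (by simp [hl]),
      h2 c (by simp), by simpa using h4⟩
  · rintro ⟨h, h1, h2, h3, h4⟩
    refine ⟨fun l hl => ?_, fun l hl => ?_, by simp, by simpa using h4⟩
    · rcases List.mem_append.1 hl with hl | hl
      · exact h1 l hl
      · rwa [List.mem_singleton.1 hl]
    · rcases List.mem_append.1 hl with hl | hl
      · exact h2 l hl
      · rwa [List.mem_singleton.1 hl]

/-- Validity can be tested online: a new vertex only has to be fresh and adjacent to the last one.
-/
theorem isPartial_nextVertex {L : List (List (Fin n))} {c : List (Fin n)} {v : Fin n} :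
    IsPartial G L (c ++ [v]) ↔
      IsPartial G L c ∧ v ∉ L.flatten ++ c ∧ ∀ u ∈ c.getLast?, G.Adj u v := by
  have hn : (L.flatten ++ (c ++ [v])).Nodup ↔ (L.flatten ++ c).Nodup ∧ v ∉ L.flatten ++ c := by
    rw [← List.append_assoc, List.nodup_append]
    simp
    intros
    constructor <;> intro h
    · exact ⟨fun x hx hv => h v (Or.inl ⟨x, hx, hv⟩) rfl, fun hv => h v (Or.inr hv) rfl⟩
    · rintro a (⟨x, hx, ha⟩ | ha) rfl
      · exact h.1 x hx ha
      · exact h.2 ha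
  constructor
  · rintro ⟨h1, h2, h3, h4⟩
    have h5 := List.isChain_append.1 h3
    exact ⟨⟨h1, h2, h5.1, (hn.1 h4).1⟩, (hn.1 h4).2, fun u hu => h5.2.2 u hu v (by simp)⟩
  · rintro ⟨⟨h1, h2, h3, h4⟩, h5, h6⟩
    exact ⟨h1, h2, List.isChain_append.2 ⟨h3, by simp, by simpa using h6⟩, hn.2 ⟨h4, h5⟩⟩

/-- The labels describe the connected components of the multigraph. -/
structure LabelInv {ι : Type*} (E : Multiset (ι × ι)) (label : ι → ℕ) : Prop where
  eq : ∀ e ∈ E, label e.1 = label e.2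
  closed : ∀ C : ι → Prop, (∀ e ∈ E, C e.1 ↔ C e.2) → ∀ x y, label x = label y → C x → C y

/-- Giving the class of `a` the label of `b` merges the two components joined by the new edge. In
each case a path through `a` and `b` transports membership in a closed set. -/
theorem LabelInv.cons {ι : Type*} {E : Multiset (ι × ι)} {label label' : ι → ℕ}
    (h : LabelInv E label) (a b : ι)
    (h' : ∀ x, label' x = if label x = label a then label b else label x) :
    LabelInv ((a, b) ::ₘ E) label' := by
  constructor
  · intro e he
    rw [h', h']
    rcases Multiset.mem_cons.1 he with rfl | he
    · simp
    · rw [h.eq e he]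
  · intro C hC x y hxy hx
    simp only [Multiset.forall_mem_cons] at hC
    have h1 := fun x y => h.closed C hC.2 x y
    rw [h', h'] at hxy
    have h2 := h1 x y
    have h3 := h1 x a
    have h4 := h1 a y
    have h5 := h1 x b
    have h6 := h1 b y
    have h7 := hC.1
    split_ifs at hxy with c1 c2 c2
    · exact h2 (c1.trans c2.symm) hx
    · exact h6 hxy (h7.1 (h3 c1 hx))
    · exact h4 c2.symm (h7.2 (h5 hxy hx))
    · exact h2 hxy hx

/-- The label classes are themselves closed, and every closed set is a union of label classes, so
they are exactly the components. -/
theorem LabelInv.conn_iff {ι : Type*} {E : Multiset (ι × ι)} {label : ι → ℕ}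
    (h : LabelInv E label) (x₀ : ι) : EdgeConn E ↔ ∀ x, label x = label x₀ := by
  constructor
  · intro hE x
    exact hE (fun y => label y = label x₀) (fun e he => by rw [h.eq e he]) x₀ x rfl
  · intro hl C hC x y hx
    exact h.closed C hC x y ((hl x).trans (hl y).symm) hx

/-- The parts of the state that all parts of the program may rely on. -/
structure HoldsInput (G : SimpleGraph (Fin n)) (part : Fin n → Fin m) (σ : State) : Prop where
  reg0 : σ.reg 0 = n
  reg1 : σ.reg 1 = m
  reg2 : σ.reg 2 = 0
  reg3 : σ.reg 3 = 1
  adj : ∀ u v : Fin n, σ.arr 0 (u.val * n + v.val) = 1 ↔ G.Adj u v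
  part : ∀ v : Fin n, σ.arr 1 v.val = (part v).val

theorem HoldsInput.of_agree {p : Prog} {σ σ' : State} (h : HoldsInput G part σ)
    (hA : Agree p σ σ') (h0 : 0 ∉ p.wregs) (h1 : 1 ∉ p.wregs) (h2 : 2 ∉ p.wregs)
    (h3 : 3 ∉ p.wregs) (a0 : 0 ∉ p.warrs) (a1 : 1 ∉ p.warrs) : HoldsInput G part σ' := by
  refine ⟨?_, ?_, ?_, ?_, fun u v => ?_, fun v => ?_⟩
  · rw [hA.reg 0 h0, h.reg0]
  · rw [hA.reg 1 h1, h.reg1]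
  · rw [hA.reg 2 h2, h.reg2]
  · rw [hA.reg 3 h3, h.reg3]
  · rw [hA.arr 0 a0, h.adj]
  · rw [hA.arr 1 a1, h.part]

/-- The state after the tokens `encodeLists L ++ tokens c`. -/
structure ReadInv (G : SimpleGraph (Fin n)) (part : Fin n → Fin m) (L : List (List (Fin n)))
    (c : List (Fin n)) (σ : State) : Prop where
  prev_nil : c = [] → σ.reg 40 = 0
  prev : ∀ v ∈ c.getLast?, σ.reg 40 = v.val + 1
  first : ∀ v ∈ c.head?, σ.reg 41 = v.val + 1
  edges : σ.reg 42 = stepSum (fun _ => 1) (L : Multiset (List (Fin n))) + (c.length - 1)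
  ok : σ.reg 43 = 1 ↔ IsPartial G L c
  parity : ∀ x : Fin m, σ.arr 7 x.val =
    edgeDegree (endPairs part (L : Multiset (List (Fin n)))) x % 2
  label : LabelInv (endPairs part (L : Multiset (List (Fin n)))) fun x => σ.arr 8 x.val

theorem ReadInv.congr {L : List (List (Fin n))} {c : List (Fin n)} {σ σ' : State}
    (h : ReadInv G part L c σ) (h0 : σ'.reg 40 = σ.reg 40) (h1 : σ'.reg 41 = σ.reg 41)
    (h2 : σ'.reg 42 = σ.reg 42) (h3 : σ'.reg 43 = σ.reg 43) (h7 : σ'.arr 7 = σ.arr 7)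
    (h8 : σ'.arr 8 = σ.arr 8) : ReadInv G part L c σ' :=
  ⟨by rw [h0]; exact h.prev_nil, by rw [h0]; exact h.prev, by rw [h1]; exact h.first,
    by rw [h2]; exact h.edges, by rw [h3]; exact h.ok, by rw [h7]; exact h.parity,
    by rw [h8]; exact h.label⟩

theorem endPairs_append_nil (L : List (List (Fin n))) :
    endPairs part ((L ++ [[]] : List (List (Fin n))) : Multiset (List (Fin n))) =
      endPairs part (L : Multiset (List (Fin n))) := by
  simp [endPairs_coe, endPair]

theorem endPairs_append (L : List (List (Fin n))) {c : List (Fin n)} {a b : Fin n}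
    (ha : a ∈ c.head?) (hb : b ∈ c.getLast?) :
    endPairs part ((L ++ [c] : List (List (Fin n))) : Multiset (List (Fin n))) =
      (part a, part b) ::ₘ endPairs part (L : Multiset (List (Fin n))) := by
  have : endPair part c = [(part a, part b)] := by
    cases c with
    | nil => simp at ha
    | cons x c =>
      simp only [List.head?_cons, Option.mem_def, Option.some.injEq] at ha
      rw [Option.mem_def, List.getLast?_eq_some_getLast (by simp), Option.some.injEq] at hb
      subst ha
      simp only [endPair, hb]
  rw [← endPairs_cons part this]
  congr 1
  exact Multiset.coe_eq_coe.2 (List.perm_append_singleton c L)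

theorem stepSum_append (L : List (List (Fin n))) (c : List (Fin n)) :
    stepSum (fun _ => 1) ((L ++ [c] : List (List (Fin n))) : Multiset (List (Fin n))) =
      stepSum (fun _ => 1) (L : Multiset (List (Fin n))) + (c.length - 1) := by
  simp [stepSum, length_stepPairs]

/-- If the path is empty, the flag is cleared, while the empty list added to `L` contributes no
reduced edge. Thus the other fields of `ReadInv` stay correct for invalid inputs as well. -/
theorem endOfPath_spec {B : ℕ} {σ : State} {L : List (List (Fin n))} {c : List (Fin n)}
    (hI : HoldsInput G part σ) (h : ReadInv G part L c σ) (hB : m + 1 < B) :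
    Runs B (block endOfPath) σ (m * 7 + 20) fun σ' => ReadInv G part (L ++ [c]) [] σ' := by
  by_cases hc : c = []
  · have h40 := h.prev_nil hc
    subst hc
    simp [endOfPath, h40, hI.reg2]
    refine ⟨by omega, ⟨by simp [h40], by simp, by simp, ?_, ?_, ?_, ?_⟩⟩
    · simp [h.edges, stepSum_append]
    · simp only [State.reg_setReg, if_true, zero_ne_one, false_iff]
      rw [isPartial_endOfPath]
      simp
    · rw [endPairs_append_nil]; exact h.parity
    · rw [endPairs_append_nil]; exact h.label
  · obtain ⟨a, ha⟩ : ∃ a, a ∈ c.head? := ⟨c.head hc, List.head?_eq_some_head hc⟩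
    obtain ⟨b, hb⟩ : ∃ b, b ∈ c.getLast? := ⟨c.getLast hc, List.getLast?_eq_some_getLast hc⟩
    have h40 := h.prev b hb
    have h41 := h.first a ha
    simp [endOfPath, h40, h41, hI.reg2, hI.reg3, hI.part]
    refine ⟨by omega, ?_⟩
    refine Runs.cons (T₂ := 2) (relabel_spec (m := m) (by simp [hI.reg1]) (by simp [hI.reg3])
      (by simp) (by omega)) ?_ (by omega)
    intro τ hA hτ
    have e42 := hA.reg 42 (by decide)
    have e43 := hA.reg 43 (by decide)
    have e7 := hA.arr 7 (by decide)
    simp at e42 e43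
    simp at hτ
    simp
    refine ⟨by omega, ⟨by simp, by simp, by simp, ?_, ?_, ?_, ?_⟩⟩
    · simp [e42, h.edges, stepSum_append]
    · simp [e43, h.ok, isPartial_endOfPath, hc]
    -- The two parities are toggled one after the other, so a loop toggles the same entry twice and
    -- leaves it unchanged.
    · intro x
      have hx := h.parity x
      have hxa := h.parity (part a)
      have hxb := h.parity (part b)
      rw [endPairs_append L ha hb, edgeDegree_cons]
      simp [e7]
      simp only [Fin.val_inj]
      grind
    · rw [endPairs_append L ha hb]
      refine h.label.cons _ _ fun x => ?_
      exact hτ x x.2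

end Tokens

/-! ### Correctness of the recognizer -/

section Check

variable {n m : ℕ} {G : SimpleGraph (Fin n)} {part : Fin n → Fin m}

theorem nextVertex_spec {B i : ℕ} {σ : State} {L : List (List (Fin n))} {c : List (Fin n)}
    {v : Fin n} (hI : HoldsInput G part σ) (h : ReadInv G part L c σ)
    (hi : σ.reg 44 = i) (hv : σ.reg 45 = v.val + 1)
    (ht : (List.range i).map (σ.arr 2) = encodeLists L ++ tokens c)
    (hB : n * n + n < B) (hiB : i < B) (hn : σ.reg 42 + 1 < B) :
    Runs B (block nextVertex) σ (i * 7 + 20) fun σ' => ReadInv G part L (c ++ [v]) σ' := by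
  have hvn := v.2
  simp [nextVertex]
  refine ⟨by omega, ?_⟩
  refine Runs.cons (T₂ := 15) (checkFresh_spec (i := i) (by simp [hi]) (by simp [hI.reg3])
    (by simp) hiB) ?_ (by omega)
  intro τ hA hτ
  have e0 := hA.reg 0 (by decide)
  have e2 := hA.reg 2 (by decide)
  have e3 := hA.reg 3 (by decide)
  have e40 := hA.reg 40 (by decide)
  have e41 := hA.reg 41 (by decide)
  have e42 := hA.reg 42 (by decide)
  have e45 := hA.reg 45 (by decide)
  have a0 := hA.arr 0 (by decide)
  have a7 := hA.arr 7 (by decide)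
  have a8 := hA.arr 8 (by decide)
  simp at e0 e2 e3 e40 e41 e42 e45 a0 a7 a8
  simp only [State.reg_setReg, State.arr_setReg, ht, hv] at hτ
  simp only [Nat.reduceEqDiff, if_false, mem_encodeLists, h.ok] at hτ
  by_cases hc : c = []
  · have h40 := h.prev_nil hc
    subst hc
    simp [e2, e40, hI.reg2, h40, e45, hv]
    refine ⟨by simp, by simp, by simp, ?_, ?_, ?_, ?_⟩
    · simp [e42, h.edges]
    · have := isPartial_nextVertex (G := G) (L := L) (c := []) (v := v)
      simp [hτ] at this ⊢
      rw [this]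
    · simpa [a7] using h.parity
    · simpa [a8] using h.label
  · obtain ⟨b, hb⟩ : ∃ b, b ∈ c.getLast? := ⟨c.getLast hc, List.getLast?_eq_some_getLast hc⟩
    have h40 := h.prev b hb
    have hlen : 0 < c.length := List.length_pos_iff.2 hc
    have hbn : b.val * n + v.val < n * n := by
      have : (b.val + 1) * n ≤ n * n := Nat.mul_le_mul_right n b.2
      rw [add_mul] at this
      omega
    have hfirst : ∀ w ∈ (c ++ [v]).head?, σ.reg 41 = w.val + 1 := by
      intro w hw
      refine h.first w ?_
      cases c with
      | nil => exact absurd rfl hc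
      | cons x c => simpa using hw
    have hedge : σ.reg 42 + 1 = stepSum (fun _ => 1) (L : Multiset (List (Fin n))) +
        ((c ++ [v]).length - 1) := by
      rw [h.edges, List.length_append, List.length_singleton]
      omega
    have hok := isPartial_nextVertex (G := G) (L := L) (c := c) (v := v)
    rw [Option.mem_def] at hb
    simp only [hb, Option.mem_def, Option.some.injEq, forall_eq'] at hok
    simp [e2, e40, hI.reg2, h40, e45, hv, e0, hI.reg0, a0, hI.adj, e3, hI.reg3, e42]
    refine ⟨by omega, by omega, fun hadj => ⟨hn, ?_⟩, fun hadj => ⟨by omega, hn, ?_⟩⟩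
    · refine ⟨by simp, by simp, by simpa [e41] using hfirst, by simpa using hedge, ?_, ?_, ?_⟩
      · simp only [State.reg_setReg]
        simp [hτ, hok, hadj]
      · simpa [a7] using h.parity
      · simpa [a8] using h.label
    · refine ⟨by simp, by simp, by simpa [e41] using hfirst, by simpa using hedge, ?_, ?_, ?_⟩
      · simp [hok, hadj]
      · simpa [a7] using h.parity
      · simpa [a8] using h.label

theorem readTokens_spec {B ℓ : ℕ} {σ : State} (hI : HoldsInput G part σ)
    (h : ReadInv G part [] [] σ) (h33 : σ.reg 33 = ℓ) (h44 : σ.reg 44 = 0)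
    (hB : n * n + n < B) (hm : m + 1 < B) (hℓ : ℓ + 1 < B) (ht : ∀ i < ℓ, σ.arr 2 i ≤ n) :
    Runs B readTokens σ (ℓ * (ℓ * 7 + m * 7 + 30) + 1) fun σ' => ∃ L c, ReadInv G part L c σ' ∧
      (List.range ℓ).map (σ.arr 2) = encodeLists L ++ tokens c := by
  refine Runs.mono (Runs.forTo (T := ℓ * 7 + m * 7 + 25) (N := ℓ) (fun k τ =>
    ∃ L c, ReadInv G part L c τ ∧ (List.range k).map (σ.arr 2) = encodeLists L ++ tokens c)
    (by decide) (by decide) (by decide) (by decide) (by decide) (by omega) h44 h33 hI.reg3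
    ⟨[], [], h, rfl⟩ ?_) (Nat.add_le_add_right (Nat.mul_le_mul_left _ (by omega)) _) fun σ' _ h => h.1
  rintro k hk τ hA hτ ⟨L, c, hR, hts⟩
  have hIτ : HoldsInput G part τ :=
    hI.of_agree hA (by decide) (by decide) (by decide) (by decide) (by decide) (by decide)
  have e2 : τ.arr 2 = σ.arr 2 := hA.arr 2 (by decide)
  -- The edge counter never exceeds the number of tokens read, which keeps its increment within a
  -- word.
  have hedges : τ.reg 42 ≤ k := by
    have hl := congrArg List.length hts
    rw [hR.edges]
    simp only [List.length_map, List.length_range, List.length_append, tokens] at hl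
    have : stepSum (fun _ => 1) (L : Multiset (List (Fin n))) ≤ (encodeLists L).length := by
      simp only [stepSum, Multiset.map_coe, Multiset.sum_coe, encodeLists, List.length_flatMap]
      refine List.sum_le_sum fun l _ => ?_
      simp [length_stepPairs, tokens]
      omega
    omega
  have hcongr : ∀ {L c τ'}, ReadInv G part L c τ' → ReadInv G part L c (τ'.setReg 44 (k + 1)) :=
    fun h => h.congr (by simp) (by simp) (by simp) (by simp) rfl rfl
  set x := σ.arr 2 k with hx
  have hlast : (List.range (k + 1)).map (σ.arr 2) = (List.range k).map (σ.arr 2) ++ [x] := by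
    rw [List.range_succ, List.map_append]; rfl
  have hstart : ∀ {T Q}, Runs B (block [.load 45 2 44, .cond (.eq 45 2) (block endOfPath)
      (block nextVertex)]) τ (T + 4) Q ↔
      (x = 0 → Runs B (block endOfPath) (τ.setReg 45 x) (T + 1) Q) ∧
      (x ≠ 0 → Runs B (block nextVertex) (τ.setReg 45 x) (T + 1) Q) := by
    intro T Q
    rw [show T + 4 = (T + 1 + 2) + 1 by rfl, runs_load, runs_cond]
    simp [hτ, e2, ← hx, hIτ.reg2]
  have hI' : HoldsInput G part (τ.setReg 45 x) :=
    ⟨by simp [hIτ.reg0], by simp [hIτ.reg1], by simp [hIτ.reg2], by simp [hIτ.reg3], hIτ.adj,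
      hIτ.part⟩
  have hR' : ReadInv G part L c (τ.setReg 45 x) :=
    hR.congr (by simp) (by simp) (by simp) (by simp) rfl rfl
  refine (hstart (T := ℓ * 7 + m * 7 + 21)).2 ⟨fun h0 => ?_, fun h0 => ?_⟩
  · refine (endOfPath_spec hI' hR' hm).mono (by omega) fun τ' _ h' => ⟨L ++ [c], [], hcongr h', ?_⟩
    rw [hlast, hts, encodeLists_append, h0]
    simp [tokens]
  · obtain ⟨v, hv⟩ : ∃ v : Fin n, x = v.val + 1 :=
      ⟨⟨x - 1, by have := ht k hk; omega⟩, by simp; omega⟩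
    refine (nextVertex_spec (i := k) (v := v) hI' hR' (by simp [hτ]) (by simp [hv])
      (by simpa [e2] using hts) hB (by omega) (by simp; omega)).mono (by omega)
      fun τ' _ h' => ⟨L, c ++ [v], hcongr h', ?_⟩
    rw [hlast, hts, tokens_append_singleton, hv, List.append_assoc]

theorem checkTokens_spec {B ℓ M : ℕ} {σ : State} (hI : HoldsInput G part σ) (hm0 : 0 < m)
    (h33 : σ.reg 33 = ℓ) (h4 : σ.reg 4 = M)
    (hB : n * n + n < B) (hm : m + 1 < B) (hℓ : ℓ + 1 < B) (ht : ∀ i < ℓ, σ.arr 2 i ≤ n) :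
    Runs B checkTokens σ (ℓ * (ℓ * 7 + m * 7 + 30) + m * 17 + 30) fun σ' =>
      (σ'.reg 43 = 1 ↔ ∃ L : List (List (Fin n)), IsGood G part (L : Multiset (List (Fin n))) ∧
        stepSum (fun _ => 1) (L : Multiset (List (Fin n))) ≤ M ∧
        (List.range ℓ).map (σ.arr 2) = encodeLists L) := by
  rw [checkTokens]
  simp
  refine ⟨by omega, by omega, by omega, ?_⟩
  refine Runs.cons (T₂ := ℓ * (ℓ * 7 + m * 7 + 30) + m * 12 + 20) (initParts_spec (m := m)
    (by simp [hI.reg1]) (by simp [hI.reg3]) (by simp [hI.reg2]) (by simp) (by omega)) ?_ (by omega)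
  intro σ₁ hA₁ hσ₁
  have e40 := hA₁.reg 40 (by decide)
  have e41 := hA₁.reg 41 (by decide)
  have e42 := hA₁.reg 42 (by decide)
  have e43 := hA₁.reg 43 (by decide)
  have e33 := hA₁.reg 33 (by decide)
  have e4 := hA₁.reg 4 (by decide)
  have a2 := hA₁.arr 2 (by decide)
  simp [h33, h4] at e40 e41 e42 e43 e33 e4 a2
  have hI₁ : HoldsInput G part σ₁ := by
    refine HoldsInput.of_agree (p := initParts) (σ' := σ₁) ?_ hA₁ (by decide) (by decide) (by decide) (by decide)
      (by decide) (by decide)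
    exact ⟨by simp [hI.reg0], by simp [hI.reg1], by simp [hI.reg2], by simp [hI.reg3], hI.adj,
      hI.part⟩
  simp
  refine ⟨by omega, ?_⟩
  refine Runs.cons (T₂ := m * 12 + 18) (readTokens_spec (G := G) (part := part) (ℓ := ℓ) ?_ ?_
    (by simp [e33]) (by simp) hB hm hℓ ?_) ?_ (by omega)
  · exact ⟨by simp [hI₁.reg0], by simp [hI₁.reg1], by simp [hI₁.reg2], by simp [hI₁.reg3], hI₁.adj,
      hI₁.part⟩
  · refine ⟨by simp [e40], by simp, by simp, by simp [e42, stepSum], ?_, fun x => ?_, ?_⟩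
    · simp [e43]
      exact ⟨by simp, by simp, by simp, by simp⟩
    · simp [hσ₁ x x.2, edgeDegree, endPairs]
    · refine ⟨by simp [endPairs], fun C _ x y hxy hx => ?_⟩
      simp only [State.arr_setReg, hσ₁ x x.2, hσ₁ y y.2, Fin.val_inj] at hxy
      rwa [← hxy]
  · simpa [a2] using ht
  rintro σ₂ hA₂ ⟨L, c, hR, hts⟩
  have hI₂ : HoldsInput G part σ₂ := by
    refine HoldsInput.of_agree (p := readTokens) (σ' := σ₂) ?_ hA₂ (by decide) (by decide) (by decide) (by decide)
      (by decide) (by decide)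
    exact ⟨by simp [hI₁.reg0], by simp [hI₁.reg1], by simp [hI₁.reg2], by simp [hI₁.reg3], hI₁.adj,
      hI₁.part⟩
  have f4 := hA₂.reg 4 (by decide)
  simp [e4] at f4
  simp [a2] at hts
  have final : ∀ τ : State, τ.reg 1 = m → τ.reg 2 = 0 → τ.reg 3 = 1 → τ.reg 52 = 0 →
      τ.arr = σ₂.arr → τ.reg 54 = σ₂.arr 8 0 →
      (τ.reg 43 = 1 ↔ σ₂.reg 43 = 1 ∧ c = [] ∧ σ₂.reg 42 ≤ M) →
      Runs B (block [checkParts]) τ (m * 12 + 2) fun σ' =>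
      (σ'.reg 43 = 1 ↔ ∃ L : List (List (Fin n)), IsGood G part (L : Multiset (List (Fin n))) ∧
        stepSum (fun _ => 1) (L : Multiset (List (Fin n))) ≤ M ∧
        (List.range ℓ).map (σ.arr 2) = encodeLists L) := by
    intro τ h1 h2 h3 h52 harr h54 h43
    refine Runs.cons (T₂ := 1) (checkParts_spec h1 h3 h2 h52 (by omega)) ?_ (by omega)
    intro τ' _ hτ'
    rw [show (1 : ℕ) = 0 + 1 by rfl, runs_block_nil, hτ', h43, hR.ok]
    -- Zero parities mean even degrees; agreement of all labels with the label of part 0 means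
    -- connectedness.
    have hpar : (∀ x < m, τ.arr 7 x = 0 ∧ τ.arr 8 x = τ.reg 54) ↔
        EdgeEulerian (endPairs part (L : Multiset (List (Fin n)))) := by
      rw [EdgeEulerian, hR.label.conn_iff ⟨0, hm0⟩, harr, h54]
      constructor
      · intro h
        refine ⟨fun x => ?_, fun x => (h x x.2).2⟩
        rw [Nat.even_iff, ← hR.parity]
        exact (h x x.2).1
      · rintro ⟨h, h'⟩ x hx
        refine ⟨?_, h' ⟨x, hx⟩⟩
        have := hR.parity ⟨x, hx⟩
        rw [Nat.even_iff.1 (h ⟨x, hx⟩)] at this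
        exact this
    rw [hpar]
    constructor
    · rintro ⟨⟨hL, rfl, hE⟩, hEul⟩
      refine ⟨L, ⟨isPartial_nil.1 hL, hEul⟩, ?_, ?_⟩
      · rw [hR.edges] at hE
        simpa using hE
      · rw [hts]; simp [tokens]
    · rintro ⟨L', hL', hM, ht'⟩
      rw [hts] at ht'
      -- An unfinished path would end the token list with a positive token, whereas a nonempty code
      -- ends with `0`.
      have hc : c = [] := by
        by_contra hc
        have h1 := congrArg List.getLast? ht'
        obtain ⟨b, hb⟩ : ∃ b, c.getLast? = some b :=
          ⟨c.getLast hc, List.getLast?_eq_some_getLast hc⟩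
        rcases List.eq_nil_or_concat' L' with rfl | ⟨L'', l, rfl⟩
        · simp [encodeLists, tokens, hc] at ht'
        · rw [encodeLists_append] at h1
          simp [tokens, hb, List.getLast?_append] at h1
      subst hc
      obtain rfl : L = L' := encodeLists_injective (by simpa [tokens] using ht')
      refine ⟨⟨isPartial_nil.2 hL'.1, rfl, ?_⟩, hL'.2⟩
      rw [hR.edges]
      simpa using hM
  have h40 : σ₂.reg 40 = 0 ↔ c = [] := by
    constructor
    · intro h
      by_contra hc
      have := hR.prev (c.getLast hc) (List.getLast?_eq_some_getLast hc)
      omega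
    · exact hR.prev_nil
  have final' : ∀ {T : ℕ} {τ : State}, m * 12 + 2 ≤ T → _ → _ → _ → _ → _ → _ → _ → _ :=
    fun {T τ} hT h1 h2 h3 h4 h5 h6 h7 => (final τ h1 h2 h3 h4 h5 h6 h7).mono hT fun _ _ h => h
  simp [hI₂.reg2, f4, h40]
  constructor
  · intro hc
    refine ⟨fun hM => ⟨by omega, ?_⟩, fun hM => ⟨by omega, ?_⟩⟩
    · refine final' (by omega) ?_ ?_ ?_ ?_ ?_ ?_ ?_ <;>
        simp [hI₂.reg1, hI₂.reg2, hI₂.reg3, hM]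
    · refine final' (by omega) ?_ ?_ ?_ ?_ ?_ ?_ ?_ <;>
        simp [hI₂.reg1, hI₂.reg2, hI₂.reg3, hc, hM]
  · intro hc
    refine ⟨by omega, fun hM => ⟨by omega, ?_⟩, fun hM => ⟨by omega, ?_⟩⟩
    · refine final' (by omega) ?_ ?_ ?_ ?_ ?_ ?_ ?_ <;>
        simp [hI₂.reg1, hI₂.reg2, hI₂.reg3, hc]
    · refine final' (by omega) ?_ ?_ ?_ ?_ ?_ ?_ ?_ <;>
        simp [hI₂.reg1, hI₂.reg2, hI₂.reg3, hc]

end Check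

/-! ### Exhaustive search -/

/-- Translate the digits in array `6` to tokens. -/
def translate : Prog := forTo 34 8 [.load 35 6 34, .load 35 5 35, .store 2 34 35]

/-- Check the initial segments of the token list; if one is fine, record its length. -/
def tryLengths : Prog :=
  forTo 33 9 [checkTokens, .cond (.eq 43 3) (block [.const 31 1, .copy 32 33]) (block [])]

/-- Add `1` to the number with the digits in array `6`. -/
def increment : Prog :=
  forTo 34 8 [.cond (.eq 36 3) (block [.load 35 6 34, .cond (.lt 35 7)
    (block [.add 35 35 3, .store 6 34 35, .const 36 0]) (block [.store 6 34 2])]) (block [])]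

/-- Test one candidate and go to the next one. -/
def searchStep : Prog :=
  block [.const 34 0, translate, .const 33 0, tryLengths, .const 36 1, .const 34 0, increment,
    .cond (.eq 36 3) (block [.const 30 0]) (block []),
    .cond (.eq 31 3) (block [.const 30 0]) (block [])]

/-- Test all candidates until one is fine. -/
def search : Prog := block [.const 30 1, .const 31 0, .loop (.eq 30 3) searchStep]

/-! ### Correctness of the exhaustive search -/

section Search

variable {n m : ℕ} {G : SimpleGraph (Fin n)} {part : Fin n → Fin m}

/-- The first `ℓ` tokens encode a connecting path system with at most `M` edges. -/
def Accepts (G : SimpleGraph (Fin n)) (part : Fin n → Fin m) (M : ℕ) (t : ℕ → ℕ) (ℓ : ℕ) : Prop :=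
  ∃ L : List (List (Fin n)), IsGood G part (L : Multiset (List (Fin n))) ∧
    stepSum (fun _ => 1) (L : Multiset (List (Fin n))) ≤ M ∧ (List.range ℓ).map t = encodeLists L

theorem Accepts.congr {M ℓ : ℕ} {t t' : ℕ → ℕ} (h : Accepts G part M t ℓ)
    (ht : ∀ i < ℓ, t' i = t i) : Accepts G part M t' ℓ := by
  obtain ⟨L, h1, h2, h3⟩ := h
  refine ⟨L, h1, h2, h3 ▸ List.map_congr_left fun i hi => ht i (List.mem_range.1 hi)⟩

/-- The parts of the state that do not change during the search; `s` is the alphabet. -/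
structure SearchCtx (G : SimpleGraph (Fin n)) (part : Fin n → Fin m) (M K N : ℕ) (s : ℕ → ℕ)
    (σ : State) : Prop where
  input : HoldsInput G part σ
  reg4 : σ.reg 4 = M
  reg7 : σ.reg 7 = K
  reg8 : σ.reg 8 = N
  reg9 : σ.reg 9 = N + 1
  arr5 : σ.arr 5 = s

theorem SearchCtx.congr {M K N : ℕ} {s : ℕ → ℕ} {σ σ' : State} (h : SearchCtx G part M K N s σ)
    (hr : ∀ r < 10, σ'.reg r = σ.reg r) (h0 : σ'.arr 0 = σ.arr 0) (h1 : σ'.arr 1 = σ.arr 1)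
    (h5 : σ'.arr 5 = σ.arr 5) : SearchCtx G part M K N s σ' := by
  refine ⟨⟨?_, ?_, ?_, ?_, fun u v => ?_, fun v => ?_⟩, ?_, ?_, ?_, ?_, ?_⟩
  · rw [hr 0 (by omega), h.input.reg0]
  · rw [hr 1 (by omega), h.input.reg1]
  · rw [hr 2 (by omega), h.input.reg2]
  · rw [hr 3 (by omega), h.input.reg3]
  · rw [h0, h.input.adj]
  · rw [h1, h.input.part]
  · rw [hr 4 (by omega), h.reg4]
  · rw [hr 7 (by omega), h.reg7]
  · rw [hr 8 (by omega), h.reg8]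
  · rw [hr 9 (by omega), h.reg9]
  · rw [h5, h.arr5]

theorem SearchCtx.setReg {M K N r x : ℕ} {s : ℕ → ℕ} {σ : State} (h : SearchCtx G part M K N s σ)
    (hr : 10 ≤ r) : SearchCtx G part M K N s (σ.setReg r x) :=
  h.congr (fun r' hr' => by simp [show r' ≠ r by omega]) rfl rfl rfl

theorem SearchCtx.of_agree {p : Prog} {M K N : ℕ} {s : ℕ → ℕ} {σ σ' : State}
    (h : SearchCtx G part M K N s σ) (hA : Agree p σ σ') (hr : ∀ r < 10, r ∉ p.wregs)
    (h0 : 0 ∉ p.warrs) (h1 : 1 ∉ p.warrs) (h5 : 5 ∉ p.warrs) : SearchCtx G part M K N s σ' :=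
  h.congr (fun r hr' => hA.reg r (hr r hr')) (hA.arr 0 h0) (hA.arr 1 h1) (hA.arr 5 h5)

variable {B M K N : ℕ} {s : ℕ → ℕ}

theorem translate_spec {σ : State} (h : SearchCtx G part M K N s σ) (h34 : σ.reg 34 = 0)
    (hB : N < B) : Runs B translate σ (N * 6 + 1) fun σ' =>
      ∀ i < N, σ'.arr 2 i = s (σ.arr 6 i) := by
  refine Runs.mono (Runs.forTo (T := 4) (N := N) (fun k τ => ∀ i < k, τ.arr 2 i = s (σ.arr 6 i))
    (by decide) (by decide) (by decide) (by decide) (by decide) hB h34 h.reg8 h.input.reg3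
    (by simp) ?_) le_rfl fun σ' _ h => h.1
  intro k hk τ hA hτ hI
  have e6 : τ.arr 6 = σ.arr 6 := hA.arr 6 (by decide)
  have e5 : τ.arr 5 = s := (hA.arr 5 (by decide)).trans h.arr5
  simp [hτ, e6, e5]
  intro i hi
  rcases hi.lt_or_eq with hi | rfl
  · simp [hi.ne, hI i hi]
  · simp

/-- The loop does not stop at a success, so a later accepted length overwrites an earlier one;
whichever length is recorded was accepted. -/
theorem tryLengths_spec {σ : State} (h : SearchCtx G part M K N s σ) (hm0 : 0 < m)
    (h33 : σ.reg 33 = 0) (h31 : σ.reg 31 = 0)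
    (hB : n * n + n < B) (hm : m + 1 < B) (hN : N + 1 < B) (ht : ∀ i < N, σ.arr 2 i ≤ n) :
    Runs B tryLengths σ ((N + 1) * (N * (N * 7 + m * 7 + 30) + m * 17 + 40) + 1) fun σ' =>
      σ'.reg 31 = 0 ∧ (∀ ℓ ≤ N, ¬ Accepts G part M (σ.arr 2) ℓ) ∨
      σ'.reg 31 = 1 ∧ Accepts G part M (σ.arr 2) (σ'.reg 32) := by
  refine Runs.mono (Runs.forTo (T := N * (N * 7 + m * 7 + 30) + m * 17 + 36) (N := N + 1)
    (fun k τ => τ.reg 31 = 0 ∧ (∀ ℓ < k, ¬ Accepts G part M (σ.arr 2) ℓ) ∨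
      τ.reg 31 = 1 ∧ Accepts G part M (σ.arr 2) (τ.reg 32))
    (by decide) (by decide) (by decide) (by decide) (by decide) hN h33 h.reg9 h.input.reg3
    (by simp [h31]) ?_) (Nat.add_le_add_right (Nat.mul_le_mul_left _ (by omega)) _)
    fun σ' _ h => by simpa only [Nat.lt_succ_iff] using h.1
  intro k hk τ hA hτ hI
  have e2 : τ.arr 2 = σ.arr 2 := hA.arr 2 (by decide)
  have hτc : SearchCtx G part M K N s τ :=
    h.of_agree hA (by decide) (by decide) (by decide) (by decide)
  have hcheck := checkTokens_spec (B := B) hτc.input hm0 hτ hτc.reg4 hB hm (by omega)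
    (by rw [e2]; exact fun i hi => ht i (by omega))
  have hkN : k * (k * 7 + m * 7 + 30) ≤ N * (N * 7 + m * 7 + 30) :=
    Nat.mul_le_mul (by omega) (by omega)
  refine Runs.cons (T₂ := 6) hcheck ?_ (by omega)
  intro τ' hA' hτ'
  have e31 : τ'.reg 31 = τ.reg 31 := hA'.reg 31 (by decide)
  have e32 : τ'.reg 32 = τ.reg 32 := hA'.reg 32 (by decide)
  have e33 : τ'.reg 33 = k := (hA'.reg 33 (by decide)).trans hτ
  have e3 : τ'.reg 3 = 1 := (hA'.reg 3 (by decide)).trans hτc.input.reg3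
  rw [e2] at hτ'
  change _ ↔ Accepts G part M (σ.arr 2) k at hτ'
  simp [e3, hτ', e33, e31, e32]
  refine ⟨fun hacc => ⟨by omega, hacc⟩, fun hacc => ?_⟩
  rcases hI with ⟨hI, hI'⟩ | hI
  · refine Or.inl ⟨hI, fun ℓ hℓ => ?_⟩
    rcases hℓ.lt_or_eq with hℓ | rfl
    · exact hI' ℓ hℓ
    · exact hacc
  · exact Or.inr hI

/-- The counter `c` may be far too large for a word, so it exists only through its base-`(K + 1)`
digits. Register `36` is the carry: after `k` digits it is set exactly if `(K + 1) ^ k` divides `c +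
1`, and a final carry means overflow. -/
theorem increment_spec {σ : State} {c : ℕ} (h : SearchCtx G part M K N s σ) (h34 : σ.reg 34 = 0)
    (h36 : σ.reg 36 = 1) (hN : N < B) (hK : K < B)
    (hd : ∀ i < N, σ.arr 6 i = c / (K + 1) ^ i % (K + 1)) :
    Runs B increment σ (N * 11 + 1) fun σ' =>
      (∀ i < N, σ'.arr 6 i = (c + 1) / (K + 1) ^ i % (K + 1)) ∧
      (σ'.reg 36 = 1 ↔ (K + 1) ^ N ∣ c + 1) := by
  refine Runs.mono (Runs.forTo (T := 9) (N := N)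
    (fun k τ => (∀ i < k, τ.arr 6 i = (c + 1) / (K + 1) ^ i % (K + 1)) ∧
      (∀ i, k ≤ i → τ.arr 6 i = σ.arr 6 i) ∧
      (τ.reg 36 = 1 ↔ (K + 1) ^ k ∣ c + 1))
    (by decide) (by decide) (by decide) (by decide) (by decide) hN h34 h.reg8 h.input.reg3
    (by simp [h36]) ?_) le_rfl fun σ' _ h => ⟨h.1.1, h.1.2.2⟩
  rintro k hk τ hA hτ ⟨hI1, hI2, hI3⟩
  have hτc : SearchCtx G part M K N s τ :=
    h.of_agree hA (by decide) (by decide) (by decide) (by decide)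
  have hb : 0 < (K + 1) ^ k := by positivity
  have hk6 : τ.arr 6 k = c / (K + 1) ^ k % (K + 1) := (hI2 k le_rfl).trans (hd k hk)
  have hlt : c / (K + 1) ^ k % (K + 1) < K + 1 := Nat.mod_lt _ (by omega)
  have hnot : ¬ (K + 1) ^ k ∣ c + 1 → (c + 1) / (K + 1) ^ k % (K + 1) = c / (K + 1) ^ k % (K + 1) ∧
      ¬ (K + 1) ^ (k + 1) ∣ c + 1 := by
    intro hdiv
    refine ⟨?_, fun h => hdiv ((pow_dvd_pow _ (by omega)).trans h)⟩
    rw [Nat.succ_div_of_not_dvd hdiv]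
  have hdvd : (K + 1) ^ k ∣ c + 1 → (c + 1) / (K + 1) ^ k = c / (K + 1) ^ k + 1 ∧
      ((K + 1) ^ (k + 1) ∣ c + 1 ↔ c / (K + 1) ^ k % (K + 1) = K) := by
    intro hdiv
    have h1 : (c + 1) / (K + 1) ^ k = c / (K + 1) ^ k + 1 := Nat.succ_div_of_dvd hdiv
    refine ⟨h1, ?_⟩
    obtain ⟨q, hq⟩ := hdiv
    rw [hq, Nat.mul_div_cancel_left _ hb] at h1
    rw [hq, pow_succ, Nat.mul_dvd_mul_iff_left hb, h1, Nat.dvd_iff_mod_eq_zero, Nat.add_mod]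
    rcases Nat.eq_zero_or_pos K with rfl | hK0
    · simp [Nat.mod_one]
    · rw [Nat.mod_eq_of_lt (a := 1) (by omega)]
      constructor
      · intro h
        by_contra hne
        rw [Nat.mod_eq_of_lt (by omega)] at h
        omega
      · intro h
        rw [h, Nat.mod_self]
  simp [hτ, hτc.input.reg2, hτc.input.reg3, hτc.reg7, hk6, hI3]
  refine ⟨fun hdiv => ?_, fun hdiv => ?_⟩
  · obtain ⟨h1, h2⟩ := hdvd hdiv
    refine ⟨fun hl => ⟨by omega, by omega, ?_, ?_, ?_⟩, fun hl => ⟨?_, ?_, ?_⟩⟩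
    · intro i hi
      rcases hi.lt_or_eq with hi | rfl
      · simp [hi.ne, hI1 i hi]
      · rw [if_pos rfl, h1, Nat.add_mod, Nat.mod_eq_of_lt (a := 1) (by omega),
          Nat.mod_eq_of_lt (a := _ + 1) (by omega)]
    · intro i hi
      rw [if_neg (by omega), hI2 i (by omega)]
    · rw [h2]; omega
    · intro i hi
      rcases hi.lt_or_eq with hi | rfl
      · simp [hi.ne, hI1 i hi]
      · rw [if_pos rfl, h1]
        have h3 := h2.2 (by omega)
        rw [← h1, eq_comm, ← Nat.dvd_iff_mod_eq_zero, ← Nat.mul_dvd_mul_iff_left hb,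
          Nat.mul_div_cancel' hdiv, ← pow_succ]
        exact h3
    · intro i hi
      rw [if_neg (by omega), hI2 i (by omega)]
    · exact ⟨fun _ => h2.2 (by omega), fun _ => hdiv⟩
  · obtain ⟨h1, h2⟩ := hnot hdiv
    refine ⟨?_, ?_, ?_⟩
    · intro i hi
      rcases hi.lt_or_eq with hi | rfl
      · exact hI1 i hi
      · rw [hk6, h1]
    · exact fun i hi => hI2 i (by omega)
    · exact iff_of_false hdiv h2

/-- A bound on the time for one candidate. -/
def stepTime (m N : ℕ) : ℕ := (N + 1) * (N * (N * 7 + m * 7 + 30) + m * 17 + 60)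

/-- The candidate number `c`. -/
def candidate (s : ℕ → ℕ) (K c : ℕ) (i : ℕ) : ℕ := s (c / (K + 1) ^ i % (K + 1))

theorem searchStep_spec {σ : State} {c : ℕ} (h : SearchCtx G part M K N s σ) (hm0 : 0 < m)
    (h31 : σ.reg 31 = 0) (h30 : σ.reg 30 = 1)
    (hB : n * n + n < B) (hm : m + 1 < B) (hN : N + 1 < B) (hK : K < B) (hs : ∀ j ≤ K, s j ≤ n)
    (hc : c < (K + 1) ^ N) (hd : ∀ i < N, σ.arr 6 i = c / (K + 1) ^ i % (K + 1)) :
    Runs B searchStep σ (stepTime m N) fun σ' =>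
      (∀ i < N, σ'.arr 6 i = (c + 1) / (K + 1) ^ i % (K + 1)) ∧
      (σ'.reg 31 = 0 ∧ (σ'.reg 30 = 1 ↔ c + 1 < (K + 1) ^ N) ∧
          (∀ ℓ ≤ N, ¬ Accepts G part M (candidate s K c) ℓ) ∨
        σ'.reg 31 = 1 ∧ σ'.reg 30 = 0 ∧ Accepts G part M (σ'.arr 2) (σ'.reg 32)) := by
  rw [searchStep, stepTime]
  obtain ⟨T, hT⟩ : ∃ T, T = N * (N * 7 + m * 7 + 30) + m * 17 + 40 := ⟨_, rfl⟩
  have hTT : (N + 1) * (N * (N * 7 + m * 7 + 30) + m * 17 + 60) =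
      (N + 1) * T + N * 20 + 19 + 1 := by
    rw [hT]; ring
  rw [hTT]
  simp
  refine ⟨by omega, ?_⟩
  refine Runs.cons (T₂ := (N + 1) * T + N * 14 + 18) (translate_spec (N := N)
    (h.setReg (by omega)) (by simp) (by omega)) ?_ (by omega)
  intro σ₁ hA₁ hσ₁
  have h₁ : SearchCtx G part M K N s σ₁ :=
    (h.setReg (by omega)).of_agree hA₁ (by decide) (by decide) (by decide) (by decide)
  have e31 := hA₁.reg 31 (by decide)
  have e30 := hA₁.reg 30 (by decide)
  have e6 := hA₁.arr 6 (by decide)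
  simp [h30, h31] at e31 e30 e6 hσ₁
  have hcand : ∀ i < N, σ₁.arr 2 i = candidate s K c i := by
    intro i hi
    rw [hσ₁ i hi, hd i hi, candidate]
  simp
  refine ⟨by omega, ?_⟩
  refine Runs.cons (T₂ := N * 14 + 15) (tryLengths_spec (h₁.setReg (by omega)) hm0 (by simp)
    (by simp [e31]) hB hm hN ?_) ?_ (by rw [← hT]; omega)
  · intro i hi
    simp only [State.arr_setReg]
    rw [hcand i hi, candidate]
    exact hs _ (by have := Nat.mod_lt (c / (K + 1) ^ i) (show 0 < K + 1 by omega); omega)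
  intro σ₂ hA₂ hσ₂
  have h₂ : SearchCtx G part M K N s σ₂ :=
    (h₁.setReg (by omega)).of_agree hA₂ (by decide) (by decide) (by decide) (by decide)
  have f30 := hA₂.reg 30 (by decide)
  have f6 := hA₂.arr 6 (by decide)
  have f2 := hA₂.arr 2 (by decide)
  simp [e30, e6] at f30 f6 f2
  simp only [State.arr_setReg] at hσ₂
  simp
  refine ⟨by omega, by omega, ?_⟩
  refine Runs.cons (T₂ := N * 2 + 10) (increment_spec (c := c) (K := K) (N := N)
    ((h₂.setReg (by omega)).setReg (by omega)) (by simp) (by simp) (by omega) hK ?_) ?_ (by omega)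
  · simpa [f6] using hd
  intro σ₃ hA₃ hσ₃
  have g31 := hA₃.reg 31 (by decide)
  have g30 := hA₃.reg 30 (by decide)
  have g32 := hA₃.reg 32 (by decide)
  have g2 := hA₃.arr 2 (by decide)
  have g3 := hA₃.reg 3 (by decide)
  simp [f30, f2, h₂.input.reg3] at g31 g30 g32 g2 g3
  -- As `c + 1` is at most `(K + 1) ^ N`, overflow happens only after the last candidate.
  have hdiv : (K + 1) ^ N ∣ c + 1 ↔ ¬ c + 1 < (K + 1) ^ N := by
    constructor
    · intro h h'
      exact absurd (Nat.le_of_dvd (by omega) h) (by omega)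
    · intro h'
      rw [show c + 1 = (K + 1) ^ N by omega]
  have hA' : σ₂.reg 31 = 0 → ∀ ℓ ≤ N, ¬ Accepts G part M (candidate s K c) ℓ := by
    intro h0 ℓ hℓ hacc
    rcases hσ₂ with ⟨-, h⟩ | ⟨h, -⟩
    · exact h ℓ hℓ (hacc.congr fun i hi => hcand i (by omega))
    · omega
  simp [g3, hσ₃.2, g31, hdiv, g30, g32, g2]
  grind

theorem search_spec {σ : State} (h : SearchCtx G part M K N s σ) (hm0 : 0 < m)
    (hB : n * n + n < B) (hm : m + 1 < B) (hN : N + 1 < B) (hK : K < B) (hs : ∀ j ≤ K, s j ≤ n)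
    (hd : ∀ i < N, σ.arr 6 i = 0) :
    Runs B search σ ((K + 1) ^ N * (stepTime m N + 1) + 4) fun σ' =>
      σ'.reg 31 = 0 ∧ (∀ c < (K + 1) ^ N, ∀ ℓ ≤ N, ¬ Accepts G part M (candidate s K c) ℓ) ∨
      σ'.reg 31 = 1 ∧ Accepts G part M (σ'.arr 2) (σ'.reg 32) := by
  -- Here `c` is the current candidate, `j` more follow it, and all earlier ones have been rejected.
  have main : ∀ j c σ, c + (j + 1) = (K + 1) ^ N → SearchCtx G part M K N s σ →
      σ.reg 31 = 0 → σ.reg 30 = 1 → (∀ i < N, σ.arr 6 i = c / (K + 1) ^ i % (K + 1)) →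
      (∀ c' < c, ∀ ℓ ≤ N, ¬ Accepts G part M (candidate s K c') ℓ) →
      Runs B (.loop (.eq 30 3) searchStep) σ ((j + 1) * (stepTime m N + 1) + 1) fun σ' =>
        σ'.reg 31 = 0 ∧ (∀ c < (K + 1) ^ N, ∀ ℓ ≤ N, ¬ Accepts G part M (candidate s K c) ℓ) ∨
        σ'.reg 31 = 1 ∧ Accepts G part M (σ'.arr 2) (σ'.reg 32) := by
    intro j
    induction j with
    | zero =>
      intro c σ hc h h31 h30 hd hno
      obtain ⟨t, τ, hE, ht, hτd, hτ⟩ := searchStep_spec h hm0 h31 h30 hB hm hN hK hs (by omega) hd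
      have hh : (Test.eq 30 3).Holds σ := by rw [holds_eq, h30, h.input.reg3]
      have h3 : τ.reg 3 = 1 := (hE.agree.reg 3 (by decide)).trans h.input.reg3
      rcases hτ with ⟨h1, h2, h3'⟩ | ⟨h1, h2, h3'⟩
      · refine ⟨_, τ, .loop_true hh hE (.loop_false ?_), by omega, Or.inl ⟨h1, ?_⟩⟩
        · rw [holds_eq, h3, h2]; omega
        · intro c' hc'
          rcases lt_or_eq_of_le (show c' ≤ c by omega) with h | rfl
          · exact hno c' h
          · exact h3'
      · refine ⟨_, τ, .loop_true hh hE (.loop_false ?_), by omega, Or.inr ⟨h1, h3'⟩⟩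
        rw [holds_eq, h3, h2]; omega
    | succ j ih =>
      intro c σ hc h h31 h30 hd hno
      obtain ⟨t, τ, hE, ht, hτd, hτ⟩ := searchStep_spec h hm0 h31 h30 hB hm hN hK hs (by omega) hd
      have hh : (Test.eq 30 3).Holds σ := by rw [holds_eq, h30, h.input.reg3]
      have h3 : τ.reg 3 = 1 := (hE.agree.reg 3 (by decide)).trans h.input.reg3
      rcases hτ with ⟨h1, h2, h3'⟩ | ⟨h1, h2, h3'⟩
      · obtain ⟨t', τ', hE', ht', hτ'⟩ := ih (c + 1) τ (by omega)
          (h.of_agree hE.agree (by decide) (by decide) (by decide) (by decide)) h1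
          (h2.2 (by omega)) hτd (by
            intro c' hc'
            rcases (Nat.lt_succ_iff.1 hc').lt_or_eq with h | rfl
            · exact hno c' h
            · exact h3')
        refine ⟨_, τ', .loop_true hh hE hE', ?_, hτ'⟩
        rw [add_mul (j + 1)]
        omega
      · refine ⟨_, τ, .loop_true hh hE (.loop_false ?_), ?_, Or.inr ⟨h1, h3'⟩⟩
        · rw [holds_eq, h3, h2]; omega
        · rw [add_mul (j + 1)]; omega
  rw [search]
  simp
  refine ⟨by omega, by omega, ?_⟩
  have hpos : 0 < (K + 1) ^ N := by positivity
  refine Runs.cons (T₂ := 1) (main ((K + 1) ^ N - 1) 0 _ (by omega)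
    ((h.setReg (by omega)).setReg (by omega)) (by simp) (by simp) (by simpa using hd) (by simp))
    (fun σ' _ h' => ?_) (by rw [Nat.sub_add_cancel hpos])
  rw [show (1 : ℕ) = 0 + 1 by rfl, runs_block_nil]
  exact h'

end Search

/-! ### Computing a kernel -/

section KernelEdges

variable {n m : ℕ} {G : SimpleGraph (Fin n)} {part : Fin n → Fin m}
  {F : Finset (Fin n × Fin n)} {k L : ℕ}

/-- The neighbours of `u` in part `W`, when `F` is the set of edges. -/
def nbrs (part : Fin n → Fin m) (F : Finset (Fin n × Fin n)) (u : Fin n) (W : Fin m) :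
    Finset (Fin n) :=
  Finset.univ.filter fun y => ((u, y) ∈ F ∨ (y, u) ∈ F) ∧ part y = W

/-- The edges from part `U` to part `W`. -/
def edgesBetween (part : Fin n → Fin m) (F : Finset (Fin n × Fin n)) (U W : Fin m) :
    Finset (Fin n × Fin n) :=
  F.filter fun e => part e.1 = U ∧ part e.2 = W

/-- An edge that is kept, or is not needed as there are many similar edges. -/
def IsDecided (part : Fin n → Fin m) (k L : ℕ) (F : Finset (Fin n × Fin n)) (u v : Fin n) : Prop :=
  (u, v) ∈ F ∨ k ≤ (nbrs part F u (part v)).card ∨ k ≤ (nbrs part F v (part u)).card ∨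
    L ≤ (edgesBetween part F (part u) (part v)).card

theorem IsDecided.mono {F' : Finset (Fin n × Fin n)} {u v : Fin n} (h : IsDecided part k L F u v)
    (hF : F ⊆ F') : IsDecided part k L F' u v := by
  have h1 : ∀ u W, (nbrs part F u W).card ≤ (nbrs part F' u W).card := fun u W =>
    Finset.card_le_card fun y hy => by
      simp only [nbrs, Finset.mem_filter, Finset.mem_univ, true_and] at hy ⊢
      exact ⟨hy.1.imp (fun h => hF h) (fun h => hF h), hy.2⟩
  have h2 : ∀ U W, (edgesBetween part F U W).card ≤ (edgesBetween part F' U W).card := fun U W =>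
    Finset.card_le_card (Finset.filter_subset_filter _ hF)
  rcases h with h | h | h | h
  · exact Or.inl (hF h)
  · exact Or.inr (Or.inl (h.trans (h1 _ _)))
  · exact Or.inr (Or.inr (Or.inl (h.trans (h1 _ _))))
  · exact Or.inr (Or.inr (Or.inr (h.trans (h2 _ _))))

/-- The sets of edges that the algorithm builds. -/
structure IsSparse (G : SimpleGraph (Fin n)) (part : Fin n → Fin m) (k L : ℕ)
    (F : Finset (Fin n × Fin n)) : Prop where
  lt : ∀ e ∈ F, e.1 < e.2
  adj : ∀ e ∈ F, G.Adj e.1 e.2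
  card_nbrs_le : ∀ u W, (nbrs part F u W).card ≤ k
  card_edgesBetween_le : ∀ U W, (edgesBetween part F U W).card ≤ L

/-- There are `m ^ 2` ordered pairs of parts, each accounting for at most `L` kept edges. -/
theorem IsSparse.card_le (h : IsSparse G part k L F) : F.card ≤ m ^ 2 * L := by
  have := Finset.card_le_mul_card_image_of_maps_to (s := F)
    (t := (Finset.univ : Finset (Fin m × Fin m))) (f := fun e => (part e.1, part e.2)) (by simp) L
    (fun b _ => by
      refine le_trans (Finset.card_le_card fun e he => ?_) (h.card_edgesBetween_le b.1 b.2)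
      simp only [edgesBetween, Finset.mem_filter] at he ⊢
      exact ⟨he.1, by rw [← he.2]; exact ⟨rfl, rfl⟩⟩)
  rw [Finset.card_univ, Fintype.card_prod, Fintype.card_fin] at this
  calc F.card ≤ L * (m * m) := this
    _ = m ^ 2 * L := by ring

/-- Among `k > s` neighbours one avoids `Z`. A vertex of `Z` is an end of at most `2 * k` kept edges
from one part to another, `k` for either position, so `Z` meets at most `2 * s * k < L` of them and
a saturated pair of parts has an edge avoiding `Z`. -/
theorem IsSparse.isKernel {s : ℕ} (h : IsSparse G part k L F) (hk : s < k) (hL : 2 * s * k < L)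
    (hF : ∀ u v, u < v → G.Adj u v → IsDecided part k L F u v) :
    IsKernel G part s fun x y => (x, y) ∈ F ∨ (y, x) ∈ F := by
  classical
  have many : ∀ u W (Z : Finset (Fin n)), Z.card ≤ s → k ≤ (nbrs part F u W).card →
      ∃ y ∉ Z, ((u, y) ∈ F ∨ (y, u) ∈ F) ∧ part y = W := by
    intro u W Z hZ hcard
    obtain ⟨y, hy, hyZ⟩ := Finset.exists_mem_notMem_of_card_lt_card
      (show Z.card < (nbrs part F u W).card by omega)
    simp only [nbrs, Finset.mem_filter, Finset.mem_univ, true_and] at hy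
    exact ⟨y, hyZ, hy⟩
  have manyEdges : ∀ U W (Z : Finset (Fin n)), Z.card ≤ s →
      L ≤ (edgesBetween part F U W).card →
      ∃ x ∉ Z, ∃ y ∉ Z, (x, y) ∈ F ∧ part x = U ∧ part y = W := by
    intro U W Z hZ hcard
    by_contra hcon
    push Not at hcon
    have hsub : edgesBetween part F U W ⊆ Z.biUnion fun z =>
        ((nbrs part F z W).image fun y => (z, y)) ∪ ((nbrs part F z U).image fun y => (y, z)) := by
      rintro ⟨x, y⟩ he
      simp only [edgesBetween, Finset.mem_filter] at he
      obtain ⟨he, hU, hW⟩ := he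
      simp only [Finset.mem_biUnion, Finset.mem_union, Finset.mem_image, nbrs, Finset.mem_filter,
        Finset.mem_univ, true_and]
      by_cases hx : x ∈ Z
      · exact ⟨x, hx, Or.inl ⟨y, ⟨Or.inl he, hW⟩, rfl⟩⟩
      · by_cases hy : y ∈ Z
        · exact ⟨y, hy, Or.inr ⟨x, ⟨Or.inr he, hU⟩, rfl⟩⟩
        · exact absurd hW (hcon x hx y hy he hU)
    have h1 := Finset.card_le_card hsub
    have h2 := Finset.card_biUnion_le_card_mul Z (fun z =>
        ((nbrs part F z W).image fun y => (z, y)) ∪ ((nbrs part F z U).image fun y => (y, z)))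
        (2 * k) (fun z _ => by
          refine (Finset.card_union_le _ _).trans ?_
          have h3 := (Finset.card_image_le (s := nbrs part F z W) (f := fun y => (z, y))).trans
            (h.card_nbrs_le z W)
          have h4 := (Finset.card_image_le (s := nbrs part F z U) (f := fun y => (y, z))).trans
            (h.card_nbrs_le z U)
          omega)
    have h3 : Z.card * (2 * k) ≤ 2 * s * k := by
      calc Z.card * (2 * k) ≤ s * (2 * k) := Nat.mul_le_mul_right _ hZ
        _ = 2 * s * k := by ring
    omega
  refine ⟨fun x y hxy => ?_, fun x y hxy => ?_⟩
  · rcases hxy with hxy | hxy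
    · exact h.adj _ hxy
    · exact (h.adj _ hxy).symm
  · rcases lt_trichotomy x y with hlt | rfl | hlt
    · rcases hF x y hlt hxy with hd | hd | hd | hd
      · exact Or.inl (Or.inl hd)
      · refine Or.inr fun Z hZ => Or.inl ?_
        exact many _ _ Z hZ hd
      · refine Or.inr fun Z hZ => Or.inr (Or.inl ?_)
        obtain ⟨z, hz, hz', hz''⟩ := many _ _ Z hZ hd
        exact ⟨z, hz, hz'.symm, hz''⟩
      · refine Or.inr fun Z hZ => Or.inr (Or.inr ?_)
        obtain ⟨x', hx', y', hy', h1, h2, h3⟩ := manyEdges _ _ Z hZ hd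
        exact ⟨x', hx', y', hy', Or.inl h1, h2, h3⟩
    · exact absurd hxy (G.loopless.irrefl x)
    -- Only increasing pairs are scanned, so here the edge was decided as `(y, x)` and the roles of
    -- its ends are exchanged.
    · rcases hF y x hlt hxy.symm with hd | hd | hd | hd
      · exact Or.inl (Or.inr hd)
      · refine Or.inr fun Z hZ => Or.inr (Or.inl ?_)
        obtain ⟨z, hz, hz', hz''⟩ := many _ _ Z hZ hd
        exact ⟨z, hz, hz'.symm, hz''⟩
      · refine Or.inr fun Z hZ => Or.inl ?_
        exact many _ _ Z hZ hd
      · refine Or.inr fun Z hZ => Or.inr (Or.inr ?_)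
        obtain ⟨x', hx', y', hy', h1, h2, h3⟩ := manyEdges _ _ Z hZ hd
        exact ⟨y', hy', x', hx', Or.inr h1, h3, h2⟩

theorem card_nbrs_insert {u v : Fin n} (huv : u < v) (h1 : (u, v) ∉ F) (h2 : (v, u) ∉ F)
    (x : Fin n) (W : Fin m) : (nbrs part (insert (u, v) F) x W).card =
      (nbrs part F x W).card +
        if x = u ∧ W = part v ∨ x = v ∧ W = part u then 1 else 0 := by
  split_ifs with h
  · rcases h with ⟨rfl, rfl⟩ | ⟨rfl, rfl⟩
    · have : nbrs part (insert (x, v) F) x (part v) = insert v (nbrs part F x (part v)) := by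
        ext y
        simp only [nbrs, Finset.mem_insert, Finset.mem_filter, Finset.mem_univ, true_and,
          Prod.mk.injEq]
        grind
      rw [this, Finset.card_insert_of_notMem]
      simp [nbrs, h1, h2]
    · have : nbrs part (insert (u, x) F) x (part u) = insert u (nbrs part F x (part u)) := by
        ext y
        simp only [nbrs, Finset.mem_insert, Finset.mem_filter, Finset.mem_univ, true_and,
          Prod.mk.injEq]
        grind
      rw [this, Finset.card_insert_of_notMem]
      simp [nbrs, h1, h2]
  · rw [add_zero]
    congr 1
    ext y
    simp only [nbrs, Finset.mem_insert, Finset.mem_filter, Finset.mem_univ, true_and,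
      Prod.mk.injEq]
    grind

theorem card_edgesBetween_insert {u v : Fin n} (h1 : (u, v) ∉ F) (U W : Fin m) :
    (edgesBetween part (insert (u, v) F) U W).card =
      (edgesBetween part F U W).card + if U = part u ∧ W = part v then 1 else 0 := by
  rw [edgesBetween, Finset.filter_insert]
  by_cases h : part u = U ∧ part v = W
  · rw [if_pos h, if_pos ⟨h.1.symm, h.2.symm⟩, Finset.card_insert_of_notMem (by simp [h1])]
    rfl
  · rw [if_neg h, if_neg (fun h' => h ⟨h'.1.symm, h'.2.symm⟩)]
    rfl

theorem index_inj {m a a' b b' : ℕ} (hb : b < m) (hb' : b' < m) :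
    a * m + b = a' * m + b' ↔ a = a' ∧ b = b' := by
  constructor
  · intro h
    have h1 := congrArg (· / m) h
    have h2 := congrArg (· % m) h
    simp only [mul_comm _ m, Nat.mul_add_div (show 0 < m by omega), Nat.mul_add_mod,
      Nat.div_eq_of_lt hb, Nat.div_eq_of_lt hb', Nat.mod_eq_of_lt hb, Nat.mod_eq_of_lt hb'] at h1 h2
    exact ⟨by omega, h2⟩
  · rintro ⟨rfl, rfl⟩; rfl

end KernelEdges

/-- Keep the edge between the vertices in registers `10` and `11`, if there is one, unless there
are many similar edges. -/
def scanPair : List Prog :=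
  [.cond (.lt 10 11) (block [.mul 12 10 0, .add 12 12 11, .load 13 0 12,
    .cond (.eq 13 3) (block [.load 14 1 10, .load 15 1 11, .mul 16 10 1, .add 16 16 15,
      .mul 17 11 1, .add 17 17 14, .mul 18 14 1, .add 18 18 15,
      .load 19 3 16, .load 20 3 17, .load 21 4 18,
      .cond (.lt 19 5) (block [.cond (.lt 20 5) (block [.cond (.lt 21 6) (block
        [.add 19 19 3, .store 3 16 19, .add 20 20 3, .store 3 17 20, .add 21 21 3, .store 4 18 21,
          .add 22 10 3, .add 7 7 3, .store 5 7 22, .add 22 11 3, .add 7 7 3, .store 5 7 22])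
        (block [])]) (block [])]) (block [])]) (block [])]) (block [])]

/-- Compute a kernel. -/
def scan : Prog := forTo 10 0 [.const 11 0, forTo 11 0 scanPair]

/-! ### Correctness of the kernel computation -/

section Scan

variable {n m : ℕ} {G : SimpleGraph (Fin n)} {part : Fin n → Fin m} {k L : ℕ}

/-- The state describes the set `F` of kept edges. -/
structure ScanInv (G : SimpleGraph (Fin n)) (part : Fin n → Fin m) (k L : ℕ)
    (F : Finset (Fin n × Fin n)) (σ : State) : Prop where
  input : HoldsInput G part σ
  reg5 : σ.reg 5 = k
  reg6 : σ.reg 6 = L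
  sparse : IsSparse G part k L F
  arr3 : ∀ (u : Fin n) (W : Fin m), σ.arr 3 (u.val * m + W.val) = (nbrs part F u W).card
  arr4 : ∀ U W : Fin m, σ.arr 4 (U.val * m + W.val) = (edgesBetween part F U W).card
  reg7 : σ.reg 7 = 2 * F.card
  zero : σ.arr 5 0 = 0
  le : ∀ j ≤ σ.reg 7, σ.arr 5 j ≤ n
  mem : ∀ e ∈ F, (∃ j ≤ σ.reg 7, σ.arr 5 j = e.1.val + 1) ∧ ∃ j ≤ σ.reg 7, σ.arr 5 j = e.2.val + 1

theorem ScanInv.congr {F : Finset (Fin n × Fin n)} {σ σ' : State} (h : ScanInv G part k L F σ)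
    (hr : ∀ r < 8, σ'.reg r = σ.reg r) (ha : σ'.arr = σ.arr) : ScanInv G part k L F σ' := by
  have h7 := hr 7 (by omega)
  exact ⟨⟨(hr 0 (by omega)).trans h.input.reg0, (hr 1 (by omega)).trans h.input.reg1,
    (hr 2 (by omega)).trans h.input.reg2, (hr 3 (by omega)).trans h.input.reg3,
    by rw [ha]; exact h.input.adj, by rw [ha]; exact h.input.part⟩,
    (hr 5 (by omega)).trans h.reg5, (hr 6 (by omega)).trans h.reg6, h.sparse,
    by rw [ha]; exact h.arr3, by rw [ha]; exact h.arr4, by rw [h7]; exact h.reg7,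
    by rw [ha]; exact h.zero, by rw [ha, h7]; exact h.le, by rw [ha, h7]; exact h.mem⟩

/-- Array `3` counts kept neighbours by vertex and part, array `4` kept edges by pair of parts.
Array `5` becomes the search alphabet: `0` first, then both ends of every kept edge, possibly with
repetitions, whence the last index `2 * F.card`. -/
theorem scanPair_spec {B : ℕ} {F : Finset (Fin n × Fin n)} {σ : State} {u v : Fin n}
    (h : ScanInv G part k L F σ) (hu : σ.reg 10 = u.val) (hv : σ.reg 11 = v.val)
    (huv : (u, v) ∉ F) (hB : n * n + n < B) (hmn : m ≤ n) (hk : k < B) (hL : L < B)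
    (hK : 2 * (m ^ 2 * L) + 2 < B) :
    Runs B (block scanPair) σ 40 fun σ' => ∃ F' : Finset (Fin n × Fin n), F ⊆ F' ∧
      F' ⊆ insert (u, v) F ∧ ScanInv G part k L F' σ' ∧
      (u < v → G.Adj u v → IsDecided part k L F' u v) := by
  have hI := h.input
  -- All row-major indices stay below `n * n`; for the tables indexed by parts this uses `m ≤ n`.
  have bound : ∀ (a : ℕ), a < n → ∀ c : ℕ, c ≤ n → ∀ d, d < c → a * c + d < n * n := by
    intro a ha c hc d hd
    have h1 : (a + 1) * c ≤ n * n := Nat.mul_le_mul ha hc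
    rw [add_mul] at h1
    omega
  have b1 := bound u u.2 n le_rfl v v.2
  have b2 := bound u u.2 m hmn (part v) (part v).2
  have b3 := bound v v.2 m hmn (part u) (part u).2
  have b4 := bound (part u) (by have := (part u).2; omega) m hmn (part v) (part v).2
  have hun := u.2
  have hvn := v.2
  have hcard := h.sparse.card_le
  have h7 := h.reg7
  simp [scanPair, hu, hv, hI.reg0, hI.reg1, hI.reg3, hI.adj, hI.part, h.reg5, h.reg6, h.arr3, h.arr4]
  refine ⟨fun hlt => ⟨by omega, by omega, fun hadj => ⟨by omega, by omega, by omega, by omega,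
    by omega, by omega, fun c1 => ⟨fun c2 => ⟨fun c3 => ⟨by omega, by omega, by omega, by omega,
      by omega, by omega, by omega, ?_⟩, fun c3 => ?_⟩, fun c2 => ?_⟩, fun c1 => ?_⟩,
      fun hadj => ?_⟩, fun hlt => ?_⟩
  · have hvu : (v, u) ∉ F := fun hmem => absurd (h.sparse.lt _ hmem) (by simpa using hlt.le)
    have hne : u.val ≠ v.val := by omega
    refine ⟨insert (u, v) F, Finset.subset_insert _ _, Finset.Subset.refl _, ?_, fun _ _ =>
      Or.inl (Finset.mem_insert_self _ _)⟩
    refine ⟨?_, by simp [h.reg5], by simp [h.reg6], ?_, ?_, ?_, ?_, ?_, ?_, ?_⟩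
    · exact ⟨by simp [hI.reg0], by simp [hI.reg1], by simp [hI.reg2], by simp [hI.reg3],
        by simpa using hI.adj, by simpa using hI.part⟩
    · refine ⟨?_, ?_, ?_, ?_⟩
      · intro e he
        rcases Finset.mem_insert.1 he with rfl | he
        · exact hlt
        · exact h.sparse.lt e he
      · intro e he
        rcases Finset.mem_insert.1 he with rfl | he
        · exact hadj
        · exact h.sparse.adj e he
      · intro x W
        rw [card_nbrs_insert hlt huv hvu]
        have := h.sparse.card_nbrs_le x W
        grind
      · intro U W
        rw [card_edgesBetween_insert huv]
        have := h.sparse.card_edgesBetween_le U W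
        grind
    · intro x W
      rw [card_nbrs_insert hlt huv hvu]
      simp [index_inj, h.arr3, Fin.val_inj]
      grind
    · intro U W
      rw [card_edgesBetween_insert huv]
      simp [index_inj, h.arr4, Fin.val_inj]
      grind
    · rw [Finset.card_insert_of_notMem huv]
      simp [h7]
      omega
    · simp [h.zero]
    · intro j hj
      simp at hj ⊢
      have := h.le j
      grind
    · intro e he
      simp
      rcases Finset.mem_insert.1 he with rfl | he
      · exact ⟨⟨σ.reg 7 + 1, by omega, by simp⟩, ⟨σ.reg 7 + 1 + 1, by omega, by simp⟩⟩
      · obtain ⟨⟨j, hj, hj'⟩, j', hi, hi'⟩ := h.mem e he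
        refine ⟨⟨j, by omega, ?_⟩, ⟨j', by omega, ?_⟩⟩
        · rw [if_neg (by omega), if_neg (by omega), hj']
        · rw [if_neg (by omega), if_neg (by omega), hi']
  -- In the remaining cases nothing is kept. Either the pair needs no decision or the comparison
  -- that failed supplies the corresponding alternative of `IsDecided`.
  all_goals
    refine ⟨F, Finset.Subset.refl _, Finset.subset_insert _ _, ?_, ?_⟩
  · exact h.congr (fun r hr => by interval_cases r <;> simp) rfl
  · exact fun _ _ => Or.inr (Or.inr (Or.inr (by simpa using c3)))
  · exact h.congr (fun r hr => by interval_cases r <;> simp) rfl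
  · exact fun _ _ => Or.inr (Or.inr (Or.inl (by simpa using c2)))
  · exact h.congr (fun r hr => by interval_cases r <;> simp) rfl
  · exact fun _ _ => Or.inr (Or.inl (by simpa using c1))
  · exact h.congr (fun r hr => by interval_cases r <;> simp) rfl
  · exact fun _ h => absurd h hadj
  · exact h
  · exact fun h => absurd h (not_lt.2 (by simpa using hlt))

theorem scan_spec {B : ℕ} {σ : State} (h : ScanInv G part k L ∅ σ) (h10 : σ.reg 10 = 0)
    (hB : n * n + n < B) (hmn : m ≤ n) (hk : k < B) (hL : L < B) (hK : 2 * (m ^ 2 * L) + 2 < B) :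
    Runs B scan σ (n * (n * 42 + 6) + 1) fun σ' => ∃ F : Finset (Fin n × Fin n),
      ScanInv G part k L F σ' ∧ ∀ u v, u < v → G.Adj u v → IsDecided part k L F u v := by
  refine Runs.mono (Runs.forTo (T := n * 42 + 4) (N := n) (fun i τ =>
    ∃ F : Finset (Fin n × Fin n), ScanInv G part k L F τ ∧ (∀ e ∈ F, e.1.val < i) ∧
      ∀ u v : Fin n, u.val < i → u < v → G.Adj u v → IsDecided part k L F u v)
    (by decide) (by decide) (by decide) (by decide) (by decide) (by omega) h10 h.input.reg0
    h.input.reg3 ⟨∅, h, by simp, by simp⟩ ?_) le_rfl fun σ' _ h' => ?_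
  · rintro i hi τ - hτ ⟨F, hF, hFi, hFd⟩
    simp
    refine ⟨by omega, ?_⟩
    have hF₀ : ScanInv G part k L F (τ.setReg 11 0) :=
      hF.congr (fun r hr => by simp [show r ≠ 11 by omega]) rfl
    -- Inner invariant: all pairs lexicographically before `(i, j)` are decided. Kept edges are
    -- never removed, so `IsDecided.mono` preserves earlier decisions, and the current pair is not
    -- yet kept.
    refine Runs.cons (T₁ := n * 42 + 1) (T₂ := 1) (Runs.forTo (T := 40) (N := n) (fun j τ =>
      ∃ F : Finset (Fin n × Fin n), ScanInv G part k L F τ ∧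
        (∀ e ∈ F, e.1.val < i ∨ e.1.val = i ∧ e.2.val < j) ∧
        ∀ u v : Fin n, u.val < i ∨ u.val = i ∧ v.val < j → u < v → G.Adj u v →
          IsDecided part k L F u v)
      (by decide) (by decide) (by decide) (by decide) (by decide) (by omega) (by simp)
      hF₀.input.reg0 hF₀.input.reg3 ⟨F, hF₀, fun e he => Or.inl (hFi e he),
        fun u v huv => hFd u v (by omega)⟩ ?_) ?_ (by omega)
    · rintro j hj τ' hA' hτ' ⟨F', hF', hFi', hFd'⟩
      have e10 : τ'.reg 10 = i := (hA'.reg 10 (by decide)).trans (by simp [hτ])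
      refine (scanPair_spec (u := ⟨i, hi⟩) (v := ⟨j, hj⟩) hF' e10 hτ' (fun hmem => ?_) hB hmn hk hL
        hK).mono le_rfl ?_
      · have := hFi' _ hmem
        simp at this
      · rintro τ'' - ⟨F'', h1, h2, h3, h4⟩
        refine ⟨F'', h3.congr (fun r hr => by simp [show r ≠ 11 by omega]) rfl, ?_, ?_⟩
        · intro e he
          rcases Finset.mem_insert.1 (h2 he) with rfl | he
          · simp
          · have := hFi' e he
            omega
        · intro u v huv hlt hadj
          by_cases hc : u.val < i ∨ u.val = i ∧ v.val < j
          · exact (hFd' u v hc hlt hadj).mono h1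
          · obtain rfl : u = ⟨i, hi⟩ := Fin.ext (by simp; omega)
            obtain rfl : v = ⟨j, hj⟩ := Fin.ext (by simp; omega)
            exact h4 hlt hadj
    · rintro τ' hA' ⟨⟨F', hF', hFi', hFd'⟩, -⟩
      rw [show (1 : ℕ) = 0 + 1 by rfl, runs_block_nil]
      refine ⟨F', hF'.congr (fun r hr => by simp [show r ≠ 10 by omega]) rfl, ?_, ?_⟩
      · intro a b hab
        have := hFi' _ hab
        simp at this
        omega
      · intro u v hu
        refine hFd' u v ?_
        have := v.2
        omega
  · obtain ⟨⟨F, hF, -, hFd⟩, -⟩ := h'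
    exact ⟨F, hF, fun u v => hFd u v u.2⟩

end Scan

/-! ### The algorithm -/

/-- The main part of the algorithm: compute the parameters, then a kernel, then search. -/
def mainBlock : Prog :=
  block [.const 3 1, .mul 4 1 1, .sub 4 4 1, .add 5 4 4, .add 10 5 5, .add 5 5 3, .mul 6 10 5,
    .add 6 6 3, .add 8 4 4, .add 8 8 4, .add 9 8 3, .const 10 0, scan, search, .copy 0 31,
    .copy 1 32]

/-- The algorithm. -/
def mainProg : Prog := .cond (.eq 1 2) (.copy 0 2) mainBlock

/-! ### The candidates cover all path systems in the kernel -/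

section Candidates

theorem exists_digits {b : ℕ} (hb : 0 < b) (N : ℕ) (d : ℕ → ℕ) (hd : ∀ i, d i < b) :
    ∃ c < b ^ N, ∀ i < N, c / b ^ i % b = d i := by
  induction N generalizing d with
  | zero => exact ⟨0, by simp, by simp⟩
  | succ N ih =>
    obtain ⟨c, hc, h⟩ := ih (fun i => d (i + 1)) (fun i => hd _)
    refine ⟨d 0 + b * c, ?_, fun i hi => ?_⟩
    · have h1 := hd 0
      have h2 : b * (c + 1) ≤ b * b ^ N := Nat.mul_le_mul_left _ hc
      rw [pow_succ']
      rw [mul_add] at h2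
      omega
    · cases i with
      | zero => simp [Nat.add_mul_mod_self_left, Nat.mod_eq_of_lt (hd 0)]
      | succ i =>
        rw [pow_succ', ← Nat.div_div_eq_div_mul, Nat.add_mul_div_left _ _ hb,
          Nat.div_eq_of_lt (hd 0), zero_add]
        exact h i (by omega)

/-- Every vertex of a nontrivial path is an end of one of its edges, hence occurs in the alphabet of
ends of kept edges. -/
theorem exists_rel_of_isChain {V : Type*} {R : V → V → Prop} {l : List V} (h : l.IsChain R)
    (hl : 2 ≤ l.length) {v : V} (hv : v ∈ l) : ∃ w, R v w ∨ R w v := by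
  obtain ⟨A, B, rfl⟩ := List.append_of_mem hv
  cases B with
  | cons w B => exact ⟨w, Or.inl (List.isChain_append_cons_cons.1 h).2.1⟩
  | nil =>
    rcases List.eq_nil_or_concat' A with rfl | ⟨A, w, rfl⟩
    · simp at hl
    · rw [List.append_assoc, List.singleton_append] at h
      exact ⟨w, Or.inr (List.isChain_append_cons_cons.1 h).2.1⟩

variable {n m : ℕ} {G : SimpleGraph (Fin n)} {part : Fin n → Fin m}

/-- A path with `e ≥ 1` edges takes `e + 1` vertex tokens and a terminator, and `e + 2 ≤ 3 * e`.
This is why candidates have `3 * M` digits. -/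
theorem length_encodeLists_le {L : List (List (Fin n))} (h : ∀ l ∈ L, 2 ≤ l.length) :
    (encodeLists L).length ≤ 3 * stepSum (fun _ => 1) (L : Multiset (List (Fin n))) := by
  induction L with
  | nil => simp [encodeLists]
  | cons l L ih =>
    have h1 := h l (by simp)
    have h2 := ih fun l' h' => h l' (by simp [h'])
    rw [← Multiset.cons_coe, stepSum_cons]
    have h3 : encodeLists (l :: L) = tokens l ++ [0] ++ encodeLists L := by simp [encodeLists]
    have h4 : (tokens l).length = l.length := by simp [tokens]
    have h5 : ((stepPairs l).map fun _ => 1).sum = l.length - 1 := by simp [length_stepPairs]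
    rw [h3, h5]
    simp only [List.length_append, List.length_singleton, h4]
    omega

/-- If all vertices belong to the alphabet, then the search finds the path system. -/
theorem exists_candidate {K M : ℕ} {s : ℕ → ℕ} {L : List (List (Fin n))} (hs : s 0 = 0)
    (hL : IsGood G part (L : Multiset (List (Fin n))))
    (hM : stepSum (fun _ => 1) (L : Multiset (List (Fin n))) ≤ M)
    (hlen : ∀ l ∈ L, 2 ≤ l.length) (hmem : ∀ l ∈ L, ∀ v ∈ l, ∃ j ≤ K, s j = v.val + 1) :
    ∃ c < (K + 1) ^ (3 * M), ∃ ℓ ≤ 3 * M, Accepts G part M (candidate s K c) ℓ := by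
  have hle := length_encodeLists_le hlen
  -- Digits beyond the end of the code are arbitrary and padded with 0, since all prefixes of a
  -- candidate are tried.
  have hd : ∀ i, ∃ j < K + 1, ∀ h : i < (encodeLists L).length, s j = (encodeLists L)[i] := by
    intro i
    by_cases hi : i < (encodeLists L).length
    · have hx : (encodeLists L)[i] ∈ encodeLists L := List.getElem_mem hi
      simp only [encodeLists, List.mem_flatMap, List.mem_append, tokens, List.mem_map,
        List.mem_singleton] at hx
      obtain ⟨l, hl, ⟨v, hv, hv'⟩ | h0⟩ := hx
      · obtain ⟨j, hj, hj'⟩ := hmem l hl v hv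
        exact ⟨j, by omega, fun _ => hj'.trans hv'⟩
      · exact ⟨0, by omega, fun _ => hs.trans h0.symm⟩
    · exact ⟨0, by omega, fun h => absurd h hi⟩
  choose d hd1 hd2 using hd
  obtain ⟨c, hc, hcd⟩ := exists_digits (by omega) (3 * M) d hd1
  refine ⟨c, hc, (encodeLists L).length, by omega, L, hL, hM, ?_⟩
  refine List.ext_getElem (by simp) fun i h1 h2 => ?_
  simp only [List.getElem_map, List.getElem_range, candidate]
  rw [hcd i (by omega), hd2 i h2]

end Candidates

/-! ### Correctness of the whole algorithm -/

section Main

variable {n m : ℕ} {G : SimpleGraph (Fin n)} {part : Fin n → Fin m}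

/-- The number of edges that suffice. -/
def edgeBound (m : ℕ) : ℕ := m ^ 2 - m

/-- More similar edges than this are never needed. -/
def classBound (m : ℕ) : ℕ := 4 * edgeBound m * (2 * edgeBound m + 1) + 1

theorem edgeBound_le (m : ℕ) : edgeBound m ≤ m ^ 2 := Nat.sub_le _ _

theorem classBound_le {m : ℕ} (hm : 0 < m) : classBound m ≤ 13 * m ^ 4 := by
  have h := edgeBound_le m
  have h1 : 1 ≤ m ^ 2 := Nat.one_le_pow _ _ hm
  rw [classBound]
  generalize edgeBound m = e at h
  have h2 : m ^ 4 = m ^ 2 * m ^ 2 := by ring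
  rw [h2]
  generalize m ^ 2 = q at h h1
  nlinarith

theorem sq_mul_classBound_le {m : ℕ} (hm : 0 < m) : m ^ 2 * classBound m ≤ 13 * m ^ 6 := by
  calc m ^ 2 * classBound m ≤ m ^ 2 * (13 * m ^ 4) := Nat.mul_le_mul_left _ (classBound_le hm)
    _ = 13 * m ^ 6 := by ring

theorem solves_of_accepts {σ : State} (hm0 : 0 < m) (h0 : σ.reg 0 = 1)
    (h : Accepts G part (edgeBound m) (σ.arr 2) (σ.reg 1)) : Solves G part σ := by
  have : Nonempty (Fin m) := ⟨⟨0, hm0⟩⟩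
  obtain ⟨L, hL, hM, ht⟩ := h
  obtain ⟨P, rfl⟩ := PathSystem.exists_lists_eq hL.1
  have hP : P.IsConnecting part := (P.isConnecting_iff).2 ⟨inferInstance, hL.2⟩
  refine ⟨fun _ => ⟨h0, P, hP, ?_, ?_⟩, fun h => absurd ⟨P, hP⟩ h⟩
  · rw [P.edgeCount_eq]; exact hM
  · rw [P.encode_eq]; exact ht

theorem holdsInput_inputState :
    HoldsInput G part ((inputState G part).setReg 3 1) := by
  refine ⟨by simp [inputState], by simp [inputState], by simp [inputState], by simp, ?_, ?_⟩
  · intro u v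
    rw [State.arr_setReg]
    have : (∃ u' v' : Fin n, u.val * n + v.val = u'.val * n + v'.val ∧ G.Adj u' v') ↔ G.Adj u v := by
      constructor
      · rintro ⟨u', v', h, hadj⟩
        obtain ⟨h1, h2⟩ := (index_inj v.2 v'.2).1 h
        rwa [Fin.ext h1, Fin.ext h2]
      · exact fun h => ⟨u, v, rfl, h⟩
    classical
    have h0 : (inputState G part).arr 0 (u.val * n + v.val) =
        if ∃ u' v' : Fin n, u.val * n + v.val = u'.val * n + v'.val ∧ G.Adj u' v' then 1 else 0 := rfl
    rw [h0, ← this]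
    split_ifs with h <;> simp [h]
  · intro v
    simp [inputState]

theorem mainBlock_spec {B : ℕ} (hm0 : 0 < m) (hmn : m ≤ n) (hB : (n + 2) ^ 20 ≤ B) :
    ∃ K ≤ 26 * m ^ 6, Runs B mainBlock (inputState G part)
      (n * (n * 42 + 6) + (K + 1) ^ (3 * edgeBound m) * (stepTime m (3 * edgeBound m) + 1) + 30)
      (Solves G part) := by
  obtain ⟨M, hM⟩ : ∃ M, M = edgeBound m := ⟨_, rfl⟩
  obtain ⟨L, hL⟩ : ∃ L, L = classBound m := ⟨_, rfl⟩
  have hL' : L = 4 * M * (2 * M + 1) + 1 := by rw [hL, classBound, hM]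
  have hmL := sq_mul_classBound_le hm0
  have hmn6 : m ^ 6 ≤ n ^ 6 := Nat.pow_le_pow_left hmn 6
  have hMm : M ≤ m ^ 2 := by rw [hM]; exact edgeBound_le m
  -- Since `m ≤ n`, the numbers computed, of order at most `m ^ 6` or `n ^ 2`, all fit below this
  -- bound.
  have hbig : 100 * (n + 2) ^ 6 ≤ B := by
    refine le_trans ?_ hB
    calc 100 * (n + 2) ^ 6 ≤ (n + 2) ^ 14 * (n + 2) ^ 6 := by
          refine Nat.mul_le_mul_right _ ?_
          calc 100 ≤ 2 ^ 14 := by norm_num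
            _ ≤ (n + 2) ^ 14 := Nat.pow_le_pow_left (by omega) _
      _ = (n + 2) ^ 20 := by ring
  have hn6 : n ^ 6 ≤ (n + 2) ^ 6 := Nat.pow_le_pow_left (by omega) _
  have hn2 : (n + 2) ^ 2 ≤ (n + 2) ^ 6 := Nat.pow_le_pow_right (by omega) (by omega)
  have hnn : n * n + n + n + 4 ≤ (n + 2) ^ 2 := by nlinarith
  have hm2 : m * m ≤ n * n := Nat.mul_le_mul hmn hmn
  have hmsq : m ^ 2 = m * m := sq m
  have hMe : m * m - m = M := by rw [hM, edgeBound, hmsq]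
  have hLle : L ≤ m ^ 2 * L := Nat.le_mul_of_pos_left _ (by positivity)
  have hLB : 4 * M * (2 * M + 1) + 1 < B := by rw [← hL']; rw [← hL] at hmL; omega
  rw [← hL] at hmL
  set σ₀ := inputState G part with hσ₀
  have r0 : σ₀.reg 0 = n := by simp [hσ₀, inputState]
  have r1 : σ₀.reg 1 = m := by simp [hσ₀, inputState]
  have rest : ∀ r, 2 ≤ r → σ₀.reg r = 0 := fun r hr => by
    simp [hσ₀, inputState, show r ≠ 0 by omega, show r ≠ 1 by omega]
  have arest : ∀ k, 2 ≤ k → ∀ i, σ₀.arr k i = 0 := fun r hr => by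
    simp [hσ₀, inputState, show r ≠ 0 by omega, show r ≠ 1 by omega]
  have hinput := holdsInput_inputState (G := G) (part := part)
  rw [← hσ₀] at hinput
  set σ₁ : State := (((((((((((σ₀.setReg 3 1).setReg 4 (m * m)).setReg 4 M).setReg 5 (M + M)).setReg
    10 (M + M + (M + M))).setReg 5 (M + M + 1)).setReg 6 ((M + M + (M + M)) * (M + M + 1))).setReg 6
    ((M + M + (M + M)) * (M + M + 1) + 1)).setReg 8 (M + M)).setReg 8 (M + M + M)).setReg
    9 (M + M + M + 1)).setReg 10 0 with hσ₁
  have hLL : (M + M + (M + M)) * (M + M + 1) + 1 = L := by rw [hL']; ring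
  have hstart : ∀ {T Q}, Runs B (block [scan, search, .copy 0 31, .copy 1 32]) σ₁ T Q →
      Runs B mainBlock σ₀ (T + 12) Q := by
    intro T Q h
    rw [mainBlock]
    simp [r1, hMe]
    refine ⟨by omega, by omega, by omega, by omega, by omega, by omega, by omega, by omega,
      by omega, by omega, by omega, h⟩
  have hscan : ScanInv G part (2 * M + 1) L ∅ σ₁ := by
    refine ⟨⟨?_, ?_, ?_, ?_, ?_, ?_⟩, ?_, ?_, ⟨by simp, by simp, ?_, ?_⟩, ?_, ?_, ?_, ?_, ?_, ?_⟩
    · simp [hσ₁, r0]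
    · simp [hσ₁, r1]
    · simp [hσ₁, rest]
    · simp [hσ₁]
    · exact hinput.adj
    · exact hinput.part
    · simp [hσ₁]; omega
    · simp [hσ₁, hLL]
    · simp [nbrs]
    · simp [edgesBetween]
    · simp [nbrs, hσ₁, arest]
    · simp [edgesBetween, hσ₁, arest]
    · simp [hσ₁, rest]
    · simp [hσ₁, arest]
    · simp [hσ₁, arest]
    · simp
  obtain ⟨t₂, σ₂, hE₂, ht₂, F, hF, hFd⟩ := scan_spec (B := B) hscan (by simp [hσ₁]) (by omega) hmn
    (by omega) (by omega) (by omega)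
  have hcard := hF.sparse.card_le
  -- With `s = 2 * M`, the number of vertices to avoid, the thresholds are `k = s + 1` and `L = 2 *
  -- s * k + 1`, the least ones allowed.
  have hker := hF.sparse.isKernel (s := 2 * M) (by omega)
    (by rw [hL', show 2 * (2 * M) * (2 * M + 1) = 4 * M * (2 * M + 1) by ring]; omega) hFd
  have s4 : σ₂.reg 4 = M := (hE₂.agree.reg 4 (by decide)).trans (by simp [hσ₁])
  have s8 : σ₂.reg 8 = 3 * M := (hE₂.agree.reg 8 (by decide)).trans (by simp [hσ₁]; omega)
  have s9 : σ₂.reg 9 = 3 * M + 1 := (hE₂.agree.reg 9 (by decide)).trans (by simp [hσ₁]; omega)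
  have s6 : σ₂.arr 6 = σ₀.arr 6 := hE₂.agree.arr 6 (by decide)
  have hctx : SearchCtx G part M (2 * F.card) (3 * M) (σ₂.arr 5) σ₂ :=
    ⟨hF.input, s4, hF.reg7, s8, s9, rfl⟩
  refine ⟨2 * F.card, by omega, ?_⟩
  have hsearch := search_spec (B := B) hctx hm0 (by omega) (by omega) (by omega) (by omega)
    (by rw [← hF.reg7]; exact hF.le) (fun i _ => by rw [s6, arest 6 (by omega)])
  rw [← hM]
  set X := (2 * F.card + 1) ^ (3 * M) * (stepTime m (3 * M) + 1) with hX
  refine Runs.mono (hstart (T := n * (n * 42 + 6) + X + 9) ?_) (by omega) fun σ' _ h => h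
  refine Runs.cons (T₂ := X + 8) ⟨t₂, σ₂, hE₂, ht₂, rfl⟩ ?_ (by omega)
  rintro _ - rfl
  refine Runs.cons (T₂ := 3) hsearch ?_ (by omega)
  rintro σ₃ - hσ₃
  simp
  rcases hσ₃ with ⟨h31, hno⟩ | ⟨h31, hacc⟩
  · have hnone : ¬ ∃ P : PathSystem G, P.IsConnecting part := by
      rintro ⟨P, hP⟩
      have hgood : IsGood G part (P.lists : Multiset (List (Fin n))) :=
        ⟨P.isPathFamily, ((P.isConnecting_iff).1 hP).2⟩
      -- A hypothetical system is first shortened to `M` edges, then moved into the kernel, and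
      -- finally coded as a candidate in some order of its paths. The search would have accepted it.
      obtain ⟨S₁, g1, g2⟩ := hgood.exists_stepSum_le
      rw [Fintype.card_fin] at g2
      obtain ⟨S₂, g3, g4, g5, g6⟩ := g1.exists_in_kernel hker (by rw [hM]; exact g2)
      induction S₂ using Quot.inductionOn with
      | _ L₂ =>
      obtain ⟨c, hc, ℓ, hℓ, hacc⟩ := exists_candidate (K := 2 * F.card) hF.zero g3 g4 g5
        (fun l hl v hv => by
          obtain ⟨w, hw⟩ := exists_rel_of_isChain (g6 l hl) (g5 l hl) hv
          rw [← hF.reg7]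
          rcases hw with (hw | hw) | (hw | hw)
          · exact (hF.mem _ hw).1
          · exact (hF.mem _ hw).2
          · exact (hF.mem _ hw).2
          · exact (hF.mem _ hw).1)
      exact hno c hc ℓ hℓ hacc
    exact ⟨fun h => absurd h hnone, fun _ => by simp [h31]⟩
  · refine solves_of_accepts hm0 (by simp [h31]) ?_
    simpa [hM] using hacc

end Main

/-! ### The running time -/

/-- For `m ≥ 2` the constant is absorbed by `32 ≤ m ^ 5`, so `K + 1 ≤ m ^ 11`. For `m = 1` this is
impossible, but then the exponent `edgeBound 1` is 0. -/
theorem pow_searchSize_le {m K : ℕ} (hm : 0 < m) (hK : K ≤ 26 * m ^ 6) :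
    (K + 1) ^ (3 * edgeBound m) ≤ m ^ (33 * m ^ 2) := by
  rcases Nat.lt_or_ge m 2 with h | h
  · obtain rfl : m = 1 := by omega
    simp [edgeBound]
  · have h1 : K + 1 ≤ m ^ 11 := by
      have h2 : 32 ≤ m ^ 5 := by
        calc 32 = 2 ^ 5 := by norm_num
          _ ≤ m ^ 5 := Nat.pow_le_pow_left h 5
      have h3 : 1 ≤ m ^ 6 := Nat.one_le_pow _ _ hm
      calc K + 1 ≤ 32 * m ^ 6 := by omega
        _ ≤ m ^ 5 * m ^ 6 := Nat.mul_le_mul_right _ h2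
        _ = m ^ 11 := by ring
    calc (K + 1) ^ (3 * edgeBound m) ≤ (m ^ 11) ^ (3 * edgeBound m) := Nat.pow_le_pow_left h1 _
      _ = m ^ (33 * edgeBound m) := by rw [← pow_mul]; congr 1; ring
      _ ≤ m ^ (33 * m ^ 2) := Nat.pow_le_pow_right hm (Nat.mul_le_mul_left _ (edgeBound_le m))

theorem stepTime_le {m : ℕ} (hm : 0 < m) : stepTime m (3 * edgeBound m) + 1 ≤ 1005 * m ^ 6 := by
  have aux : ∀ e q : ℕ, e ≤ q → 1 ≤ q → m ≤ q →
      (3 * e + 1) * (3 * e * (3 * e * 7 + m * 7 + 30) + m * 17 + 60) + 1 ≤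
        1005 * (q * (q * q)) := by
    intro e q h h1 h2
    have h3 : 3 * e * (3 * e * 7 + m * 7 + 30) ≤ 3 * q * (58 * q) :=
      Nat.mul_le_mul (by omega) (by omega)
    have h4 : q ≤ q * q := Nat.le_mul_of_pos_left _ h1
    have h5 : 3 * q * (58 * q) = 174 * (q * q) := by ring
    have h6 : (3 * e + 1) * (3 * e * (3 * e * 7 + m * 7 + 30) + m * 17 + 60) ≤
        (4 * q) * (251 * (q * q)) := Nat.mul_le_mul (by omega) (by omega)
    have h7 : 1 ≤ q * (q * q) := Nat.mul_pos h1 (Nat.mul_pos h1 h1)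
    have h8 : (4 * q) * (251 * (q * q)) = 1004 * (q * (q * q)) := by ring
    rw [h8] at h6
    linarith
  rw [stepTime, show m ^ 6 = m ^ 2 * (m ^ 2 * m ^ 2) by ring]
  exact aux _ _ (edgeBound_le m) (Nat.one_le_pow _ _ hm) (Nat.le_self_pow (by omega) m)

theorem searchTime_le {m K C : ℕ} (hm : 0 < m) (hK : K ≤ 26 * m ^ 6) (hC : 2000 ≤ C) :
    (K + 1) ^ (3 * edgeBound m) * (stepTime m (3 * edgeBound m) + 1) ≤ C * m ^ (C * m ^ 2) := by
  have h1 : 1 ≤ m ^ 2 := Nat.one_le_pow _ _ hm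
  have h2 : 2000 * m ^ 2 ≤ C * m ^ 2 := Nat.mul_le_mul_right _ hC
  calc (K + 1) ^ (3 * edgeBound m) * (stepTime m (3 * edgeBound m) + 1)
      ≤ m ^ (33 * m ^ 2) * (1005 * m ^ 6) := Nat.mul_le_mul (pow_searchSize_le hm hK) (stepTime_le hm)
    _ = 1005 * m ^ (33 * m ^ 2 + 6) := by rw [pow_add]; ring
    _ ≤ C * m ^ (C * m ^ 2) :=
      Nat.mul_le_mul (by omega) (Nat.pow_le_pow_right hm (by omega))

/-- The algorithm is correct and meets the time bound. -/
theorem mainProg_spec {n m C : ℕ} (hC : 2000 ≤ C) (G : SimpleGraph (Fin n)) (part : Fin n → Fin m)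
    (hpart : Function.Surjective part) :
    ∃ (t : ℕ) (σ : State), Exec ((n + 2) ^ C) mainProg (inputState G part) t σ ∧
      Solves G part σ ∧
      (t : ℝ) ≤ C * (m : ℝ) ^ (C * m ^ 2) + C * ((m : ℝ) ^ 2 * (n : ℝ) ^ ((5 : ℝ) / 2)) := by
  have hC' : (2000 : ℝ) ≤ C := by exact_mod_cast hC
  rcases Nat.eq_zero_or_pos m with rfl | hm
  · have hnone : ¬ ∃ P : PathSystem G, P.IsConnecting part := by
      rintro ⟨P, hP⟩
      obtain ⟨⟨x⟩, -⟩ := (P.isConnecting_iff).1 hP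
      exact x.elim0
    -- Without parts the reduced multigraph is empty and nothing is connecting. The two steps are
    -- paid for by `C * 0 ^ 0 = C`.
    refine ⟨1 + 1, _, .cond_true ?_ (.copy _ 0 2), ⟨fun h => absurd h hnone, fun _ => ?_⟩, ?_⟩
    · simp [inputState]
    · simp [inputState]
    · norm_num
      linarith
  · have hmn : m ≤ n := by simpa using Fintype.card_le_of_surjective part hpart
    obtain ⟨K, hK, t, σ, hE, ht, hσ⟩ := mainBlock_spec (B := (n + 2) ^ C) (G := G)
      (part := part) hm hmn (Nat.pow_le_pow_right (by omega) (by omega))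
    refine ⟨t + 1, σ, .cond_false ?_ hE, hσ, ?_⟩
    · simp [inputState]
      omega
    · have h1 := searchTime_le hm hK hC
      have hn : 1 ≤ n := by omega
      -- Everything outside the search is quadratic in `n`, and `n ≥ 1` absorbs the lower order
      -- terms.
      have h2 : t + 1 ≤ C * m ^ (C * m ^ 2) + 2000 * n ^ 2 := by
        have h3 : n * (n * 42 + 6) = 42 * n ^ 2 + 6 * n := by ring
        have h4 : n ≤ n ^ 2 := Nat.le_self_pow (by omega) n
        omega
      have h3 : (n : ℝ) ^ 2 ≤ (n : ℝ) ^ ((5 : ℝ) / 2) := by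
        rw [← Real.rpow_natCast]
        exact Real.rpow_le_rpow_of_exponent_le (by exact_mod_cast hn) (by norm_num)
      have h4 : (1 : ℝ) ≤ (m : ℝ) ^ 2 := one_le_pow₀ (by exact_mod_cast hm)
      have h5 : (n : ℝ) ^ 2 ≤ (m : ℝ) ^ 2 * (n : ℝ) ^ ((5 : ℝ) / 2) :=
        h3.trans (le_mul_of_one_le_left (by positivity) h4)
      calc ((t + 1 : ℕ) : ℝ) ≤ ((C * m ^ (C * m ^ 2) + 2000 * n ^ 2 : ℕ) : ℝ) := by
            exact_mod_cast h2
        _ = C * (m : ℝ) ^ (C * m ^ 2) + 2000 * (n : ℝ) ^ 2 := by push_cast; ring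
        _ ≤ C * (m : ℝ) ^ (C * m ^ 2) +
            C * ((m : ℝ) ^ 2 * (n : ℝ) ^ ((5 : ℝ) / 2)) := by gcongr

end PathSystems

theorem mainTheorem7 :
    ∃ (p : PathSystems.Prog) (C : ℕ),
      ∀ (n m : ℕ) (G : SimpleGraph (Fin n)) (part : Fin n → Fin m), Function.Surjective part →
        ∃ (t : ℕ) (σ : PathSystems.State),
          PathSystems.Exec ((n + 2) ^ C) p (PathSystems.inputState G part) t σ ∧
          PathSystems.Solves G part σ ∧
          (t : ℝ) ≤ C * (m : ℝ) ^ (C * m ^ 2) + C * ((m : ℝ) ^ 2 * (n : ℝ) ^ ((5 : ℝ) / 2)) :=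
  ⟨PathSystems.mainProg, 2000, fun _ _ G part hpart => PathSystems.mainProg_spec le_rfl G part hpart⟩
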